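/- Let $d\in\mathbb N$, $\gamma\ge 0$, $0<\alpha_T<\tfrac12$, $0<\alpha_S<\tfrac d2$. Let $Z=\{Z(\mathbf x,t):\mathbf x\in\mathbb R^{d+1},\,t\in\mathbb R\}$ be a (jointly measurable) zero-mean Gaussian random field with variance one, mean-square continuous, homogeneous and isotropic in space and stationary in time, with covariance $E[Z(\mathbf x,t)Z(\mathbf y,s)]=C_Z(\|\mathbf x-\mathbf y\|,|t-s|)$. Write $\mathbb S_d(R)=\{\mathbf x\in\mathbb R^{d+1}:\|\mathbf x\|=R\}$, let $d\nu$ be its non-normalized Riemannian surface measure, and put $\mathbb T(T)=[-T,T]$. Let $\mathcal L$ be a positive function, slowly varying at infinity ($\mathcal L(cT)/\mathcal L(T)\to1$ as $T\to\infty$ for every $c>0$). Assume: (A0) For every $T\ge1$ there are an orthonormal basis $\{\phi_k\}_{k\ge1}$ of $L^2(\mathbb T(T),dt)$ and nonnegative coefficients $B_n(0,T^\gamma)$, $B_{n,k}(T)$ ($n\ge 0$, $k\ge1$) such that, for all $\mathbf x,\mathbf y\in\mathbb S_d(T^\gamma)$ and $t,s\in\mathbb T(T)$, $$C_Z(\|\mathbf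 x-\mathbf y\|,|t-s|)=\sum_{n\ge0}B_n(0,T^\gamma)\sum_{k\ge1}B_{n,k}(T)\sum_{j=1}^{\Gamma(n,d)}S_{n,j}(\mathbf x)S_{n,j}(\mathbf y)\,\phi_k(t)\phi_k(s),$$ where $\{S_{n,j}\}_{j\le\Gamma(n,d)}$ is an orthonormal basis in $L^2(\mathbb S_d(T^\gamma),d\nu)$ of the $n$-th eigenspace of the Laplace–Beltrami operator (obtained by rescaling a fixed basis on $\mathbb S_d(1)$), and $\Gamma(n,d)$ is the dimension of this eigenspace. (A1) For all $\mathbf x\neq\mathbf 0$ and $\tau\ne0$, as $T\to\infty$, the ratio of $C_Z(\|T^\gamma\mathbf x\|,|T\tau|)$ and $\dfrac{\mathcal L(T)\mathcal L(T^\gamma)}{|T\tau|^{\alpha_T}\|T^\gamma\mathbf x\|^{\alpha_S}}$ tends to $1$. (A2) For every $m\ge2$ and all sufficiently large $T$, with cyclic indices ($m+1:=1$), $$\int_{\mathbb S_d(1)^m\times\mathbb T(1)^m}\prod_{i=1}^{m}\frac{\mathcal L(T|t_i-t_{i+1}|)\,\mathcal L(T^\gamma\|\mathbf x_i-\mathbf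 x_{i+1}\|)}{\mathcal L(T)\mathcal L(T^\gamma)|t_i-t_{i+1}|^{\alpha_T}\|\mathbf x_i-\mathbf x_{i+1}\|^{\alpha_S}}\prod_{i=1}^m d\nu(\mathbf x_i)dt_i\le c_m ,$$ where $$c_m=\int_{\mathbb S_d(1)^m\times\mathbb T(1)^m}\prod_{i=1}^{m}\frac{1}{|t_i-t_{i+1}|^{\alpha_T}\|\mathbf x_i-\mathbf x_{i+1}\|^{\alpha_S}}\prod_{i=1}^m d\nu(\mathbf x_i)dt_i .$$ Let $d_T=T^{\gamma(d-\alpha_S)}T^{1-\alpha_T}\mathcal L(T)\mathcal L(T^\gamma)$ and $$S_T=\frac1{d_T}\int_{\mathbb T(T)}\int_{\mathbb S_d(T^\gamma)}\bigl(Z^2(\mathbf x,t)-1\bigr)\,d\nu(\mathbf x)\,dt .$$ Then $c_m<\infty$ for all $m\ge2$, and $S_T$ converges in distribution, as $T\to\infty$, to a random variable $S_\infty$ whose characteristic function is $$\psi(\xi)=E\bigl[e^{i\xi S_\infty}\bigr]=\exp\Bigl(\tfrac12\Phi(\xi)\Bigr),\qquad \xi\in\mathbb R,$$ where $\Phi:\mathbb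 R\to\mathbb C$ is real-analytic on the whole line, the series $\sum_{m\ge2}\frac{(2i\xi)^m}{m}c_m$ converges absolutely in a neighbourhood of $\xi=0$, and $$\Phi(\xi)=\sum_{m=2}^{\infty}\frac{(2i\xi)^m}{m}c_m$$ for every $\xi\in\mathbb R$ at which this series converges absolutely. In other words, $\psi(\xi)=\exp\bigl(\tfrac12\sum_{m\ge2}\frac{(2i\xi)^m}{m}c_m\bigr)$, the series being continued analytically along $\mathbb R$ beyond its interval of convergence. -/

import Mathlib

open MeasureTheory ProbabilityTheory Filter Topology Set

noncomputable section

namespace SphereNCLT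

/-- The ambient Euclidean space `ℝ^{d+1}`. -/
abbrev E (d : ℕ) : Type := EuclideanSpace ℝ (Fin (d + 1))

/-- The unit sphere `S_d(1)` in `ℝ^{d+1}`. -/
abbrev Sph (d : ℕ) : Type := Metric.sphere (0 : E d) 1

/-- The (non-normalized) Riemannian surface measure on the unit sphere `S_d(1)`. -/
def unitSurface (d : ℕ) : Measure (Sph d) := (volume : Measure (E d)).toSphere

/-- The (non-normalized) Riemannian surface measure on the sphere `S_d(R)` of radius `R`, as a
measure on `ℝ^{d+1}`: the image of the unit surface measure under `u ↦ R u`, multiplied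
by `R ^ d`. -/
def surfaceMeasure (d : ℕ) (R : ℝ) : Measure (E d) :=
  ENNReal.ofReal (R ^ d) • (unitSurface d).map (fun u : Sph d => R • (u : E d))

/-! ### Spherical harmonics -/

/-- `f` is an eigenfunction (or zero) of the Laplace--Beltrami operator of `S_d(1)` for its `n`-th
eigenvalue `-n(n+d-1)`. The Laplace--Beltrami operator applied to `f` is the restriction to the
sphere of the Euclidean Laplacian of the extension `F` of `f` that is constant along rays. -/
def IsSphereEigenfunction (d n : ℕ) (f : Sph d → ℝ) : Prop :=
  ∃ F : E d → ℝ, (∀ x : E d, x ≠ 0 → ∀ r : ℝ, 0 < r → F (r • x) = F x) ∧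
    (∀ u : Sph d, F u = f u) ∧ ContDiffOn ℝ ((⊤ : ℕ∞) : WithTop ℕ∞) F {0}ᶜ ∧
    ∀ u : Sph d, Laplacian.laplacian F (u : E d) =
      -((n : ℝ) * ((n : ℝ) + (d : ℝ) - 1)) * f u

lemma contDiffAt_of_sphere {d : ℕ} {F : E d → ℝ} (hF : ContDiffOn ℝ ((⊤ : ℕ∞) : WithTop ℕ∞) F {0}ᶜ) (u : Sph d) :
    ContDiffAt ℝ 2 F (u : E d) := by
  have hu : (u : E d) ≠ 0 := ne_zero_of_mem_unit_sphere u
  have h := hF.contDiffAt (isOpen_compl_singleton.mem_nhds hu)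
  exact h.of_le (WithTop.coe_le_coe.2 (le_top : (2 : ℕ∞) ≤ ⊤))

/-- The `n`-th eigenspace of the Laplace--Beltrami operator of `S_d(1)`. -/
def sphereEigenspace (d n : ℕ) : Submodule ℝ (Sph d → ℝ) where
  carrier := {f | IsSphereEigenfunction d n f}
  zero_mem' := by
    refine ⟨fun _ => 0, fun _ _ _ _ => rfl, fun _ => rfl, contDiffOn_const, fun u => ?_⟩
    rw [InnerProductSpace.laplacian_const]
    simp
  add_mem' := by
    rintro f g ⟨F, hF1, hF2, hF3, hF4⟩ ⟨G, hG1, hG2, hG3, hG4⟩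
    refine ⟨F + G, fun x hx r hr => ?_, fun u => ?_, hF3.add hG3, fun u => ?_⟩
    · simp [hF1 x hx r hr, hG1 x hx r hr]
    · simp [hF2, hG2]
    · rw [(contDiffAt_of_sphere hF3 u).laplacian_add (contDiffAt_of_sphere hG3 u), hF4, hG4]
      simp only [Pi.add_apply]
      ring
  smul_mem' := by
    rintro c f ⟨F, hF1, hF2, hF3, hF4⟩
    refine ⟨c • F, fun x hx r hr => ?_, fun u => ?_, hF3.const_smul c, fun u => ?_⟩
    · simp [hF1 x hx r hr]
    · simp [hF2]
    · rw [InnerProductSpace.laplacian_smul c (contDiffAt_of_sphere hF3 u), hF4]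
      simp only [Pi.smul_apply, smul_eq_mul]
      ring

/-- `Γ(n,d)`, the dimension of the `n`-th eigenspace of the Laplace--Beltrami operator. -/
def eigenDim (d n : ℕ) : ℕ := Module.finrank ℝ (sphereEigenspace d n)

/-- `Y n j`, `1 ≤ j ≤ Γ(n,d)`, is for every `n` an `L²(S_d(1), dν)`-orthonormal family (hence a
basis) of the `n`-th eigenspace of the Laplace--Beltrami operator. -/
def IsSphericalHarmonicBasis (d : ℕ) (Y : (n : ℕ) → Fin (eigenDim d n) → Sph d → ℝ) : Prop :=
  (∀ n j, Y n j ∈ sphereEigenspace d n) ∧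
    ∀ n i j, ∫ u, Y n i u * Y n j u ∂(unitSurface d) = if i = j then 1 else 0

/-- The functions `φ k` form an orthonormal basis of `L²([-T,T], dt)`. -/
def IsTimeBasis (T : ℝ) (φ : ℕ → ℝ → ℝ) : Prop :=
  ∃ b : HilbertBasis ℕ ℝ (Lp ℝ 2 ((volume : Measure ℝ).restrict (Icc (-T) T))),
    ∀ k, (b k : ℝ → ℝ) =ᵐ[(volume : Measure ℝ).restrict (Icc (-T) T)] φ k

/-! ### The random field -/

/-- `Z` is a (jointly measurable) zero-mean Gaussian random field on `ℝ^{d+1} × ℝ` with variance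
one, mean-square continuous, homogeneous and isotropic in space and stationary in time, with
covariance `E[Z(x,t) Z(y,s)] = C(‖x - y‖, |t - s|)`. -/
structure IsGaussianSTRF {Ω : Type*} [MeasurableSpace Ω] (P : Measure Ω) (d : ℕ)
    (C : ℝ → ℝ → ℝ) (Z : E d → ℝ → Ω → ℝ) : Prop where
  measurable : Measurable (fun q : (E d × ℝ) × Ω => Z q.1.1 q.1.2 q.2)
  gaussian : IsGaussianProcess (fun p : E d × ℝ => Z p.1 p.2) P
  mean_zero : ∀ x t, ∫ ω, Z x t ω ∂P = 0
  covariance : ∀ x y t s, ∫ ω, Z x t ω * Z y s ω ∂P = C ‖x - y‖ |t - s|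
  variance_one : ∀ x t, ∫ ω, Z x t ω ^ 2 ∂P = 1
  meanSquare_continuous : ∀ p : E d × ℝ,
    Tendsto (fun q : E d × ℝ => ∫ ω, (Z q.1 q.2 ω - Z p.1 p.2 ω) ^ 2 ∂P) (𝓝 p) (𝓝 0)

/-! ### Assumptions -/

/-- Diagonal (Karhunen--Loève type) expansion of the covariance of the field restricted to
`S_d(T^γ) × [-T,T]`, for every `T ≥ 1`. The points of `S_d(T^γ)` are `T^γ u`, `T^γ v` with unit
vectors `u`, `v`, and `(T^γ)^(-d/2) Y n j` is the orthonormal basis of the `n`-th eigenspace on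
`S_d(T^γ)`. The coefficients are variances (`B`) and eigenvalues of covariance operators (`b`), so
they are nonnegative; the basis `φ` may depend on `T`, but not on `n`. -/
def HasDiagonalExpansion (d : ℕ) (γ : ℝ) (C : ℝ → ℝ → ℝ) : Prop :=
  ∃ Y : (n : ℕ) → Fin (eigenDim d n) → Sph d → ℝ, IsSphericalHarmonicBasis d Y ∧
  ∃ B : ℕ → ℝ → ℝ, ∀ T : ℝ, 1 ≤ T →
    (∀ n, 0 ≤ B n (T ^ γ)) ∧
    ∃ (b : ℕ → ℕ → ℝ) (φ : ℕ → ℝ → ℝ), (∀ n k, 0 ≤ b n k) ∧ IsTimeBasis T φ ∧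
      ∀ u v : Sph d, ∀ t ∈ Icc (-T) T, ∀ s ∈ Icc (-T) T,
        HasSum (fun q : ℕ × ℕ => B q.1 (T ^ γ) * (b q.1 q.2 *
            ∑ j : Fin (eigenDim d q.1),
              (((T ^ γ) ^ (-(d : ℝ) / 2) * Y q.1 j u) * ((T ^ γ) ^ (-(d : ℝ) / 2) * Y q.1 j v)) *
                (φ q.2 t * φ q.2 s)))
          (C ‖(T ^ γ) • (u : E d) - (T ^ γ) • (v : E d)‖ |t - s|)

/-- Positive (measurable) slowly varying function at infinity. -/
structure IsSlowlyVarying (L : ℝ → ℝ) : Prop where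
  measurable : Measurable L
  pos : ∀ x, 0 < x → 0 < L x
  tendsto : ∀ c, 0 < c → Tendsto (fun T => L (T * c) / L T) atTop (𝓝 1)

/-- Asymptotically separable power-law decay of the covariance: for all `x ≠ 0`, `τ ≠ 0`, as
`T → ∞`, the ratio of `C(T^γ x, T τ)` and `L(T) L(T^γ) / (|Tτ|^{α_T} ‖T^γ x‖^{α_S})` tends
to `1`. -/
def HasSeparableDecay (d : ℕ) (γ αT αS : ℝ) (L : ℝ → ℝ) (C : ℝ → ℝ → ℝ) : Prop :=
  ∀ x : E d, x ≠ 0 → ∀ τ : ℝ, τ ≠ 0 →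
    Asymptotics.IsEquivalent atTop (fun T : ℝ => C ‖(T ^ γ) • x‖ |T * τ|)
      (fun T : ℝ => L T * L (T ^ γ) / (|T * τ| ^ αT * ‖(T ^ γ) • x‖ ^ αS))

/-- The measure `dν ⊗ dt` on `S_d(1) × [-1,1]`. -/
def unitDomain (d : ℕ) : Measure (Sph d × ℝ) :=
  (unitSurface d).prod ((volume : Measure ℝ).restrict (Icc (-1) 1))

/-- The product Riesz kernel `|t - s|^{-α_T} ‖x - y‖^{-α_S}`. -/
def rieszKernel (d : ℕ) (αT αS : ℝ) (p q : Sph d × ℝ) : ℝ :=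
  1 / (|p.2 - q.2| ^ αT * ‖(p.1 : E d) - (q.1 : E d)‖ ^ αS)

/-- The product Riesz kernel with the slowly varying corrections at scale `T`. -/
def correctedKernel (d : ℕ) (γ αT αS : ℝ) (L : ℝ → ℝ) (T : ℝ) (p q : Sph d × ℝ) : ℝ :=
  L (T * |p.2 - q.2|) * L (T ^ γ * ‖(p.1 : E d) - (q.1 : E d)‖) /
    (L T * L (T ^ γ) * |p.2 - q.2| ^ αT * ‖(p.1 : E d) - (q.1 : E d)‖ ^ αS)

/-- The cyclic product `K(p₁,p₂) K(p₂,p₃) ⋯ K(p_m,p₁)`. -/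
def cyclicProduct {X : Type*} (K : X → X → ℝ) (m : ℕ) (p : Fin m → X) : ℝ :=
  ∏ i : Fin m, K (p i) (p (finRotate m i))

/-- For every `m ≥ 2` and all sufficiently large `T`, the `m`-th cyclic integral of the corrected
kernel is at most the one of the Riesz kernel. -/
def CyclicDomination (d : ℕ) (γ αT αS : ℝ) (L : ℝ → ℝ) : Prop :=
  ∀ m : ℕ, 2 ≤ m → ∀ᶠ T : ℝ in atTop,
    ∫⁻ p : Fin m → Sph d × ℝ,
        ENNReal.ofReal (cyclicProduct (correctedKernel d γ αT αS L T) m p)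
        ∂(Measure.pi fun _ => unitDomain d) ≤
      ∫⁻ p : Fin m → Sph d × ℝ, ENNReal.ofReal (cyclicProduct (rieszKernel d αT αS) m p)
        ∂(Measure.pi fun _ => unitDomain d)

/-! ### The functional and the limit coefficients -/

/-- `d_T = T^{γ(d-α_S)} T^{1-α_T} L(T) L(T^γ)`. -/
def normalizer (d : ℕ) (γ αT αS : ℝ) (L : ℝ → ℝ) (T : ℝ) : ℝ :=
  T ^ (γ * ((d : ℝ) - αS)) * T ^ (1 - αT) * L T * L (T ^ γ)

/-- `S_T = d_T⁻¹ ∫_{[-T,T]} ∫_{S_d(T^γ)} (Z(x,t)² - 1) dν(x) dt`. -/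
def functional {Ω : Type*} (d : ℕ) (γ αT αS : ℝ) (L : ℝ → ℝ) (Z : E d → ℝ → Ω → ℝ)
    (T : ℝ) (ω : Ω) : ℝ :=
  1 / normalizer d γ αT αS L T *
    ∫ t in Icc (-T) T, ∫ x, (Z x t ω ^ 2 - 1) ∂(surfaceMeasure d (T ^ γ))

/-- The cyclic integrals `c_m`. -/
def cycleCoeff (d : ℕ) (αT αS : ℝ) (m : ℕ) : ℝ :=
  ∫ p : Fin m → Sph d × ℝ, cyclicProduct (rieszKernel d αT αS) m p
    ∂(Measure.pi fun _ => unitDomain d)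

/-- The `m`-th term `(2iξ)^m c_m / m` of the series in the exponent of the limit characteristic
function. -/
def cumulantTerm (d : ℕ) (αT αS ξ : ℝ) (m : ℕ) : ℂ :=
  (2 * Complex.I * (ξ : ℂ)) ^ m / (m : ℂ) * (cycleCoeff d αT αS m : ℂ)

end SphereNCLT

end

namespace SphereNCLT

/-! A centred quadratic functional of a Gaussian field is, after discretization, a sum `∑ λ_j (ξ_j²
- 1)` with independent standard normal `ξ_j`, where the `λ_j ≥ 0` are the eigenvalues of a
covariance matrix (`exists_charFun_sum_sq`). Its characteristic function is `exp (½ ∑ logRem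
(2iξλ_j))`, and `logRem w = w² q(w)` with `q` holomorphic on `re w < 1`. So the exponent is the
integral of a continuous function against the finite measure `∑ λ_j² δ_{λ_j}`. The moments of this
measure are the power sums of order at least two, that is, traces of matrix powers, and these
approximate the cyclic integrals of the rescaled covariance (`exists_discretization`).

If the cyclic integrals converge to `c_m`, these measures have bounded mass on a compact interval.
Every weak limit point `σ` has moments `c_{m+2}`, and `(2iξ)² ∫ q(2iξx) dσ(x)` is a limit of the
exponents. This function is analytic on the line and has the prescribed Taylor series at 0, so it
does not depend on the limit point (`exists_exponent_of_tendsto_powerSums`). Lévy's theorem turns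
this into convergence in distribution.

The cyclic integrals converge by dominated convergence. Pointwise limits are given by the decay
assumption; the difficulty is a bound uniform in `T`. The diagonal expansion uses one time basis for
all spherical frequencies, so for each distance `r` the kernel `C(r, |t - s|)` has the same
eigenfunctions on `[-T, T]` as `C(0, |t - s|)`, and the two commute. Differentiating the commutation
relation in the length of the interval isolates a boundary term and yields `C(r, t) = C(r, 0) C(0,
t)` (`cov_eq_mul_of_hasDiagonalExpansion`). Each factor is then a bounded, continuous, regularly
varying function of one variable, and a Potter bound (`exists_potter_bound`) dominates the rescaled
covariance by a Riesz kernel with slightly larger exponents, still below `1/2` and `d/2`. Such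
kernels have finite cyclic integrals because their squares are integrable (`lintegral_cyclic_le`).
For `γ = 0` the factorization would make `C(r, 0)` proportional to `r ^ (-αS)` near 0, against `|C|
≤ 1`; hence `γ > 0` (`radius_exponent_ne_zero`). -/

/-! ### The remainder of the logarithm -/

/-- The remainder `-log (1 - w) - w` of the logarithm. -/
noncomputable def logRem (w : ℂ) : ℂ := -Complex.log (1 - w) - w

/-- The holomorphic function `(-log (1 - w) - w) / w ^ 2` on `re w < 1`. -/
noncomputable def logRemQuot : ℂ → ℂ :=
  dslope (dslope (fun z : ℂ => -Complex.log (1 - z)) 0) 0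

lemma isOpen_re_lt_one : IsOpen {w : ℂ | w.re < 1} :=
  isOpen_lt Complex.continuous_re continuous_const

/-- Divided slopes at 0 preserve holomorphy, so only `log (1 - w)` matters, and `1 - w` stays in the
right half-plane. -/
lemma differentiableOn_logRemQuot : DifferentiableOn ℂ logRemQuot {w : ℂ | w.re < 1} := by
  have h0 : {w : ℂ | w.re < 1} ∈ 𝓝 (0 : ℂ) := isOpen_re_lt_one.mem_nhds (by simp)
  unfold logRemQuot
  rw [Complex.differentiableOn_dslope h0, Complex.differentiableOn_dslope h0]
  intro w hw
  have : (1 - w) ∈ Complex.slitPlane := by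
    left
    simpa using hw
  exact ((differentiableAt_id.const_sub 1).clog this).neg.differentiableWithinAt

lemma sq_mul_logRemQuot (w : ℂ) : w ^ 2 * logRemQuot w = logRem w := by
  have h1 := sub_smul_dslope (fun z : ℂ => -Complex.log (1 - z)) 0 w
  have h2 := sub_smul_dslope (dslope (fun z : ℂ => -Complex.log (1 - z)) 0) 0 w
  have h3 : deriv (fun z : ℂ => -Complex.log (1 - z)) 0 = 1 := by
    have : HasDerivAt (fun z : ℂ => -Complex.log (1 - z)) (-((-1) / (1 - 0))) 0 :=
      (((hasDerivAt_id (0 : ℂ)).const_sub 1).clog (by simp)).neg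
    rw [this.deriv]; simp
  rw [dslope_same, h3] at h2
  simp only [sub_zero, smul_eq_mul, Complex.log_one, neg_zero] at h1 h2
  unfold logRem logRemQuot
  rw [pow_two, mul_assoc, h2, mul_sub, h1]
  ring

lemma hasSum_logRem {w : ℂ} (hw : ‖w‖ < 1) :
    HasSum (fun m : ℕ => w ^ (m + 2) / ((m + 2 : ℕ) : ℂ)) (logRem w) := by
  have h := Complex.hasSum_taylorSeries_neg_log hw
  rw [← hasSum_nat_add_iff' 2] at h
  simpa [Finset.sum_range_succ, logRem] using h

lemma norm_pow_div_le {w : ℂ} (m : ℕ) : ‖w ^ m / ((m + 2 : ℕ) : ℂ)‖ ≤ ‖w‖ ^ m := by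
  rw [norm_div, norm_pow, Complex.norm_natCast]
  apply div_le_self (by positivity)
  exact_mod_cast (by omega : 1 ≤ m + 2)

/-- For `w ≠ 0` the series of `logRem` can be divided by `w ^ 2`; at 0 both sides are continuous. -/
lemma hasSum_logRemQuot {w : ℂ} (hw : ‖w‖ < 1) :
    HasSum (fun m : ℕ => w ^ m / ((m + 2 : ℕ) : ℂ)) (logRemQuot w) := by
  have hs : ∀ w : ℂ, ‖w‖ < 1 → Summable (fun m : ℕ => w ^ m / ((m + 2 : ℕ) : ℂ)) := fun w hw =>
    Summable.of_norm_bounded (summable_geometric_of_lt_one (norm_nonneg w) hw)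
      (fun m => norm_pow_div_le m)
  have hne : ∀ w : ℂ, ‖w‖ < 1 → w ≠ 0 →
      logRemQuot w = ∑' m : ℕ, w ^ m / ((m + 2 : ℕ) : ℂ) := by
    intro w hw h0
    have h1 := (hasSum_logRem hw).tsum_eq
    rw [← sq_mul_logRemQuot] at h1
    have h2 : ∀ m : ℕ, w ^ (m + 2) / ((m + 2 : ℕ) : ℂ) = w ^ 2 * (w ^ m / ((m + 2 : ℕ) : ℂ)) := by
      intro m; ring
    simp_rw [h2] at h1
    rw [tsum_mul_left] at h1
    exact (mul_left_cancel₀ (pow_ne_zero 2 h0) h1).symm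
  by_cases h0 : w = 0
  · subst h0
    have hcont : ContinuousOn (fun w : ℂ => ∑' m : ℕ, w ^ m / ((m + 2 : ℕ) : ℂ))
        (Metric.closedBall 0 (1 / 2)) := by
      refine continuousOn_tsum (u := fun m : ℕ => (1 / 2 : ℝ) ^ m) (fun m => by fun_prop)
        (summable_geometric_of_lt_one (by norm_num) (by norm_num)) ?_
      intro m x hx
      refine (norm_pow_div_le m).trans ?_
      gcongr
      simpa using hx
    have hc1 : ContinuousAt (fun w : ℂ => ∑' m : ℕ, w ^ m / ((m + 2 : ℕ) : ℂ)) 0 :=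
      hcont.continuousAt (Metric.closedBall_mem_nhds _ (by norm_num))
    have hc2 : ContinuousAt logRemQuot 0 :=
      (differentiableOn_logRemQuot.differentiableAt
        (isOpen_re_lt_one.mem_nhds (by simp))).continuousAt
    have heq : logRemQuot 0 = ∑' m : ℕ, (0 : ℂ) ^ m / ((m + 2 : ℕ) : ℂ) := by
      refine tendsto_nhds_unique (hc2.tendsto.mono_left (nhdsWithin_le_nhds (s := {0}ᶜ))) ?_
      refine (hc1.tendsto.mono_left (nhdsWithin_le_nhds (s := {0}ᶜ))).congr' ?_
      have hb : Metric.ball (0 : ℂ) 1 ∈ 𝓝[{0}ᶜ] (0 : ℂ) :=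
        mem_nhdsWithin_of_mem_nhds (Metric.ball_mem_nhds _ one_pos)
      filter_upwards [hb, self_mem_nhdsWithin] with x hx hx0
      exact (hne x (by simpa using hx) hx0).symm
    rw [heq]
    exact (hs 0 hw).hasSum
  · rw [hne w hw h0]
    exact (hs w hw).hasSum

/-! ### Exponents represented by spectral measures -/

/-- The `m`-th term of the exponent series with coefficients `c`, at a complex argument. -/
noncomputable def expTerm (c : ℕ → ℝ) (z : ℂ) (m : ℕ) : ℂ :=
  (2 * Complex.I * z) ^ (m + 2) / ((m + 2 : ℕ) : ℂ) * (c (m + 2) : ℂ)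

/-- The function `Φ` on `ℝ` extends the exponent series with coefficients `c` analytically. -/
structure IsExponent (c : ℕ → ℝ) (Φ : ℝ → ℂ) : Prop where
  analytic : AnalyticOnNhd ℝ Φ univ
  radius : ∃ r : ℝ, 0 < r ∧ ∀ ξ : ℝ, |ξ| < r → Summable (expTerm c ξ)
  eq_tsum : ∀ ξ : ℝ, Summable (expTerm c ξ) → Φ ξ = ∑' m, expTerm c ξ m

/-- Both functions equal the series near 0, and the identity theorem carries the equality along the
line. This is what makes limits along different ultrafilters agree. -/
lemma IsExponent.unique {c : ℕ → ℝ} {Φ Ψ : ℝ → ℂ} (h : IsExponent c Φ) (h' : IsExponent c Ψ) :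
    Φ = Ψ := by
  obtain ⟨r, hr, hs⟩ := h.radius
  refine h.analytic.eq_of_eventuallyEq h'.analytic (z₀ := 0) ?_
  filter_upwards [Metric.ball_mem_nhds (0 : ℝ) hr] with ξ hξ
  have := hs ξ (by simpa using hξ)
  rw [h.eq_tsum ξ this, h'.eq_tsum ξ this]

/-- The exponent `(2iz)² ∫ logRemQuot (2izx) dσ(x)` of a spectral measure `σ`. -/
noncomputable def measureExponent {M : ℝ} (σ : Measure (Icc (0 : ℝ) M)) (z : ℂ) : ℂ :=
  (2 * Complex.I * z) ^ 2 * ∫ x, logRemQuot (2 * Complex.I * z * ((x : ℝ) : ℂ)) ∂σ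

/-- The strip on which the exponent is holomorphic. -/
def strip (M : ℝ) : Set ℂ := {z | -(1 / (2 * M + 1)) < z.im}

lemma isOpen_strip (M : ℝ) : IsOpen (strip M) := isOpen_lt continuous_const Complex.continuous_im

lemma convex_strip (M : ℝ) : Convex ℝ (strip M) := by
  have : strip M = Complex.imLm ⁻¹' (Ioi (-(1 / (2 * M + 1)))) := by
    ext z; simp [strip]
  rw [this]
  exact (convex_Ioi _).linear_preimage Complex.imLm

/-- The real part is `-2 x im z`, at most `2 M / (2 M + 1) < 1`. The `+ 1` gives strictness and
keeps the bound meaningful for `M = 0`. -/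
lemma re_lt_one_of_mem_strip {M : ℝ} (hM : 0 ≤ M) {z : ℂ} (hz : z ∈ strip M) (x : Icc (0 : ℝ) M) :
    (2 * Complex.I * z * ((x : ℝ) : ℂ)).re < 1 := by
  have hx0 : (0 : ℝ) ≤ x := x.2.1
  have hxM : (x : ℝ) ≤ M := x.2.2
  have hz' : -(1 / (2 * M + 1)) < z.im := hz
  have h1 : (2 * Complex.I * z * ((x : ℝ) : ℂ)).re = 2 * (-z.im) * x := by
    simp
  rw [h1]
  have h3 : -z.im ≤ 1 / (2 * M + 1) := by linarith
  have h4 : 2 * (-z.im) * x ≤ 2 * (1 / (2 * M + 1)) * M := by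
    have : 0 ≤ 1 / (2 * M + 1) := by positivity
    nlinarith
  have h5 : 2 * (1 / (2 * M + 1)) * M < 1 := by
    rw [show 2 * (1 / (2 * M + 1)) * M = (2 * M) / (2 * M + 1) by ring, div_lt_one (by positivity)]
    linarith
  linarith

lemma continuous_logRemQuot_comp {M : ℝ} (hM : 0 ≤ M) {z : ℂ} (hz : z ∈ strip M) :
    Continuous fun x : Icc (0 : ℝ) M => logRemQuot (2 * Complex.I * z * ((x : ℝ) : ℂ)) := by
  refine differentiableOn_logRemQuot.continuousOn.comp_continuous (by fun_prop) fun x => ?_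
  exact re_lt_one_of_mem_strip hM hz x

/-- Differentiation under the integral sign: the derivative of the integrand is bounded on a closed
ball times the compact interval. -/
lemma differentiableOn_measureExponent {M : ℝ} (hM : 0 ≤ M) (σ : Measure (Icc (0 : ℝ) M))
    [IsFiniteMeasure σ] : DifferentiableOn ℂ (measureExponent σ) (strip M) := by
  intro z hz
  refine DifferentiableAt.differentiableWithinAt ?_
  refine DifferentiableAt.mul (by fun_prop) ?_
  obtain ⟨ε, hε, hball⟩ := Metric.isOpen_iff.1 (isOpen_strip M) z hz
  have hsub : Metric.closedBall z (ε / 2) ⊆ strip M :=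
    (Metric.closedBall_subset_ball (by linarith)).trans hball
  have hdd : DifferentiableOn ℂ (deriv logRemQuot) {w : ℂ | w.re < 1} :=
    differentiableOn_logRemQuot.deriv isOpen_re_lt_one
  have hcont : ContinuousOn (fun p : ℂ × Icc (0 : ℝ) M =>
      deriv logRemQuot (2 * Complex.I * p.1 * ((p.2 : ℝ) : ℂ)) * (2 * Complex.I * ((p.2 : ℝ) : ℂ)))
      (Metric.closedBall z (ε / 2) ×ˢ univ) := by
    refine ContinuousOn.mul ?_ (by fun_prop)
    refine hdd.continuousOn.comp (by fun_prop) ?_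
    intro p hp
    exact re_lt_one_of_mem_strip hM (hsub hp.1) p.2
  obtain ⟨B, hB⟩ := ((isCompact_closedBall z (ε / 2)).prod isCompact_univ).exists_bound_of_continuousOn
    hcont
  refine (hasDerivAt_integral_of_dominated_loc_of_deriv_le (μ := σ) (𝕜 := ℂ)
    (F := fun z (x : Icc (0 : ℝ) M) => logRemQuot (2 * Complex.I * z * ((x : ℝ) : ℂ)))
    (F' := fun z x => deriv logRemQuot (2 * Complex.I * z * ((x : ℝ) : ℂ)) *
      (2 * Complex.I * ((x : ℝ) : ℂ))) (bound := fun _ => B)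
    (Metric.closedBall_mem_nhds z (half_pos hε)) ?_ ?_ ?_ ?_ (integrable_const B)
    ?_).2.differentiableAt
  · filter_upwards [(isOpen_strip M).mem_nhds hz] with w hw
    exact (continuous_logRemQuot_comp hM hw).aestronglyMeasurable
  · have := BoundedContinuousFunction.integrable σ
      (BoundedContinuousFunction.mkOfCompact ⟨_, continuous_logRemQuot_comp hM hz⟩)
    exact this
  · have : Continuous fun x : Icc (0 : ℝ) M =>
        deriv logRemQuot (2 * Complex.I * z * ((x : ℝ) : ℂ)) * (2 * Complex.I * ((x : ℝ) : ℂ)) := by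
      refine Continuous.mul ?_ (by fun_prop)
      exact hdd.continuousOn.comp_continuous (by fun_prop) fun x => re_lt_one_of_mem_strip hM hz x
    exact this.aestronglyMeasurable
  · exact ae_of_all _ fun x w hw => hB (w, x) ⟨hw, mem_univ _⟩
  · refine ae_of_all _ fun x w hw => ?_
    have h1 := (differentiableOn_logRemQuot.differentiableAt (isOpen_re_lt_one.mem_nhds
      (re_lt_one_of_mem_strip hM (hsub hw) x))).hasDerivAt
    have h2 : HasDerivAt (fun w : ℂ => 2 * Complex.I * w * ((x : ℝ) : ℂ))
        (2 * Complex.I * ((x : ℝ) : ℂ)) w := by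
      simpa using ((hasDerivAt_id w).const_mul (2 * Complex.I)).mul_const ((x : ℝ) : ℂ)
    exact h1.comp w h2

lemma norm_two_I_mul (z : ℂ) : ‖2 * Complex.I * z‖ = 2 * ‖z‖ := by simp

/-- Integrating the series of `logRemQuot` term by term, under a geometric majorant, produces the
moments of `σ`; their index is shifted by two because `σ` carries the weight `λ ^ 2`. -/
lemma hasSum_measureExponent {M : ℝ} (hM : 0 ≤ M) (σ : Measure (Icc (0 : ℝ) M))
    [IsFiniteMeasure σ] {c : ℕ → ℝ} (hc : ∀ m, ∫ x, (x : ℝ) ^ m ∂σ = c (m + 2)) {z : ℂ}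
    (hz : 2 * ‖z‖ * M < 1) : HasSum (expTerm c z) (measureExponent σ z) := by
  have hle : ∀ x : Icc (0 : ℝ) M, ‖2 * Complex.I * z * ((x : ℝ) : ℂ)‖ ≤ 2 * ‖z‖ * M := by
    intro x
    rw [norm_mul, norm_two_I_mul, Complex.norm_real, Real.norm_of_nonneg x.2.1]
    exact mul_le_mul_of_nonneg_left x.2.2 (by positivity)
  have hgeo := summable_geometric_of_lt_one (by positivity : 0 ≤ 2 * ‖z‖ * M) hz
  have hint : HasSum (fun m : ℕ => ∫ x : Icc (0 : ℝ) M,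
      (2 * Complex.I * z * ((x : ℝ) : ℂ)) ^ m / ((m + 2 : ℕ) : ℂ) ∂σ)
      (∫ x, logRemQuot (2 * Complex.I * z * ((x : ℝ) : ℂ)) ∂σ) := by
    refine hasSum_integral_of_dominated_convergence (fun m _ => (2 * ‖z‖ * M) ^ m) ?_ ?_ ?_ ?_ ?_
    · exact fun m => (by fun_prop : Continuous _).aestronglyMeasurable
    · intro m
      refine ae_of_all _ fun x => (norm_pow_div_le m).trans ?_
      exact pow_le_pow_left₀ (norm_nonneg _) (hle x) m
    · exact ae_of_all _ fun _ => hgeo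
    · exact integrable_const _
    · exact ae_of_all _ fun x => hasSum_logRemQuot ((hle x).trans_lt hz)
  have := hint.mul_left ((2 * Complex.I * z) ^ 2)
  refine this.congr_fun ?_ |> fun h => h
  intro m
  have h1 : (∫ x : Icc (0 : ℝ) M, (2 * Complex.I * z * ((x : ℝ) : ℂ)) ^ m / ((m + 2 : ℕ) : ℂ) ∂σ) =
      (2 * Complex.I * z) ^ m / ((m + 2 : ℕ) : ℂ) * ((c (m + 2) : ℝ) : ℂ) := by
    rw [← hc m, ← integral_complex_ofReal, ← integral_const_mul]
    congr 1
    ext x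
    push_cast
    ring
  rw [h1, expTerm]
  ring

lemma norm_expTerm_le_of_norm_le {c : ℕ → ℝ} {z w : ℂ} (h : ‖z‖ ≤ ‖w‖) (m : ℕ) :
    ‖expTerm c z m‖ ≤ ‖expTerm c w m‖ := by
  unfold expTerm
  rw [norm_mul, norm_mul, norm_div, norm_div, norm_pow, norm_pow, norm_two_I_mul, norm_two_I_mul]
  gcongr

/-- The series may converge absolutely at some `ξ` outside the disc where it was integrated
termwise. It is then holomorphic on the open disc of radius `|ξ|`, whose intersection with the strip
is convex, so the identity theorem applies there. The point `ξ` itself lies on the boundary circle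
and is reached by uniform convergence on the closed disc. -/
lemma isExponent_measureExponent {M : ℝ} (hM : 0 ≤ M) (σ : Measure (Icc (0 : ℝ) M))
    [IsFiniteMeasure σ] {c : ℕ → ℝ} (hc : ∀ m, ∫ x, (x : ℝ) ^ m ∂σ = c (m + 2)) :
    IsExponent c (fun ξ : ℝ => measureExponent σ (ξ : ℂ)) := by
  have hreal : ∀ ξ : ℝ, (ξ : ℂ) ∈ strip M := by
    intro ξ
    have : 0 < 1 / (2 * M + 1) := by positivity
    simp only [strip, mem_ofPred_eq, Complex.ofReal_im]
    linarith
  have hana : AnalyticOnNhd ℂ (measureExponent σ) (strip M) :=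
    (differentiableOn_measureExponent hM σ).analyticOnNhd (isOpen_strip M)
  have hr : (0 : ℝ) < 1 / (2 * M + 1) := by positivity
  have hsmall : ∀ z : ℂ, ‖z‖ < 1 / (2 * M + 1) → 2 * ‖z‖ * M < 1 := by
    intro z hz
    rw [lt_div_iff₀ (by positivity)] at hz
    rcases eq_or_lt_of_le (norm_nonneg z) with h | h
    · rw [← h]; simp
    · linarith
  refine ⟨?_, ⟨1 / (2 * M + 1), hr, ?_⟩, ?_⟩
  · intro ξ _
    exact ((hana ξ (hreal ξ)).restrictScalars (𝕜 := ℝ)).comp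
      (f := fun x : ℝ => (x : ℂ)) (Complex.ofRealCLM.analyticAt ξ)
  · intro ξ hξ
    exact (hasSum_measureExponent hM σ hc (hsmall ξ (by simpa using hξ))).summable
  · intro ξ hs
    by_cases hξ0 : ξ = 0
    · subst hξ0
      exact (hasSum_measureExponent hM σ hc (by simp)).tsum_eq.symm
    set R := ‖(ξ : ℂ)‖ with hR
    have hRpos : 0 < R := by simpa [hR] using hξ0
    have hcont : ContinuousOn (fun z : ℂ => ∑' m, expTerm c z m) (Metric.closedBall 0 R) := by
      refine continuousOn_tsum (u := fun m => ‖expTerm c ξ m‖)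
        (fun m => by unfold expTerm; fun_prop) hs.norm ?_
      intro m z hz
      exact norm_expTerm_le_of_norm_le (mem_closedBall_zero_iff.1 hz) m
    have hdiff : DifferentiableOn ℂ (fun z : ℂ => ∑' m, expTerm c z m) (Metric.ball 0 R) := by
      refine Complex.differentiableOn_tsum_of_summable_norm hs.norm
        (fun m => by unfold expTerm; fun_prop) Metric.isOpen_ball ?_
      intro m z hz
      exact norm_expTerm_le_of_norm_le (mem_ball_zero_iff.1 hz).le m
    have heq : EqOn (measureExponent σ) (fun z : ℂ => ∑' m, expTerm c z m)
        (Metric.ball 0 R ∩ strip M) := by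
      refine (hana.mono inter_subset_right).eqOn_of_preconnected_of_eventuallyEq
        ((hdiff.analyticOnNhd Metric.isOpen_ball).mono inter_subset_left)
        ((convex_ball _ _).inter (convex_strip M)).isPreconnected
        (z₀ := 0) ⟨Metric.mem_ball_self hRpos, by simpa using hreal 0⟩ ?_
      filter_upwards [Metric.ball_mem_nhds (0 : ℂ) hr] with z hz
      exact (hasSum_measureExponent hM σ hc (hsmall z (by simpa using hz))).tsum_eq.symm
    -- pass to the boundary point along the segment from the origin
    have hseg : Tendsto (fun s : ℝ => ((s * ξ : ℝ) : ℂ)) (𝓝[<] 1) (𝓝 (ξ : ℂ)) := by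
      have : ContinuousAt (fun s : ℝ => ((s * ξ : ℝ) : ℂ)) 1 := by fun_prop
      have h := this.tendsto
      simp only [one_mul] at h
      exact h.mono_left nhdsWithin_le_nhds
    have hIoo : ∀ᶠ s : ℝ in 𝓝[<] 1, s ∈ Ioo (0 : ℝ) 1 := Ioo_mem_nhdsLT zero_lt_one
    have hlt : ∀ s ∈ Ioo (0 : ℝ) 1, ‖((s * ξ : ℝ) : ℂ)‖ < R := by
      intro s hs
      rw [Complex.ofReal_mul, norm_mul, Complex.norm_real, Real.norm_of_nonneg hs.1.le, ← hR]
      nlinarith [hs.2]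
    have hl : Tendsto (fun s : ℝ => measureExponent σ ((s * ξ : ℝ) : ℂ)) (𝓝[<] 1)
        (𝓝 (measureExponent σ ξ)) :=
      ((hana ξ (hreal ξ)).continuousAt.tendsto).comp hseg
    have hrr : Tendsto (fun s : ℝ => ∑' m, expTerm c ((s * ξ : ℝ) : ℂ) m) (𝓝[<] 1)
        (𝓝 (∑' m, expTerm c ξ m)) := by
      have h1 := hcont (ξ : ℂ) (by simp [hR])
      refine h1.tendsto.comp (tendsto_nhdsWithin_iff.2 ⟨hseg, ?_⟩)
      filter_upwards [hIoo] with s hs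
      simpa using (hlt s hs).le
    refine tendsto_nhds_unique (hl.congr' ?_) hrr
    filter_upwards [hIoo] with s hs
    exact heq ⟨by simpa using hlt s hs, hreal _⟩

/-! ### From convergence of power sums to convergence of exponents -/

/-- The finite measure `∑ λ_j² δ_{λ_j}` on `[0, M]`. -/
noncomputable def spectralMeasure {M : ℝ} (hM : 0 ≤ M) {n : ℕ} (lam : Fin n → ℝ) :
    FiniteMeasure (Icc (0 : ℝ) M) :=
  ⟨∑ j, (lam j ^ 2).toNNReal • Measure.dirac (projIcc 0 M hM (lam j)), inferInstance⟩

lemma integral_spectralMeasure {M : ℝ} (hM : 0 ≤ M) {n : ℕ} (lam : Fin n → ℝ)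
    {F : Type*} [NormedAddCommGroup F] [NormedSpace ℝ F] [CompleteSpace F]
    (f : Icc (0 : ℝ) M → F) :
    ∫ x, f x ∂(spectralMeasure hM lam : Measure (Icc (0 : ℝ) M)) =
      ∑ j, lam j ^ 2 • f (projIcc 0 M hM (lam j)) := by
  simp only [spectralMeasure, FiniteMeasure.toMeasure_mk]
  rw [integral_finsetSum_measure]
  · refine Finset.sum_congr rfl fun j _ => ?_
    rw [integral_smul_nnreal_measure, integral_dirac, NNReal.smul_def,
      Real.coe_toNNReal _ (sq_nonneg _)]
  · intro j _
    exact (integrable_dirac (by simp [enorm_lt_top])).smul_measure_nnreal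

lemma le_of_sum_sq_le {M : ℝ} {n : ℕ} {lam : Fin n → ℝ} (hM : 1 ≤ M)
    (h : ∑ j, lam j ^ 2 ≤ M) (j : Fin n) : lam j ≤ M := by
  have h1 : lam j ^ 2 ≤ M :=
    (Finset.single_le_sum (f := fun j => lam j ^ 2) (fun _ _ => sq_nonneg _)
      (Finset.mem_univ j)).trans h
  nlinarith

/-- The weights `λ_j²` make the total mass equal to the second power sum, which is bounded, so the
ultrafilter has a weak limit among measures on a compact interval. Powers of `x` and `logRemQuot
(2iξx)` are both continuous test functions there. -/
lemma exists_measure_of_tendsto_powerSums {ι : Type*} (l : Ultrafilter ι) {n : ι → ℕ}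
    {lam : (i : ι) → Fin (n i) → ℝ} {c : ℕ → ℝ} (h0 : ∀ i j, 0 ≤ lam i j)
    (hc : ∀ m, Tendsto (fun i => ∑ j, lam i j ^ (m + 2)) l (𝓝 (c (m + 2)))) :
    ∃ M : ℝ, 0 ≤ M ∧ ∃ σ : Measure (Icc (0 : ℝ) M), IsFiniteMeasure σ ∧
      (∀ m, ∫ x, (x : ℝ) ^ m ∂σ = c (m + 2)) ∧
      ∀ ξ : ℝ, Tendsto (fun i => ∑ j, logRem (2 * Complex.I * ξ * lam i j)) l
        (𝓝 (measureExponent σ ξ)) := by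
  have hc2 : 0 ≤ c 2 := ge_of_tendsto (hc 0) (Eventually.of_forall fun i =>
    Finset.sum_nonneg fun j _ => sq_nonneg _)
  -- The number `c 2 + 1` bounds the mass eventually and, being at least one, also bounds each
  -- eigenvalue: `λ² ≤ M ≤ M²`.
  have hM : 0 ≤ c 2 + 1 := by linarith
  have hev : ∀ᶠ i in (l : Filter ι), ∑ j, lam i j ^ 2 ≤ c 2 + 1 :=
    ((hc 0).eventually_lt_const (by linarith : c (0 + 2) < c 2 + 1)).mono fun i hi => hi.le
  have hproj : ∀ᶠ i in (l : Filter ι), ∀ j,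
      ((projIcc 0 (c 2 + 1) hM (lam i j) : Icc (0 : ℝ) (c 2 + 1)) : ℝ) = lam i j := by
    filter_upwards [hev] with i hi j
    rw [projIcc_of_mem hM ⟨h0 i j, le_of_sum_sq_le (by linarith) hi j⟩]
  have hcomp := isCompact_setOfPred_finiteMeasure_le_of_compactSpace (Icc (0 : ℝ) (c 2 + 1))
    (c 2 + 1).toNNReal
  have hmem : ∀ᶠ i in (l : Filter ι), spectralMeasure hM (lam i) ∈
      {μ : FiniteMeasure (Icc (0 : ℝ) (c 2 + 1)) | μ.mass ≤ (c 2 + 1).toNNReal} := by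
    filter_upwards [hev] with i hi
    have h1 := integral_spectralMeasure hM (lam i) (fun _ => (1 : ℝ))
    simp only [integral_const, smul_eq_mul, mul_one] at h1
    rw [← NNReal.coe_le_coe, Real.coe_toNNReal _ hM]
    refine le_trans (le_of_eq ?_) (h1.le.trans hi)
    rfl
  obtain ⟨σ, -, hσ⟩ := hcomp.ultrafilter_le_nhds
    (l.map fun i => spectralMeasure hM (lam i)) (by
      rw [Ultrafilter.coe_map, le_principal_iff, mem_map]
      exact hmem)
  have htend : Tendsto (fun i => spectralMeasure hM (lam i)) l (𝓝 σ) := hσ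
  refine ⟨c 2 + 1, hM, σ, inferInstance, fun m => ?_, fun ξ => ?_⟩
  · rw [FiniteMeasure.tendsto_iff_forall_integral_tendsto] at htend
    have h1 := htend (BoundedContinuousFunction.mkOfCompact
      ⟨fun x : Icc (0 : ℝ) (c 2 + 1) => (x : ℝ) ^ m, by fun_prop⟩)
    simp only [BoundedContinuousFunction.mkOfCompact_apply, ContinuousMap.coe_mk] at h1
    refine tendsto_nhds_unique h1 ((hc m).congr' ?_)
    filter_upwards [hproj] with i hi
    rw [integral_spectralMeasure]
    refine Finset.sum_congr rfl fun j _ => ?_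
    rw [hi j, smul_eq_mul]
    ring
  · have hξ : (ξ : ℂ) ∈ strip (c 2 + 1) := by
      have : 0 < 1 / (2 * (c 2 + 1) + 1) := by positivity
      simp only [strip, mem_ofPred_eq, Complex.ofReal_im]
      linarith
    rw [FiniteMeasure.tendsto_iff_forall_integral_rclike_tendsto ℂ] at htend
    have h1 := htend (BoundedContinuousFunction.mkOfCompact
      ⟨_, continuous_logRemQuot_comp hM hξ⟩)
    simp only [BoundedContinuousFunction.mkOfCompact_apply, ContinuousMap.coe_mk] at h1
    refine (h1.const_mul ((2 * Complex.I * ξ) ^ 2)).congr' ?_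
    filter_upwards [hproj] with i hi
    rw [integral_spectralMeasure, Finset.mul_sum]
    refine Finset.sum_congr rfl fun j _ => ?_
    rw [hi j, ← sq_mul_logRemQuot, Complex.real_smul]
    push_cast
    ring

/-- If the power sums of order at least two of finite families of nonnegative reals converge, then
the logarithms of the corresponding products converge to an exponent. -/
theorem exists_exponent_of_tendsto_powerSums {ι : Type*} (l : Filter ι) [l.NeBot] {n : ι → ℕ}
    {lam : (i : ι) → Fin (n i) → ℝ} {c : ℕ → ℝ} (h0 : ∀ i j, 0 ≤ lam i j)
    (hc : ∀ m, Tendsto (fun i => ∑ j, lam i j ^ (m + 2)) l (𝓝 (c (m + 2)))) :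
    ∃ Φ : ℝ → ℂ, IsExponent c Φ ∧
      ∀ ξ : ℝ, Tendsto (fun i => ∑ j, logRem (2 * Complex.I * ξ * lam i j)) l (𝓝 (Φ ξ)) := by
  have key : ∀ u : Ultrafilter ι, (u : Filter ι) ≤ l → ∃ Φ : ℝ → ℂ, IsExponent c Φ ∧
      ∀ ξ : ℝ, Tendsto (fun i => ∑ j, logRem (2 * Complex.I * ξ * lam i j)) u (𝓝 (Φ ξ)) := by
    intro u hu
    obtain ⟨M, hM, σ, hσ, hmom, ht⟩ :=
      exists_measure_of_tendsto_powerSums u h0 fun m => (hc m).mono_left hu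
    exact ⟨_, isExponent_measureExponent hM σ hmom, ht⟩
  obtain ⟨Φ, hΦ, -⟩ := key (Ultrafilter.of l) (Ultrafilter.of_le l)
  refine ⟨Φ, hΦ, fun ξ => ?_⟩
  -- The construction of the limit measure depends on the ultrafilter; the exponent is determined by
  -- `c` alone.
  rw [tendsto_iff_ultrafilter]
  intro u hu
  obtain ⟨Ψ, hΨ, ht⟩ := key u hu
  rw [hΦ.unique hΨ]
  exact ht ξ

/-! ### Squares of Gaussian vectors -/

/-- With `w = 2iξv`, density and quadratic phase combine into a Gaussian integral of complex
parameter `(1 - w) / (2v)`. It contributes `(1 - w) ^ (-1/2)`, and the centring contributes `exp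
(-w/2)`. Since `re w = 0`, the principal logarithm of `1 - w` stays off its cut. -/
lemma integral_cexp_sq_gaussianReal (v : NNReal) (ξ : ℝ) :
    ∫ x : ℝ, Complex.exp (Complex.I * ξ * ((x ^ 2 - v : ℝ) : ℂ)) ∂(gaussianReal 0 v) =
      Complex.exp (1 / 2 * logRem (2 * Complex.I * ξ * ((v : ℝ) : ℂ))) := by
  rcases eq_or_ne v 0 with rfl | hv
  · simp [logRem]
  have hv0 : (0 : ℝ) < v := by positivity
  rw [integral_gaussianReal_eq_integral_smul hv]
  set w : ℂ := 2 * Complex.I * ξ * ((v : ℝ) : ℂ) with hw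
  have hwre : w.re = 0 := by simp [hw]
  have h1w : (1 - w) ≠ 0 := by
    intro h
    have := congrArg Complex.re h
    simp [hwre] at this
  set b : ℂ := (1 - w) / (2 * ((v : ℝ) : ℂ)) with hb
  have hvC : ((v : ℝ) : ℂ) ≠ 0 := by exact_mod_cast hv0.ne'
  have hbre : 0 < b.re := by
    have : b = (1 - w) / ((2 * (v : ℝ) : ℝ) : ℂ) := by rw [hb]; push_cast; rfl
    rw [this, Complex.div_ofReal_re, Complex.sub_re, hwre, Complex.one_re]
    positivity
  have hint : ∀ x : ℝ, gaussianPDFReal 0 v x • Complex.exp (Complex.I * ξ * ((x ^ 2 - v : ℝ) : ℂ)) =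
      ((Real.sqrt (2 * Real.pi * v))⁻¹ : ℂ) * Complex.exp (-(w / 2)) *
        Complex.exp (-b * (x : ℂ) ^ 2) := by
    intro x
    rw [gaussianPDFReal, Complex.real_smul, Complex.ofReal_mul, mul_assoc,
      Complex.ofReal_exp, ← Complex.exp_add, mul_assoc _ (Complex.exp _) (Complex.exp _),
      ← Complex.exp_add, Complex.ofReal_inv]
    congr 2
    rw [hb, hw]
    push_cast
    field_simp
    ring
  simp_rw [hint]
  rw [integral_const_mul, integral_gaussian_complex hbre]
  have hpos : (0 : ℝ) < 2 * Real.pi * v := by positivity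
  have hpib : (Real.pi : ℂ) / b = ((2 * Real.pi * v : ℝ) : ℂ) * (1 - w)⁻¹ := by
    rw [hb]; push_cast; field_simp
  have harg : (1 - w).arg ≠ Real.pi := by
    rw [Ne, Complex.arg_eq_pi_iff]
    simp [hwre]
  have hpow : ((Real.pi : ℂ) / b) ^ (1 / 2 : ℂ) =
      ((Real.sqrt (2 * Real.pi * v) : ℝ) : ℂ) * Complex.exp (-(Complex.log (1 - w) / 2)) := by
    rw [hpib, Complex.cpow_def_of_ne_zero
      (mul_ne_zero (by exact_mod_cast hpos.ne') (inv_ne_zero h1w)),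
      Complex.log_ofReal_mul hpos (inv_ne_zero h1w), Complex.log_inv _ harg, Real.sqrt_eq_rpow,
      Real.rpow_def_of_pos hpos, Complex.ofReal_exp, ← Complex.exp_add]
    congr 1
    push_cast
    ring
  have hsq : ((Real.sqrt (2 * Real.pi * v) : ℝ) : ℂ) ≠ 0 := by
    exact_mod_cast (Real.sqrt_pos.2 hpos).ne'
  rw [hpow, show (1 / 2 : ℂ) * logRem w = -(w / 2) + -(Complex.log (1 - w) / 2) by
    unfold logRem; ring, Complex.exp_add]
  field_simp

section QuadraticForm

variable {Ω : Type*} [MeasurableSpace Ω] {P : Measure Ω} {ι : Type*} [Fintype ι] [DecidableEq ι]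

/-- The law of the centred square norm of a centred Gaussian vector, through the eigenvalues of
its covariance matrix. -/
lemma exists_charFun_sum_sq (V : ι → Ω → ℝ) (hV : HasGaussianLaw (fun ω i => V i ω) P)
    (h0 : ∀ i, ∫ ω, V i ω ∂P = 0) (A : Matrix ι ι ℝ) (hA : ∀ i j, A i j = ∫ ω, V i ω * V j ω ∂P) :
    ∃ lam : ι → ℝ, (∀ i, 0 ≤ lam i) ∧ (∀ m : ℕ, ∑ i, lam i ^ m = (A ^ m).trace) ∧
      ∀ ξ : ℝ, ∫ ω, Complex.exp (Complex.I * ξ * ((∑ i, (V i ω ^ 2 - A i i) : ℝ) : ℂ)) ∂P =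
        Complex.exp (1 / 2 * ∑ i, logRem (2 * Complex.I * ξ * lam i)) := by
  have hprob : IsProbabilityMeasure P := hV.isProbabilityMeasure
  have hherm : A.IsHermitian := by
    ext i j
    simp only [Matrix.conjTranspose_apply, star_trivial, hA, mul_comm]
  obtain ⟨U, ev, hUU, hUU', hspec, htr⟩ : ∃ (U : Matrix ι ι ℝ) (ev : ι → ℝ),
      U.transpose * U = 1 ∧ U * U.transpose = 1 ∧
      A = U * Matrix.diagonal ev * U.transpose ∧ A.trace = ∑ i, ev i := by
    have hUstar : star (hherm.eigenvectorUnitary : Matrix ι ι ℝ) =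
        (hherm.eigenvectorUnitary : Matrix ι ι ℝ).transpose := by
      ext i j; simp [Matrix.star_apply]
    refine ⟨hherm.eigenvectorUnitary, hherm.eigenvalues, ?_, ?_, ?_, ?_⟩
    · rw [← hUstar]; exact Unitary.coe_star_mul_self hherm.eigenvectorUnitary
    · rw [← hUstar]; exact Unitary.coe_mul_star_self hherm.eigenvectorUnitary
    · have h := hherm.spectral_theorem
      rw [Unitary.conjStarAlgAut_apply] at h
      rw [← hUstar]
      exact h
    · simpa using hherm.trace_eq_sum_eigenvalues
  have hdiag : U.transpose * A * U = Matrix.diagonal ev := by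
    rw [hspec]
    simp only [Matrix.mul_assoc, hUU, Matrix.mul_one]
    rw [← Matrix.mul_assoc, hUU, Matrix.one_mul]
  have hL2 : ∀ i, MemLp (V i) 2 P := fun i => (hV.eval i).memLp_two
  -- Coordinates in an eigenbasis of the covariance matrix: jointly Gaussian and uncorrelated, hence
  -- independent.
  set N : ι → Ω → ℝ := fun j ω => ∑ i, U i j * V i ω with hN
  have hNlaw : HasGaussianLaw (fun ω j => N j ω) P := by
    have h := hV.map_fun (LinearMap.toContinuousLinearMap (Matrix.toLin' U.transpose))
    refine h.congr (ae_of_all _ fun ω => ?_)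
    ext j
    simp [hN, Matrix.mulVec, dotProduct]
  have hNL2 : ∀ i, MemLp (N i) 2 P := fun i => (hNlaw.eval i).memLp_two
  have hNmean : ∀ j, ∫ ω, N j ω ∂P = 0 := by
    intro j
    simp only [hN]
    rw [integral_finsetSum _ fun i _ => ((hL2 i).integrable (by norm_num)).const_mul _]
    simp [integral_const_mul, h0]
  have hNcov : ∀ j k, ∫ ω, N j ω * N k ω ∂P = Matrix.diagonal ev j k := by
    intro j k
    rw [← hdiag]
    simp only [hN, Finset.sum_mul_sum]
    have hi : ∀ a b, Integrable (fun ω => U a j * V a ω * (U b k * V b ω)) P := fun a b =>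
      ((hL2 a).const_mul (U a j)).integrable_mul ((hL2 b).const_mul (U b k))
    rw [integral_finsetSum _ fun a _ => integrable_finsetSum _ fun b _ => hi a b]
    simp_rw [integral_finsetSum _ fun b _ => hi _ b]
    have : ∀ a b, ∫ ω, U a j * V a ω * (U b k * V b ω) ∂P = U a j * A a b * U b k := by
      intro a b
      rw [hA, ← integral_const_mul, ← integral_mul_const]
      congr 1; ext ω; ring
    simp_rw [this, Matrix.mul_apply, Matrix.transpose_apply, Finset.sum_mul]
    exact Finset.sum_comm
  have hvar : ∀ j, Var[N j; P] = ev j := by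
    intro j
    rw [variance_of_integral_eq_zero (hNL2 j).aemeasurable (hNmean j)]
    have := hNcov j j
    simp only [Matrix.diagonal_apply_eq] at this
    rw [← this]
    congr 1; ext ω; simp [pow_two]
  -- The eigenvalues are nonnegative because they are variances.
  have hlam0 : ∀ j, 0 ≤ ev j := fun j => hvar j ▸ variance_nonneg _ _
  have hind : iIndepFun N P := by
    refine hNlaw.iIndepFun_of_covariance_eq_zero fun i j hij => ?_
    rw [covariance_eq_sub (hNL2 i) (hNL2 j), hNmean, zero_mul, sub_zero]
    have := hNcov i j
    rw [Matrix.diagonal_apply_ne _ hij] at this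
    exact this
  refine ⟨ev, hlam0, fun m => ?_, fun ξ => ?_⟩
  · have hpow : ∀ m : ℕ, A ^ m = U * Matrix.diagonal ev ^ m * U.transpose := by
      intro m
      induction m with
      | zero => simp [hUU']
      | succ m ih =>
        rw [pow_succ, ih, pow_succ]
        conv_lhs => rw [hspec]
        simp only [Matrix.mul_assoc]
        rw [← Matrix.mul_assoc U.transpose U, hUU, Matrix.one_mul]
    rw [hpow, Matrix.trace_mul_comm, ← Matrix.mul_assoc, hUU, Matrix.one_mul, Matrix.diagonal_pow,
      Matrix.trace_diagonal]
    rfl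
  -- The rotation preserves the sum of squares, and the centring terms agree because the trace is
  -- the sum of the eigenvalues.
  · have hsum : ∀ ω, ∑ i, (V i ω ^ 2 - A i i) = ∑ j, (N j ω ^ 2 - ev j) := by
      intro ω
      rw [Finset.sum_sub_distrib, Finset.sum_sub_distrib]
      congr 1
      · have h1 : ∀ j, N j ω ^ 2 = ∑ a, ∑ b, U a j * V a ω * (U b j * V b ω) := by
          intro j; rw [pow_two]; simp only [hN, Finset.sum_mul_sum]
        simp_rw [h1]
        rw [Finset.sum_comm]
        refine Finset.sum_congr rfl fun a _ => ?_
        rw [Finset.sum_comm]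
        have h2 : ∀ b, ∑ j, U a j * V a ω * (U b j * V b ω) =
            (1 : Matrix ι ι ℝ) a b * (V a ω * V b ω) := by
          intro b
          rw [← hUU', Matrix.mul_apply, Finset.sum_mul]
          refine Finset.sum_congr rfl fun j _ => ?_
          rw [Matrix.transpose_apply]; ring
        simp_rw [h2, Matrix.one_apply]
        simp [pow_two]
    have hprod : ∀ ω, Complex.exp (Complex.I * ξ * ((∑ i, (V i ω ^ 2 - A i i) : ℝ) : ℂ)) =
        ∏ j, (fun x : ℝ => Complex.exp (Complex.I * ξ *
          ((x ^ 2 - ev j : ℝ) : ℂ))) (N j ω) := by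
      intro ω
      rw [hsum, ← Complex.exp_sum]
      congr 1
      push_cast
      rw [Finset.mul_sum]
    simp_rw [hprod]
    rw [hind.integral_fun_prod_comp (fun j => (hNL2 j).aemeasurable)
      (f := fun j (x : ℝ) => Complex.exp (Complex.I * ξ * ((x ^ 2 - ev j : ℝ) : ℂ)))
      (fun j => (by fun_prop : Continuous _).aestronglyMeasurable),
      Finset.mul_sum, Complex.exp_sum]
    refine Finset.prod_congr rfl fun j _ => ?_
    have hl := (hNlaw.eval j).map_eq_gaussianReal
    rw [hNmean, hvar] at hl
    have := integral_cexp_sq_gaussianReal (ev j).toNNReal ξ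
    rw [← hl, integral_map (hNL2 j).aemeasurable
      (by fun_prop : Continuous _).aestronglyMeasurable, Real.coe_toNNReal _ (hlam0 j)] at this
    exact this

end QuadraticForm

/-! ### Traces of matrix powers as cyclic sums -/

section Trace

variable {ι : Type*} [Fintype ι]

/-- The arbitrary weight `G` of the two endpoints makes the induction close: the last edge of the
path is absorbed into a new weight. Taking `G a b = A b a` closes the path to a cycle. -/
lemma sum_path_eq_sum_pow [DecidableEq ι] (A : Matrix ι ι ℝ) (n : ℕ) (G : ι → ι → ℝ) :
    ∑ f : Fin (n + 1) → ι, (∏ i : Fin n, A (f i.castSucc) (f i.succ)) * G (f 0) (f (Fin.last n)) =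
      ∑ a, ∑ b, (A ^ n) a b * G a b := by
  induction n generalizing G with
  | zero =>
    rw [← (Equiv.funUnique (Fin 1) ι).symm.sum_comp]
    simp [Matrix.one_apply]
  | succ n ih =>
    rw [← (Fin.snocEquiv (fun _ : Fin (n + 2) => ι)).sum_comp, Fintype.sum_prod_type,
      Finset.sum_comm]
    have h1 : ∀ (f : Fin (n + 1) → ι) (x : ι),
        (∏ i : Fin (n + 1), A (Fin.snocEquiv (fun _ => ι) (x, f) i.castSucc)
          (Fin.snocEquiv (fun _ => ι) (x, f) i.succ)) *
          G (Fin.snocEquiv (fun _ => ι) (x, f) 0) (Fin.snocEquiv (fun _ => ι) (x, f) (Fin.last (n + 1))) =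
        (∏ i : Fin n, A (f i.castSucc) (f i.succ)) * (A (f (Fin.last n)) x * G (f 0) x) := by
      intro f x
      rw [Fin.prod_univ_castSucc]
      simp only [Fin.snocEquiv, Equiv.coe_fn_mk, Fin.snoc_castSucc, Fin.succ_last, Fin.snoc_last]
      have h0 : (Fin.snoc (α := fun _ => ι) f x : Fin (n + 2) → ι) 0 = f 0 := by
        rw [← Fin.castSucc_zero, Fin.snoc_castSucc]
      have hs : ∀ i : Fin n, (Fin.snoc (α := fun _ => ι) f x : Fin (n + 2) → ι) i.castSucc.succ =
          f i.succ := by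
        intro i
        rw [Fin.succ_castSucc, Fin.snoc_castSucc]
      simp only [h0, hs]
      ring
    simp_rw [h1, ← Finset.mul_sum]
    rw [ih (fun a b => ∑ x, A b x * G a x)]
    refine Finset.sum_congr rfl fun a _ => ?_
    simp_rw [pow_succ, Matrix.mul_apply, Finset.mul_sum, Finset.sum_mul]
    rw [Finset.sum_comm]
    refine Finset.sum_congr rfl fun b _ => Finset.sum_congr rfl fun x _ => by ring

lemma cyclicProduct_succ {X : Type*} (K : X → X → ℝ) (n : ℕ) (p : Fin (n + 1) → X) :
    cyclicProduct K (n + 1) p =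
      (∏ i : Fin n, K (p i.castSucc) (p i.succ)) * K (p (Fin.last n)) (p 0) := by
  rw [cyclicProduct, Fin.prod_univ_castSucc]
  simp

lemma sum_cyclicProduct_eq_trace [DecidableEq ι] (A : Matrix ι ι ℝ) (n : ℕ) :
    ∑ f : Fin (n + 1) → ι, cyclicProduct (fun a b => A a b) (n + 1) f = (A ^ (n + 1)).trace := by
  simp_rw [cyclicProduct_succ]
  rw [sum_path_eq_sum_pow A n (fun a b => A b a)]
  simp [Matrix.trace, pow_succ, Matrix.mul_apply]

/-- Every vertex of a cycle meets two edges, so symmetric weights `√u` on the edges amount to a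
weight `u` on each vertex. Quadrature weights can thus be put into a symmetric matrix. -/
lemma cyclicProduct_mul_left {X : Type*} (K : X → X → ℝ) (u : X → ℝ) (m : ℕ) (p : Fin m → X) :
    cyclicProduct (fun x y => Real.sqrt (u x) * Real.sqrt (u y) * K x y) m p =
      (∏ i, Real.sqrt (u (p i)) ^ 2) * cyclicProduct K m p := by
  unfold cyclicProduct
  rw [Finset.prod_mul_distrib, Finset.prod_mul_distrib,
    Equiv.prod_comp (finRotate m) (fun i => Real.sqrt (u (p i))), ← Finset.prod_mul_distrib]
  congr 1
  exact Finset.prod_congr rfl fun i _ => (pow_two _).symm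

end Trace

/-! ### Second-order estimates for Gaussian processes -/

lemma integral_abs_mul_le_sqrt {Ω : Type*} [MeasurableSpace Ω] {P : Measure Ω} {f g : Ω → ℝ}
    (hf : MemLp f 2 P) (hg : MemLp g 2 P) :
    ∫ ω, |f ω * g ω| ∂P ≤ Real.sqrt (∫ ω, f ω ^ 2 ∂P) * Real.sqrt (∫ ω, g ω ^ 2 ∂P) := by
  have h := integral_mul_le_Lp_mul_Lq_of_nonneg (μ := P) (Real.HolderConjugate.two_two)
    (f := fun ω => |f ω|) (g := fun ω => |g ω|) (ae_of_all _ fun _ => abs_nonneg _)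
    (ae_of_all _ fun _ => abs_nonneg _)
    (by rw [ENNReal.ofReal_ofNat]; exact hf.abs) (by rw [ENNReal.ofReal_ofNat]; exact hg.abs)
  simpa [abs_mul, Real.sqrt_eq_rpow] using h

/-- A measurable, mean-square continuous, centred Gaussian process with unit variances and
covariance function `K`. -/
structure IsUnitGaussianProcess {X Ω : Type*} [TopologicalSpace X] [MeasurableSpace X]
    [MeasurableSpace Ω] (Y : X → Ω → ℝ) (K : X → X → ℝ) (P : Measure Ω) : Prop where
  measurable : Measurable (fun q : X × Ω => Y q.1 q.2)
  gaussian : IsGaussianProcess Y P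
  mean_zero : ∀ x, ∫ ω, Y x ω ∂P = 0
  covariance : ∀ x y, ∫ ω, Y x ω * Y y ω ∂P = K x y
  variance_one : ∀ x, ∫ ω, Y x ω ^ 2 ∂P = 1
  meanSquare_continuous : ∀ x, Tendsto (fun y => ∫ ω, (Y y ω - Y x ω) ^ 2 ∂P) (𝓝 x) (𝓝 0)

namespace IsUnitGaussianProcess

variable {X Ω : Type*} [TopologicalSpace X] [MeasurableSpace X]
    [MeasurableSpace Ω] {Y : X → Ω → ℝ} {K : X → X → ℝ} {P : Measure Ω}

lemma memLp (h : IsUnitGaussianProcess Y K P) (x : X) : MemLp (Y x) 2 P :=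
  (h.gaussian.hasGaussianLaw_eval x).memLp_two

lemma apply_self (h : IsUnitGaussianProcess Y K P) (x : X) : K x x = 1 := by
  rw [← h.covariance, ← h.variance_one x]
  simp_rw [pow_two]

lemma abs_sub_le (h : IsUnitGaussianProcess Y K P) (x y z : X) :
    |K x z - K y z| ≤ Real.sqrt (∫ ω, (Y x ω - Y y ω) ^ 2 ∂P) := by
  have hint : ∀ x, Integrable (fun ω => Y x ω * Y z ω) P := fun x =>
    (h.memLp x).integrable_mul (h.memLp z)
  rw [← h.covariance, ← h.covariance, ← integral_sub (hint x) (hint y)]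
  calc |∫ ω, (Y x ω * Y z ω - Y y ω * Y z ω) ∂P|
      ≤ ∫ ω, |(Y x ω - Y y ω) * Y z ω| ∂P := by
        simp_rw [← sub_mul]
        exact abs_integral_le_integral_abs
    _ ≤ _ := by
        refine (integral_abs_mul_le_sqrt ((h.memLp x).sub (h.memLp y)) (h.memLp z)).trans ?_
        rw [h.variance_one z]
        simp

lemma symm (h : IsUnitGaussianProcess Y K P) (x y : X) : K x y = K y x := by
  rw [← h.covariance, ← h.covariance]
  simp_rw [mul_comm]

lemma abs_le_one (h : IsUnitGaussianProcess Y K P) (x y : X) : |K x y| ≤ 1 := by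
  rw [← h.covariance]
  refine abs_integral_le_integral_abs.trans
    ((integral_abs_mul_le_sqrt (h.memLp x) (h.memLp y)).trans ?_)
  rw [h.variance_one, h.variance_one]
  simp

/-- The arguments are changed one at a time, each increment being controlled by the mean-square
modulus; symmetry of `K` reduces the second argument to the first. -/
lemma continuous (h : IsUnitGaussianProcess Y K P) : Continuous fun p : X × X => K p.1 p.2 := by
  rw [continuous_iff_continuousAt]
  rintro ⟨x, y⟩
  rw [ContinuousAt, tendsto_iff_dist_tendsto_zero]
  have hx : Tendsto (fun p : X × X => Real.sqrt (∫ ω, (Y p.1 ω - Y x ω) ^ 2 ∂P)) (𝓝 (x, y)) (𝓝 0) := by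
    have := (h.meanSquare_continuous x).sqrt.comp (continuous_fst.tendsto (x, y))
    simpa [Function.comp_def] using this
  have hy : Tendsto (fun p : X × X => Real.sqrt (∫ ω, (Y p.2 ω - Y y ω) ^ 2 ∂P)) (𝓝 (x, y)) (𝓝 0) := by
    have := (h.meanSquare_continuous y).sqrt.comp (continuous_snd.tendsto (x, y))
    simpa [Function.comp_def] using this
  have hxy := hx.add hy
  rw [add_zero] at hxy
  refine squeeze_zero (fun _ => dist_nonneg) (fun p => ?_) hxy
  rw [Real.dist_eq]
  calc |K p.1 p.2 - K x y| = |(K p.1 p.2 - K x p.2) + (K p.2 x - K y x)| := by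
        rw [h.symm p.2 x, h.symm y x]; ring_nf
    _ ≤ |K p.1 p.2 - K x p.2| + |K p.2 x - K y x| := abs_add_le _ _
    _ ≤ _ := add_le_add (h.abs_sub_le _ _ _) (h.abs_sub_le _ _ _)

/-- Factor the difference of squares and apply Cauchy–Schwarz; the sum of two unit-variance
variables has `L²` norm at most 2. -/
lemma integral_abs_sq_sub_le (h : IsUnitGaussianProcess Y K P) (x y : X) :
    ∫ ω, |Y x ω ^ 2 - Y y ω ^ 2| ∂P ≤ 2 * Real.sqrt (∫ ω, (Y x ω - Y y ω) ^ 2 ∂P) := by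
  have h1 : ∀ ω, Y x ω ^ 2 - Y y ω ^ 2 = (Y x ω - Y y ω) * (Y x ω + Y y ω) := fun ω => by ring
  simp_rw [h1]
  refine (integral_abs_mul_le_sqrt ((h.memLp x).sub (h.memLp y))
    ((h.memLp x).add (h.memLp y))).trans ?_
  rw [mul_comm]
  refine mul_le_mul_of_nonneg_right ?_ (Real.sqrt_nonneg _)
  refine (Real.sqrt_le_left (by norm_num)).2 ?_
  have hx := (h.memLp x).integrable_sq
  have hy := (h.memLp y).integrable_sq
  calc ∫ ω, (Y x ω + Y y ω) ^ 2 ∂P ≤ ∫ ω, (2 * Y x ω ^ 2 + 2 * Y y ω ^ 2) ∂P := by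
        refine integral_mono ((h.memLp x).add (h.memLp y)).integrable_sq
          ((hx.const_mul 2).add (hy.const_mul 2)) fun ω => ?_
        simp only
        nlinarith [sq_nonneg (Y x ω - Y y ω)]
    _ = 2 ^ 2 := by
        rw [integral_add (hx.const_mul 2) (hy.const_mul 2), integral_const_mul, integral_const_mul,
          h.variance_one, h.variance_one]
        norm_num

end IsUnitGaussianProcess

/-! ### Discretization of the quadratic functional -/

section SimpleFunc

variable {X : Type*} [MeasurableSpace X] (μ : Measure X) (π : SimpleFunc X X)

lemma SimpleFunc.measurable_toRange : Measurable (fun x => (⟨π x, π.mem_range_self x⟩ : π.range)) :=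
  π.measurable.subtype_mk

lemma SimpleFunc.map_real_singleton [MeasurableSingletonClass X] (i : π.range) :
    (μ.map fun x => (⟨π x, π.mem_range_self x⟩ : π.range)).real {i} = μ.real (π ⁻¹' {(i : X)}) := by
  rw [map_measureReal_apply (SimpleFunc.measurable_toRange π) (measurableSet_singleton i)]
  congr 1
  ext x
  simp [Subtype.ext_iff]

lemma SimpleFunc.integral_comp [MeasurableSingletonClass X] [IsFiniteMeasure μ] (f : X → ℝ) :
    ∫ x, f (π x) ∂μ = ∑ i : π.range, μ.real (π ⁻¹' {(i : X)}) * f i := by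
  have h := integral_map (μ := μ) (SimpleFunc.measurable_toRange π).aemeasurable
    (f := fun i : π.range => f i) (measurable_of_finite _).aestronglyMeasurable
  rw [← h, integral_fintype .of_finite]
  simp_rw [SimpleFunc.map_real_singleton, smul_eq_mul]

/-- The map into the finite range of `π` pushes the product measure to a product measure on a finite
type, where integrals are sums. -/
lemma SimpleFunc.integral_pi_comp [MeasurableSingletonClass X] [IsFiniteMeasure μ] (m : ℕ)
    (f : (Fin m → X) → ℝ) :
    ∫ p : Fin m → X, f (fun i => π (p i)) ∂(Measure.pi fun _ => μ) =
      ∑ g : Fin m → π.range, (∏ i, μ.real (π ⁻¹' {(g i : X)})) * f (fun i => g i) := by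
  have hmap := Measure.pi_map_pi (ι := Fin m) (μ := fun _ => μ)
    (f := fun _ x => (⟨π x, π.mem_range_self x⟩ : π.range))
    (fun _ => (SimpleFunc.measurable_toRange π).aemeasurable)
  have hm : Measurable fun (p : Fin m → X) (i : Fin m) =>
      (⟨π (p i), π.mem_range_self (p i)⟩ : π.range) :=
    measurable_pi_lambda _ fun i => (SimpleFunc.measurable_toRange π).comp (measurable_pi_apply i)
  have h := integral_map (μ := Measure.pi fun _ : Fin m => μ) hm.aemeasurable
    (f := fun g : Fin m → π.range => f fun i => g i)
    (measurable_of_finite _).aestronglyMeasurable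
  rw [← h, hmap, integral_fintype .of_finite]
  refine Finset.sum_congr rfl fun g _ => ?_
  rw [smul_eq_mul, Measure.real, Measure.pi_singleton, ENNReal.toReal_prod]
  congr 1
  exact Finset.prod_congr rfl fun i _ => SimpleFunc.map_real_singleton μ π (g i)

end SimpleFunc

section Discretization

variable {X Ω : Type*} [PseudoMetricSpace X] [MeasurableSpace X] [MeasurableSpace Ω]
    {Y : X → Ω → ℝ} {K : X → X → ℝ} {P : Measure Ω}
    (μ : Measure X) [IsFiniteMeasure μ]

/-- With `u i = a μ(π⁻¹{i})`, the functional becomes the centred square norm of the Gaussian vector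
`√(u i) Y i`: since `K i i = 1`, the constants `-1` become the diagonal of its covariance matrix.
The traces of powers of this matrix are the cyclic integrals of `a K` read through `π`. -/
lemma IsUnitGaussianProcess.exists_charFun_simpleFunc [MeasurableSingletonClass X]
    (h : IsUnitGaussianProcess Y K P) (π : SimpleFunc X X) {a : ℝ} (ha : 0 ≤ a) :
    ∃ (n : ℕ) (lam : Fin n → ℝ), (∀ j, 0 ≤ lam j) ∧
      (∀ m : ℕ, ∑ j, lam j ^ (m + 1) = ∫ p : Fin (m + 1) → X,
        cyclicProduct (fun x y => a * K x y) (m + 1) (fun i => π (p i)) ∂(Measure.pi fun _ => μ)) ∧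
      ∀ ξ : ℝ, ∫ ω, Complex.exp (Complex.I * ξ *
          ((a * ∫ x, (Y (π x) ω ^ 2 - 1) ∂μ : ℝ) : ℂ)) ∂P =
        Complex.exp (1 / 2 * ∑ j, logRem (2 * Complex.I * ξ * lam j)) := by
  classical
  set w : X → ℝ := fun x => μ.real (π ⁻¹' {x}) with hw
  have hw0 : ∀ x, 0 ≤ w x := fun x => measureReal_nonneg
  set u : X → ℝ := fun x => a * w x with hu
  have hu0 : ∀ x, 0 ≤ u x := fun x => mul_nonneg ha (hw0 x)
  have hG := (h.gaussian.smul (fun x => Real.sqrt (u x))).hasGaussianLaw π.range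
  set A : Matrix π.range π.range ℝ :=
    Matrix.of fun i j => Real.sqrt (u i) * Real.sqrt (u j) * K i j with hA
  obtain ⟨lam, hlam0, hlamp, hlamc⟩ := exists_charFun_sum_sq
    (fun (i : π.range) ω => Real.sqrt (u i) • Y i ω) hG
    (fun i => by simp [integral_const_mul, h.mean_zero]) A (fun i j => by
      simp only [hA, Matrix.of_apply, ← h.covariance, ← integral_const_mul, smul_eq_mul]
      congr 1; ext ω; ring)
  let e := Fintype.equivFin π.range
  refine ⟨Fintype.card π.range, fun j => lam (e.symm j), fun j => hlam0 _, fun m => ?_, fun ξ => ?_⟩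
  · rw [e.symm.sum_comp (fun i => lam i ^ (m + 1)), hlamp, ← sum_cyclicProduct_eq_trace,
      SimpleFunc.integral_pi_comp μ π (m + 1) (cyclicProduct (fun x y => a * K x y) (m + 1))]
    refine Finset.sum_congr rfl fun g _ => ?_
    have h1 := cyclicProduct_mul_left (fun i j : π.range => K i j) (fun i => u i) (m + 1) g
    simp only [hA, Matrix.of_apply]
    rw [h1]
    simp only [cyclicProduct, Finset.prod_mul_distrib, Finset.prod_const, Finset.card_univ,
      Fintype.card_fin]
    simp_rw [Real.sq_sqrt (hu0 _), hu, Finset.prod_mul_distrib]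
    simp only [Finset.prod_const, Finset.card_univ, Fintype.card_fin, hw]
    ring
  · rw [e.symm.sum_comp (fun i => logRem (2 * Complex.I * ξ * lam i)), ← hlamc ξ]
    congr 1
    ext ω
    congr 3
    rw [SimpleFunc.integral_comp μ π (fun x => Y x ω ^ 2 - 1), Finset.mul_sum]
    refine Finset.sum_congr rfl fun i _ => ?_
    simp only [hA, Matrix.of_apply, smul_eq_mul]
    rw [mul_pow, Real.sq_sqrt (hu0 _), Real.mul_self_sqrt (hu0 _), h.apply_self]
    simp only [hu, hw]
    ring

variable [IsProbabilityMeasure P]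

lemma IsUnitGaussianProcess.integrable_sq_comp (h : IsUnitGaussianProcess Y K P) {π : X → X}
    (hπ : Measurable π) :
    Integrable (fun q : X × Ω => Y (π q.1) q.2 ^ 2 - 1) (μ.prod P) := by
  refine Integrable.sub ?_ (integrable_const _)
  have hm : Measurable fun q : X × Ω => Y (π q.1) q.2 ^ 2 :=
    (h.measurable.comp ((hπ.comp measurable_fst).prodMk measurable_snd)).pow_const 2
  rw [integrable_prod_iff hm.aestronglyMeasurable]
  refine ⟨ae_of_all _ fun x => (h.memLp (π x)).integrable_sq, ?_⟩
  have : (fun x => ∫ ω, ‖Y (π x) ω ^ 2‖ ∂P) = fun _ => 1 := by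
    ext x
    rw [← h.variance_one (π x)]
    congr 1; ext ω
    rw [Real.norm_of_nonneg (sq_nonneg _)]
  simp only [this]
  exact integrable_const _

/-- The map `x ↦ exp (iξx)` is `|ξ|`-Lipschitz, so closeness in `L¹` passes to characteristic
functions. -/
lemma norm_integral_cexp_sub_le {f g : Ω → ℝ} (hf : AEStronglyMeasurable f P)
    (hg : AEStronglyMeasurable g P) (hfg : Integrable (fun ω => f ω - g ω) P) (ξ : ℝ) :
    ‖(∫ ω, Complex.exp (Complex.I * ξ * (f ω : ℂ)) ∂P) -
      ∫ ω, Complex.exp (Complex.I * ξ * (g ω : ℂ)) ∂P‖ ≤ |ξ| * ∫ ω, |f ω - g ω| ∂P := by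
  have hexp : ∀ f : Ω → ℝ, AEStronglyMeasurable f P →
      Integrable (fun ω => Complex.exp (Complex.I * ξ * (f ω : ℂ))) P := by
    intro f hf
    refine Integrable.of_bound (C := 1) ?_ (ae_of_all _ fun ω => ?_)
    · exact (by fun_prop : Continuous fun x : ℝ =>
        Complex.exp (Complex.I * ξ * (x : ℂ))).comp_aestronglyMeasurable hf
    · rw [mul_assoc, ← Complex.ofReal_mul, Complex.norm_exp_I_mul_ofReal]
  rw [← integral_sub (hexp f hf) (hexp g hg), ← integral_const_mul]
  refine norm_integral_le_of_norm_le (hfg.abs.const_mul _) (ae_of_all _ fun ω => ?_)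
  have h1 : Complex.exp (Complex.I * ξ * (f ω : ℂ)) - Complex.exp (Complex.I * ξ * (g ω : ℂ)) =
      Complex.exp (Complex.I * ((ξ * g ω : ℝ) : ℂ)) *
        (Complex.exp (Complex.I * ((ξ * (f ω - g ω) : ℝ) : ℂ)) - 1) := by
    rw [mul_sub, ← Complex.exp_add]
    push_cast
    ring_nf
  rw [h1, norm_mul, Complex.norm_exp_I_mul_ofReal, one_mul, ← abs_mul, ← Real.norm_eq_abs]
  exact Real.norm_exp_I_mul_ofReal_sub_one_le

/-- Finite-dimensional approximation of a quadratic functional of a Gaussian process. -/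
theorem IsUnitGaussianProcess.exists_discretization [BorelSpace X] [SecondCountableTopology X]
    [MeasurableSingletonClass X] (h : IsUnitGaussianProcess Y K P)
    {a : ℝ} (ha : 0 ≤ a) {ε : ℝ} (hε : 0 < ε) (M : ℕ) :
    ∃ (n : ℕ) (lam : Fin n → ℝ), (∀ j, 0 ≤ lam j) ∧
      (∀ ξ : ℝ, ‖(∫ ω, Complex.exp (Complex.I * ξ * ((a * ∫ x, (Y x ω ^ 2 - 1) ∂μ : ℝ) : ℂ)) ∂P) -
        Complex.exp (1 / 2 * ∑ j, logRem (2 * Complex.I * ξ * lam j))‖ ≤ |ξ| * ε) ∧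
      ∀ m : ℕ, m < M → |∑ j, lam j ^ (m + 1) - ∫ p : Fin (m + 1) → X,
        cyclicProduct (fun x y => a * K x y) (m + 1) p ∂(Measure.pi fun _ => μ)| ≤ ε := by
  rcases isEmpty_or_nonempty X with hX | ⟨⟨x₀⟩⟩
  · have hμ : μ = 0 := Subsingleton.elim _ _
    refine ⟨0, Fin.elim0, fun j => j.elim0, fun ξ => ?_, fun m _ => ?_⟩
    · simp [hμ]
      positivity
    · have : IsEmpty (Fin (m + 1) → X) := ⟨fun p => hX.elim (p 0)⟩
      simp [integral_of_isEmpty, hε.le]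
  set π : ℕ → SimpleFunc X X :=
    SimpleFunc.approxOn id measurable_id univ x₀ (mem_univ _) with hπ
  have hlim : ∀ x, Tendsto (fun n => π n x) atTop (𝓝 x) := fun x =>
    SimpleFunc.tendsto_approxOn measurable_id (mem_univ _) (by simp)
  have hKmeas : Measurable fun p : X × X => K p.1 p.2 := h.continuous.measurable
  -- The kernel is continuous and bounded by one, so inserting the simple approximations is harmless
  -- in the limit.
  have hcyc : ∀ m : ℕ, Tendsto (fun n => ∫ p : Fin (m + 1) → X,
      cyclicProduct (fun x y => a * K x y) (m + 1) (fun i => π n (p i)) ∂(Measure.pi fun _ => μ))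
      atTop (𝓝 (∫ p : Fin (m + 1) → X,
        cyclicProduct (fun x y => a * K x y) (m + 1) p ∂(Measure.pi fun _ => μ))) := by
    intro m
    refine tendsto_integral_of_dominated_convergence (fun _ => a ^ (m + 1)) ?_
      (integrable_const _) ?_ ?_
    · intro n
      refine Measurable.aestronglyMeasurable ?_
      refine Finset.measurable_prod _ fun i _ => measurable_const.mul ?_
      exact hKmeas.comp (((π n).measurable.comp (measurable_pi_apply _)).prodMk
        ((π n).measurable.comp (measurable_pi_apply _)))
    · intro n
      refine ae_of_all _ fun p => ?_
      rw [cyclicProduct, norm_prod]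
      calc ∏ i, ‖a * K (π n (p i)) (π n (p (finRotate (m + 1) i)))‖
          ≤ ∏ _i : Fin (m + 1), a := by
            refine Finset.prod_le_prod (fun _ _ => norm_nonneg _) fun i _ => ?_
            rw [norm_mul, Real.norm_of_nonneg ha]
            exact mul_le_of_le_one_right ha (h.abs_le_one _ _)
        _ = a ^ (m + 1) := by simp
    · refine ae_of_all _ fun p => ?_
      refine tendsto_finsetProd _ fun i _ => Tendsto.const_mul _ ?_
      exact (h.continuous.tendsto (p i, p (finRotate (m + 1) i))).comp
        ((hlim _).prodMk_nhds (hlim _))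
  have hint : Integrable (fun q : X × Ω => Y q.1 q.2 ^ 2 - 1) (μ.prod P) :=
    h.integrable_sq_comp μ measurable_id
  have hintn : ∀ n, Integrable (fun q : X × Ω => Y (π n q.1) q.2 ^ 2 - 1) (μ.prod P) := fun n =>
    h.integrable_sq_comp μ (π n).measurable
  have hdiff : ∀ n, Integrable (fun q : X × Ω => Y q.1 q.2 ^ 2 - Y (π n q.1) q.2 ^ 2)
      (μ.prod P) := by
    intro n
    refine (hint.sub (hintn n)).congr (ae_of_all _ fun q => ?_)
    simp
  -- The `L¹` error at each point is at most 2 and vanishes by mean-square continuity.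
  have hG : Tendsto (fun n => ∫ x, ∫ ω, |Y x ω ^ 2 - Y (π n x) ω ^ 2| ∂P ∂μ) atTop (𝓝 0) := by
    have := tendsto_integral_of_dominated_convergence (μ := μ) (f := fun _ => (0 : ℝ))
      (F := fun n x => ∫ ω, |Y x ω ^ 2 - Y (π n x) ω ^ 2| ∂P) (fun _ => 2) ?_
      (integrable_const _) ?_ ?_
    · simpa using this
    · exact fun n => (hdiff n).abs.aestronglyMeasurable.integral_prod_right'
    · intro n
      refine ae_of_all _ fun x => ?_
      rw [Real.norm_of_nonneg (integral_nonneg fun _ => abs_nonneg _)]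
      have hx := (h.memLp x).integrable_sq
      have hy := (h.memLp (π n x)).integrable_sq
      calc ∫ ω, |Y x ω ^ 2 - Y (π n x) ω ^ 2| ∂P ≤ ∫ ω, (Y x ω ^ 2 + Y (π n x) ω ^ 2) ∂P := by
            refine integral_mono (hx.sub hy).abs (hx.add hy) fun ω => ?_
            refine (abs_sub _ _).trans ?_
            simp
        _ = 2 := by
            rw [integral_add hx hy, h.variance_one, h.variance_one]; norm_num
    · refine ae_of_all _ fun x => ?_
      have h1 : Tendsto (fun n => 2 * Real.sqrt (∫ ω, (Y (π n x) ω - Y x ω) ^ 2 ∂P)) atTop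
          (𝓝 0) := by
        have := (((h.meanSquare_continuous x).comp (hlim x)).sqrt).const_mul 2
        simpa using this
      refine squeeze_zero (fun n => integral_nonneg fun _ => abs_nonneg _) (fun n => ?_) h1
      have := h.integral_abs_sq_sub_le (π n x) x
      simpa only [abs_sub_comm] using this
  have hdist : ∀ n, Integrable (fun ω => a * ∫ x, (Y x ω ^ 2 - 1) ∂μ -
        a * ∫ x, (Y (π n x) ω ^ 2 - 1) ∂μ) P ∧
      ∫ ω, |a * ∫ x, (Y x ω ^ 2 - 1) ∂μ - a * ∫ x, (Y (π n x) ω ^ 2 - 1) ∂μ| ∂P ≤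
        a * ∫ x, ∫ ω, |Y x ω ^ 2 - Y (π n x) ω ^ 2| ∂P ∂μ := by
    intro n
    have hI : Integrable (fun ω => a * ∫ x, (Y x ω ^ 2 - 1) ∂μ -
        a * ∫ x, (Y (π n x) ω ^ 2 - 1) ∂μ) P :=
      (hint.integral_prod_right.const_mul a).sub ((hintn n).integral_prod_right.const_mul a)
    refine ⟨hI, ?_⟩
    rw [integral_integral_swap (f := fun x ω => |Y x ω ^ 2 - Y (π n x) ω ^ 2|) (hdiff n).abs,
      ← integral_const_mul]
    refine integral_mono_ae hI.abs ((hdiff n).abs.integral_prod_right.const_mul a) ?_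
    filter_upwards [hint.prod_left_ae, (hintn n).prod_left_ae] with ω h1 h2
    rw [← mul_sub, ← integral_sub h1 h2, abs_mul, abs_of_nonneg ha]
    gcongr
    refine abs_integral_le_integral_abs.trans (le_of_eq ?_)
    congr 1; ext x
    simp
  have hG' := hG.const_mul a
  rw [mul_zero] at hG'
  -- Only finitely many power sums are requested, so one simple function serves all of them.
  have hev : ∀ᶠ n in atTop, (a * ∫ x, ∫ ω, |Y x ω ^ 2 - Y (π n x) ω ^ 2| ∂P ∂μ < ε) ∧
      ∀ m ∈ Finset.range M, |(∫ p : Fin (m + 1) → X,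
        cyclicProduct (fun x y => a * K x y) (m + 1) (fun i => π n (p i)) ∂(Measure.pi fun _ => μ)) -
        ∫ p : Fin (m + 1) → X,
        cyclicProduct (fun x y => a * K x y) (m + 1) p ∂(Measure.pi fun _ => μ)| < ε := by
    refine (hG'.eventually_lt_const hε).and ?_
    rw [Filter.eventually_all_finset]
    intro m _
    have := (hcyc m).eventually (Metric.ball_mem_nhds _ hε)
    simpa [Real.dist_eq] using this
  obtain ⟨n, hn1, hn2⟩ := hev.exists
  obtain ⟨k, lam, hl0, hlp, hlc⟩ := h.exists_charFun_simpleFunc μ (π n) ha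
  refine ⟨k, lam, hl0, fun ξ => ?_, fun m hm => ?_⟩
  · rw [← hlc ξ]
    refine (norm_integral_cexp_sub_le
      (hint.integral_prod_right.const_mul a).aestronglyMeasurable
      ((hintn n).integral_prod_right.const_mul a).aestronglyMeasurable (hdist n).1 ξ).trans ?_
    gcongr
    exact (hdist n).2.trans hn1.le
  · rw [hlp m]
    exact (hn2 m (Finset.mem_range.2 hm)).le

end Discretization

/-! ### Integrability of negative powers -/

section NegativePowers

/-- A distance-like function with polynomially small sublevel sets has integrable negative powers,
with a bound depending only on the growth constants. -/
lemma lintegral_rpow_neg_le {X : Type*} [MeasurableSpace X] (μ : Measure X) {ρ : X → ℝ}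
    (hρm : Measurable ρ) (hρ0 : ∀ x, 0 ≤ ρ x) {A D β : ℝ} (hβ : 0 < β) (hβD : β < D)
    (hball : ∀ r, 0 < r → μ {x | ρ x < r} ≤ ENNReal.ofReal (A * r ^ D)) :
    ∫⁻ x, ENNReal.ofReal (ρ x) ^ (-β) ∂μ ≤
      μ univ + ∫⁻ t in Ioi (1 : ℝ), ENNReal.ofReal (A * t ^ (-(D / β))) := by
  have hD : 0 < D := hβ.trans hβD
  -- Real and extended negative powers differ where `ρ = 0`, so this set has to be null.
  have hzero : μ {x | ρ x = 0} = 0 := by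
    have hlim : Tendsto (fun r : ℝ => ENNReal.ofReal (A * r ^ D)) (𝓝[>] 0) (𝓝 0) := by
      have h1 : Tendsto (fun r : ℝ => ENNReal.ofReal (A * r ^ D)) (𝓝 0) (𝓝 0) := by
        have : ContinuousAt (fun r : ℝ => ENNReal.ofReal (A * r ^ D)) 0 :=
          ENNReal.continuous_ofReal.continuousAt.comp
            (continuousAt_const.mul (Real.continuousAt_rpow_const _ _ (Or.inr hD.le)))
        have h2 := this.tendsto
        simpa [Real.zero_rpow hD.ne'] using h2
      exact h1.mono_left nhdsWithin_le_nhds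
    refine le_antisymm (ge_of_tendsto hlim ?_) zero_le
    filter_upwards [self_mem_nhdsWithin] with r hr
    refine (measure_mono fun x hx => ?_).trans (hball r hr)
    have hx' : ρ x = 0 := hx
    show ρ x < r
    rw [hx']
    exact hr
  have hae : ∀ᵐ x ∂μ, ENNReal.ofReal (ρ x) ^ (-β) = ENNReal.ofReal (ρ x ^ (-β)) := by
    have : ∀ᵐ x ∂μ, ρ x ≠ 0 := by
      rw [ae_iff]
      simpa using hzero
    filter_upwards [this] with x hx
    exact ENNReal.ofReal_rpow_of_pos (lt_of_le_of_ne (hρ0 x) (Ne.symm hx))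
  -- Layer-cake formula. Levels up to 1 cost at most the total mass; above 1 the level set is `ρ < t
  -- ^ (-1/β)`, of measure at most `A t ^ (-D/β)`.
  rw [lintegral_congr_ae hae, lintegral_eq_lintegral_meas_lt μ
    (ae_of_all _ fun x => Real.rpow_nonneg (hρ0 x) _) (hρm.pow_const _).aemeasurable,
    ← Ioc_union_Ioi_eq_Ioi zero_le_one]
  refine (lintegral_union_le _ _ _).trans (add_le_add ?_ ?_)
  · calc ∫⁻ t in Ioc (0 : ℝ) 1, μ {a | t < ρ a ^ (-β)} ≤ ∫⁻ _t in Ioc (0 : ℝ) 1, μ univ :=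
          lintegral_mono fun t => measure_mono (subset_univ _)
      _ = μ univ := by simp
  · refine setLIntegral_mono' measurableSet_Ioi fun t ht => ?_
    have ht0 : (0 : ℝ) < t := zero_lt_one.trans ht
    have h1 := hball (t ^ (-(1 / β))) (Real.rpow_pos_of_pos ht0 _)
    rw [← Real.rpow_mul ht0.le, show -(1 / β) * D = -(D / β) by ring] at h1
    refine (measure_mono fun x hx => ?_).trans h1
    have hx' : t < ρ x ^ (-β) := hx
    have hpos : 0 < ρ x := by
      refine lt_of_le_of_ne (hρ0 x) fun h => ?_
      rw [← h, Real.zero_rpow (by linarith)] at hx'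
      linarith
    show ρ x < t ^ (-(1 / β))
    have h2 := Real.rpow_lt_rpow_of_neg ht0 hx' (z := -(1 / β)) (by
      have : 0 < 1 / β := by positivity
      linarith)
    rw [← Real.rpow_mul hpos.le] at h2
    rwa [show -β * -(1 / β) = 1 by field_simp, Real.rpow_one] at h2

lemma lintegral_Ioi_rpow_lt_top {A D β : ℝ} (hβ : 0 < β) (hβD : β < D) :
    ∫⁻ t in Ioi (1 : ℝ), ENNReal.ofReal (A * t ^ (-(D / β))) < ⊤ := by
  have h : IntegrableOn (fun t : ℝ => A * t ^ (-(D / β))) (Ioi 1) := by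
    refine (integrableOn_Ioi_rpow_of_lt ?_ zero_lt_one).const_mul A
    have : 1 < D / β := (one_lt_div hβ).2 hβD
    linarith
  exact h.lintegral_lt_top

end NegativePowers

/-! ### Surface measure of spherical caps -/

section SphereCaps

-- The surface measure of a cap is `d + 1` times the volume of the cone over it. The cone is covered
-- by `⌈1/r⌉` balls of radius `2r` centred along its axis, of total volume of order `r ^ d`. The
-- condition `r ≤ 1` absorbs the rounding in `⌈1/r⌉ ≤ 2/r`.
open scoped Pointwise in
lemma unitSurface_cap_le_of_le_one (d : ℕ) (u : Sph d) {r : ℝ} (hr : 0 < r) (hr1 : r ≤ 1) :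
    unitSurface d {v | ‖(u : E d) - (v : E d)‖ < r} ≤
      ENNReal.ofReal ((d + 1) * (2 ^ (d + 2) * (volume : Measure (E d)).real (Metric.ball 0 1)) *
        r ^ d) := by
  have hmeas : MeasurableSet {v : Sph d | ‖(u : E d) - (v : E d)‖ < r} :=
    measurableSet_lt (by fun_prop) measurable_const
  have hfin : Module.finrank ℝ (E d) = d + 1 := by simp
  rw [unitSurface, Measure.toSphere_apply' _ hmeas, hfin]
  set n : ℕ := ⌈1 / r⌉₊ with hn
  have hcover : Ioo (0 : ℝ) 1 • ((↑) '' {v : Sph d | ‖(u : E d) - (v : E d)‖ < r}) ⊆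
      ⋃ j ∈ Finset.range n, Metric.ball (((j : ℝ) * r) • (u : E d)) (2 * r) := by
    rintro x ⟨s, hs, -, ⟨v, hv, rfl⟩, rfl⟩
    have hv' : ‖(u : E d) - (v : E d)‖ < r := hv
    set j : ℕ := ⌊s / r⌋₊ with hj
    have hsr : 0 ≤ s / r := (div_pos hs.1 hr).le
    have hj1 : (j : ℝ) * r ≤ s := by
      have := Nat.floor_le hsr
      rwa [← hj, le_div_iff₀ hr] at this
    have hj2 : s < (j : ℝ) * r + r := by
      have := Nat.lt_floor_add_one (s / r)
      rw [← hj, div_lt_iff₀ hr] at this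
      linarith
    have hjn : j < n := by
      have h1 : (j : ℝ) ≤ s / r := Nat.floor_le hsr
      have h2 : s / r < 1 / r := div_lt_div_of_pos_right hs.2 hr
      have h3 : (1 / r) ≤ (n : ℝ) := Nat.le_ceil _
      exact_mod_cast h1.trans_lt (h2.trans_le h3)
    simp only [mem_iUnion, Finset.mem_range, exists_prop]
    refine ⟨j, hjn, ?_⟩
    rw [Metric.mem_ball, dist_eq_norm]
    have hvn : ‖(v : E d)‖ = 1 := norm_eq_of_mem_sphere v
    calc ‖s • (v : E d) - ((j : ℝ) * r) • (u : E d)‖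
        = ‖(s - (j : ℝ) * r) • (v : E d) - ((j : ℝ) * r) • ((u : E d) - (v : E d))‖ := by
          congr 1; module
      _ ≤ ‖(s - (j : ℝ) * r) • (v : E d)‖ + ‖((j : ℝ) * r) • ((u : E d) - (v : E d))‖ :=
          norm_sub_le _ _
      _ = (s - (j : ℝ) * r) + ((j : ℝ) * r) * ‖(u : E d) - (v : E d)‖ := by
          rw [norm_smul, norm_smul, hvn, mul_one, Real.norm_of_nonneg (by linarith),
            Real.norm_of_nonneg (by positivity)]
      _ < 2 * r := by
          have : ((j : ℝ) * r) * ‖(u : E d) - (v : E d)‖ ≤ 1 * r :=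
            mul_le_mul (by linarith [hs.2]) hv'.le (norm_nonneg _) zero_le_one
          linarith
  have hvol : ∀ x : E d, (volume : Measure (E d)) (Metric.ball x (2 * r)) =
      ENNReal.ofReal ((2 * r) ^ (d + 1) * (volume : Measure (E d)).real (Metric.ball 0 1)) := by
    intro x
    rw [Measure.addHaar_ball_of_pos _ _ (by positivity), hfin, ENNReal.ofReal_mul (by positivity),
      Measure.real, ENNReal.ofReal_toReal measure_ball_lt_top.ne]
  have hn2 : (n : ℝ) ≤ 2 / r := by
    have h1 := (Nat.ceil_lt_add_one (by positivity : 0 ≤ 1 / r)).le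
    have h2 : 1 ≤ 1 / r := (one_le_div hr).2 hr1
    calc (n : ℝ) ≤ 1 / r + 1 := h1
      _ ≤ 1 / r + 1 / r := by linarith
      _ = 2 / r := by ring
  calc ((d + 1 : ℕ) : ENNReal) * (volume : Measure (E d))
        (Ioo (0 : ℝ) 1 • ((↑) '' {v : Sph d | ‖(u : E d) - (v : E d)‖ < r}))
      ≤ ((d + 1 : ℕ) : ENNReal) * ∑ j ∈ Finset.range n,
          (volume : Measure (E d)) (Metric.ball (((j : ℝ) * r) • (u : E d)) (2 * r)) := by
        gcongr
        exact (measure_mono hcover).trans (measure_biUnion_finset_le _ _)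
    _ = ENNReal.ofReal ((d + 1) * (n * ((2 * r) ^ (d + 1) *
          (volume : Measure (E d)).real (Metric.ball 0 1)))) := by
        simp_rw [hvol]
        rw [Finset.sum_const, Finset.card_range, nsmul_eq_mul, ← ENNReal.ofReal_natCast,
          ← ENNReal.ofReal_natCast, ← ENNReal.ofReal_mul (by positivity),
          ← ENNReal.ofReal_mul (by positivity)]
        push_cast
        rfl
    _ ≤ _ := by
        apply ENNReal.ofReal_le_ofReal
        have : (n : ℝ) * ((2 * r) ^ (d + 1) * (volume : Measure (E d)).real (Metric.ball 0 1)) ≤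
            2 / r * ((2 * r) ^ (d + 1) * (volume : Measure (E d)).real (Metric.ball 0 1)) := by
          gcongr
        calc (d + 1 : ℝ) * (n * ((2 * r) ^ (d + 1) *
              (volume : Measure (E d)).real (Metric.ball 0 1)))
            ≤ (d + 1) * (2 / r * ((2 * r) ^ (d + 1) *
              (volume : Measure (E d)).real (Metric.ball 0 1))) := by gcongr
          _ = _ := by
            rw [mul_pow, pow_succ r]
            field_simp
            ring

instance (d : ℕ) : IsFiniteMeasure (unitSurface d) := by
  unfold unitSurface; infer_instance

instance (d : ℕ) : IsFiniteMeasure (unitDomain d) := by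
  unfold unitDomain; infer_instance

lemma exists_unitSurface_cap_le (d : ℕ) : ∃ A : ℝ, ∀ (u : Sph d) (r : ℝ), 0 < r →
    unitSurface d {v | ‖(u : E d) - (v : E d)‖ < r} ≤ ENNReal.ofReal (A * r ^ (d : ℝ)) := by
  set A₁ : ℝ := (d + 1) * (2 ^ (d + 2) * (volume : Measure (E d)).real (Metric.ball 0 1)) with hA₁
  have hA₁0 : 0 ≤ A₁ := by positivity
  refine ⟨A₁ + (unitSurface d).real univ, fun u r hr => ?_⟩
  rw [Real.rpow_natCast]
  rcases le_total r 1 with h | h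
  · refine (unitSurface_cap_le_of_le_one d u hr h).trans (ENNReal.ofReal_le_ofReal ?_)
    rw [← hA₁, add_mul]
    have : 0 ≤ (unitSurface d).real univ * r ^ d := by positivity
    linarith
  · refine (measure_mono (subset_univ _)).trans ?_
    rw [← ENNReal.ofReal_toReal (measure_ne_top (unitSurface d) univ)]
    apply ENNReal.ofReal_le_ofReal
    have h1 : 1 ≤ r ^ d := one_le_pow₀ h
    have h2 : 0 ≤ (unitSurface d).real univ := measureReal_nonneg
    change (unitSurface d).real univ ≤ _
    nlinarith [mul_nonneg hA₁0 (zero_le_one.trans h1)]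

end SphereCaps

/-! ### The extended-valued Riesz kernel -/

/-- The product Riesz kernel with values in `[0, ∞]`, infinite on the diagonals. -/
noncomputable def rieszKernelENN (d : ℕ) (βT βS : ℝ) (p q : Sph d × ℝ) : ENNReal :=
  ENNReal.ofReal |p.2 - q.2| ^ (-βT) * ENNReal.ofReal ‖(p.1 : E d) - (q.1 : E d)‖ ^ (-βS)

lemma measurable_rieszKernelENN (d : ℕ) (βT βS : ℝ) :
    Measurable fun z : (Sph d × ℝ) × (Sph d × ℝ) => rieszKernelENN d βT βS z.1 z.2 := by
  unfold rieszKernelENN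
  refine Measurable.mul ?_ ?_
  · exact (by fun_prop : Continuous fun z : (Sph d × ℝ) × (Sph d × ℝ) =>
      |z.1.2 - z.2.2|).measurable.ennreal_ofReal.pow_const _
  · exact (by fun_prop : Continuous fun z : (Sph d × ℝ) × (Sph d × ℝ) =>
      ‖(z.1.1 : E d) - (z.2.1 : E d)‖).measurable.ennreal_ofReal.pow_const _

lemma rieszKernelENN_symm (d : ℕ) (βT βS : ℝ) (p q : Sph d × ℝ) :
    rieszKernelENN d βT βS p q = rieszKernelENN d βT βS q p := by
  unfold rieszKernelENN
  rw [abs_sub_comm, norm_sub_rev]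

lemma rieszKernelENN_ne_zero (d : ℕ) {βT βS : ℝ} (hT : 0 < βT) (hS : 0 < βS) (p q : Sph d × ℝ) :
    rieszKernelENN d βT βS p q ≠ 0 := by
  unfold rieszKernelENN
  simp [ENNReal.rpow_eq_zero_iff, hT.le, hS.le, not_lt]

lemma rieszKernelENN_eq_ofReal (d : ℕ) (βT βS : ℝ) {p q : Sph d × ℝ} (h2 : p.2 ≠ q.2)
    (h1 : p.1 ≠ q.1) : rieszKernelENN d βT βS p q =
      ENNReal.ofReal (|p.2 - q.2| ^ (-βT) * ‖(p.1 : E d) - (q.1 : E d)‖ ^ (-βS)) := by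
  have h1' : (p.1 : E d) - (q.1 : E d) ≠ 0 := sub_ne_zero.2 fun h => h1 (Subtype.ext h)
  unfold rieszKernelENN
  rw [ENNReal.ofReal_rpow_of_pos (abs_pos.2 (sub_ne_zero.2 h2)),
    ENNReal.ofReal_rpow_of_pos (norm_pos_iff.2 h1'), ← ENNReal.ofReal_mul (by positivity)]

/-- The kernel is infinite on both diagonals, since neither factor vanishes. Almost-everywhere
finiteness therefore excludes the diagonals without computing their measure. -/
lemma ne_of_rieszKernelENN_ne_top {d : ℕ} {βT βS : ℝ} (hT : 0 < βT) (hS : 0 < βS)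
    {p q : Sph d × ℝ} (h : rieszKernelENN d βT βS p q ≠ ⊤) : p.2 ≠ q.2 ∧ p.1 ≠ q.1 := by
  constructor
  · intro h2
    apply h
    unfold rieszKernelENN
    rw [h2, sub_self, abs_zero, ENNReal.ofReal_zero, ENNReal.zero_rpow_of_neg (by linarith)]
    refine ENNReal.top_mul ?_
    simp [ENNReal.rpow_eq_zero_iff, hS.le, not_lt]
  · intro h1
    apply h
    unfold rieszKernelENN
    rw [h1, sub_self, norm_zero, ENNReal.ofReal_zero, ENNReal.zero_rpow_of_neg (by linarith)]
    refine ENNReal.mul_top ?_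
    simp [ENNReal.rpow_eq_zero_iff, hT.le, not_lt]

/-- Only an inequality: on the diagonals the real kernel is `1 / 0 = 0`, while the extended one is
infinite. -/
lemma enorm_rieszKernel_le (d : ℕ) {αT αS : ℝ} (hT : 0 < αT) (hS : 0 < αS) (p q : Sph d × ℝ) :
    ‖rieszKernel d αT αS p q‖ₑ ≤ rieszKernelENN d αT αS p q := by
  by_cases h2 : p.2 = q.2
  · simp [rieszKernel, h2, Real.zero_rpow hT.ne']
  by_cases h1 : p.1 = q.1
  · simp [rieszKernel, h1, Real.zero_rpow hS.ne']
  rw [rieszKernelENN_eq_ofReal d αT αS h2 h1, Real.enorm_of_nonneg (by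
    unfold rieszKernel; positivity)]
  refine (congrArg ENNReal.ofReal ?_).le
  rw [rieszKernel, Real.rpow_neg (abs_nonneg _), Real.rpow_neg (norm_nonneg _), one_div, mul_inv]

lemma measurable_rieszKernel (d : ℕ) (αT αS : ℝ) :
    Measurable fun z : (Sph d × ℝ) × (Sph d × ℝ) => rieszKernel d αT αS z.1 z.2 := by
  unfold rieszKernel
  refine Measurable.div measurable_const (Measurable.mul ?_ ?_)
  · exact (by fun_prop : Continuous fun z : (Sph d × ℝ) × (Sph d × ℝ) =>
      |z.1.2 - z.2.2|).measurable.pow_const _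
  · exact (by fun_prop : Continuous fun z : (Sph d × ℝ) × (Sph d × ℝ) =>
      ‖(z.1.1 : E d) - (z.2.1 : E d)‖).measurable.pow_const _

/-- The kernel is a product of a space and a time factor, with growth dimensions `d` and 1. The
growth constants do not depend on the centre, hence neither does the bound. -/
lemma exists_lintegral_rieszKernelENN_le (d : ℕ) {βT βS : ℝ} (hT : 0 < βT) (hT1 : βT < 1)
    (hS : 0 < βS) (hSd : βS < d) :
    ∃ κ : ENNReal, κ ≠ ⊤ ∧ ∀ p, ∫⁻ q, rieszKernelENN d βT βS p q ∂(unitDomain d) ≤ κ := by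
  obtain ⟨A, hcap⟩ := exists_unitSurface_cap_le d
  refine ⟨(unitSurface d univ + ∫⁻ t in Ioi (1 : ℝ), ENNReal.ofReal (A * t ^ (-((d : ℝ) / βS)))) *
    ((volume : Measure ℝ).restrict (Icc (-1) 1) univ +
      ∫⁻ t in Ioi (1 : ℝ), ENNReal.ofReal (2 * t ^ (-(1 / βT)))), ?_, fun p => ?_⟩
  · refine ENNReal.mul_ne_top (ENNReal.add_ne_top.2 ⟨measure_ne_top _ _, ?_⟩)
      (ENNReal.add_ne_top.2 ⟨measure_ne_top _ _, ?_⟩)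
    · exact (lintegral_Ioi_rpow_lt_top hS hSd).ne
    · exact (lintegral_Ioi_rpow_lt_top hT hT1).ne
  · have h1 := lintegral_rpow_neg_le (unitSurface d)
      (ρ := fun v => ‖(p.1 : E d) - (v : E d)‖) (by fun_prop) (fun _ => norm_nonneg _) hS hSd
      (hcap p.1)
    have h2 := lintegral_rpow_neg_le ((volume : Measure ℝ).restrict (Icc (-1) 1))
      (ρ := fun s => |p.2 - s|) (by fun_prop) (fun _ => abs_nonneg _) hT hT1 (by
        intro r hr
        refine (Measure.restrict_apply_le _ _).trans ?_
        have : {s : ℝ | |p.2 - s| < r} = Metric.ball p.2 r := by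
          ext s; simp [Real.dist_eq, abs_sub_comm]
        rw [this, Real.volume_ball, Real.rpow_one])
    unfold rieszKernelENN unitDomain
    simp_rw [mul_comm (ENNReal.ofReal |_| ^ (-βT))]
    rw [lintegral_prod_mul (f := fun v : Sph d => ENNReal.ofReal ‖(p.1 : E d) - (v : E d)‖ ^ (-βS))
      (g := fun s : ℝ => ENNReal.ofReal |p.2 - s| ^ (-βT))]
    · exact mul_le_mul' h1 h2
    · exact ((by fun_prop : Continuous fun v : Sph d =>
        ‖(p.1 : E d) - (v : E d)‖).measurable.ennreal_ofReal.pow_const _).aemeasurable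
    · exact ((by fun_prop : Continuous fun s : ℝ =>
        |p.2 - s|).measurable.ennreal_ofReal.pow_const _).aemeasurable

/-! ### Finiteness and convergence of cyclic integrals -/

section Cyclic

variable {X : Type*} [MeasurableSpace X] (μ : Measure X) [SigmaFinite μ]

lemma lintegral_pi_succ (n : ℕ) (f : (Fin (n + 1) → X) → ENNReal) (hf : Measurable f) :
    ∫⁻ p, f p ∂(Measure.pi fun _ => μ) =
      ∫⁻ q : Fin n → X, ∫⁻ x, f (Fin.snoc (α := fun _ => X) q x) ∂μ ∂(Measure.pi fun _ => μ) := by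
  have h := (measurePreserving_piFinSuccAbove (fun _ : Fin (n + 1) => μ) (Fin.last n)).symm
  have h2 := lintegral_prod_symm' (μ := μ) (ν := Measure.pi fun _ : Fin n => μ)
    (fun z => f ((MeasurableEquiv.piFinSuccAbove (fun _ => X) (Fin.last n)).symm z))
    (hf.comp (MeasurableEquiv.measurable _))
  rw [← h.lintegral_comp hf]
  refine h2.trans ?_
  simp [MeasurableEquiv.piFinSuccAbove, Fin.insertNthEquiv, Fin.insertNth_last']

variable {k : X → X → ENNReal} (hk : Measurable fun z : X × X => k z.1 z.2) {κ : ENNReal}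

include hk

lemma measurable_kernel_comp {W : Type*} [MeasurableSpace W] {f g : W → X} (hf : Measurable f)
    (hg : Measurable g) : Measurable fun w => k (f w) (g w) :=
  hk.comp (hf.prodMk hg)

lemma measurable_path (n : ℕ) :
    Measurable fun p : Fin (n + 1) → X => ∏ i : Fin n, k (p i.castSucc) (p i.succ) :=
  Finset.measurable_prod _ fun i _ =>
    measurable_kernel_comp hk (measurable_pi_apply i.castSucc) (measurable_pi_apply i.succ)

/-- Integrating out the free end of a path costs one factor `κ`. -/
lemma lintegral_path_le (hκ : ∀ x, ∫⁻ y, k x y ∂μ ≤ κ) (n : ℕ) :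
    ∫⁻ p : Fin (n + 1) → X, ∏ i : Fin n, k (p i.castSucc) (p i.succ) ∂(Measure.pi fun _ => μ) ≤
      μ univ * κ ^ n := by
  induction n with
  | zero => simp [Measure.pi_univ]
  | succ n ih =>
    rw [lintegral_pi_succ μ (n + 1) _ (measurable_path hk (n + 1))]
    have h1 : ∀ (q : Fin (n + 1) → X) (x : X), ∏ i : Fin (n + 1),
        k (Fin.snoc (α := fun _ => X) q x i.castSucc) (Fin.snoc (α := fun _ => X) q x i.succ) =
        (∏ i : Fin n, k (q i.castSucc) (q i.succ)) * k (q (Fin.last n)) x := by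
      intro q x
      rw [Fin.prod_univ_castSucc]
      simp only [Fin.snoc_castSucc, Fin.succ_last, Fin.snoc_last, Fin.succ_castSucc]
    simp_rw [h1]
    calc ∫⁻ q : Fin (n + 1) → X, ∫⁻ x, (∏ i : Fin n, k (q i.castSucc) (q i.succ)) *
          k (q (Fin.last n)) x ∂μ ∂(Measure.pi fun _ => μ)
        ≤ ∫⁻ q : Fin (n + 1) → X, (∏ i : Fin n, k (q i.castSucc) (q i.succ)) * κ
            ∂(Measure.pi fun _ => μ) := by
          refine lintegral_mono fun q => ?_
          simp only
          rw [lintegral_const_mul _ (measurable_kernel_comp hk measurable_const measurable_id')]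
          gcongr
          exact hκ _
      _ ≤ μ univ * κ ^ n * κ := by
          rw [lintegral_mul_const _ (measurable_path hk n)]
          gcongr
      _ = μ univ * κ ^ (n + 1) := by rw [pow_succ, mul_assoc]

lemma measurable_cyclic (m : ℕ) :
    Measurable fun p : Fin m → X => ∏ i : Fin m, k (p i) (p (finRotate m i)) :=
  Finset.measurable_prod _ fun i _ =>
    measurable_kernel_comp hk (measurable_pi_apply i) (measurable_pi_apply _)

/-- The last vertex occurs in two factors only; their product is at most the sum of their squares,
whose integral is at most `2κ`. What remains is a path. -/
lemma lintegral_cyclic_le (hsymm : ∀ x y, k x y = k y x) (hκ : ∀ x, ∫⁻ y, k x y ∂μ ≤ κ)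
    (hκ2 : ∀ x, ∫⁻ y, k x y ^ 2 ∂μ ≤ κ) (n : ℕ) :
    ∫⁻ p : Fin (n + 2) → X, ∏ i : Fin (n + 2), k (p i) (p (finRotate (n + 2) i))
      ∂(Measure.pi fun _ => μ) ≤ μ univ * κ ^ n * (κ + κ) := by
  rw [lintegral_pi_succ μ (n + 1) _ (measurable_cyclic hk (n + 2))]
  have h1 : ∀ (q : Fin (n + 1) → X) (x : X), ∏ i : Fin (n + 2),
      k (Fin.snoc (α := fun _ => X) q x i) (Fin.snoc (α := fun _ => X) q x (finRotate (n + 2) i)) =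
      (∏ i : Fin n, k (q i.castSucc) (q i.succ)) * (k (q (Fin.last n)) x * k (q 0) x) := by
    intro q x
    rw [Fin.prod_univ_castSucc, Fin.prod_univ_castSucc]
    have h0 : (Fin.snoc (α := fun _ => X) q x : Fin (n + 2) → X) 0 = q 0 := by
      rw [← Fin.castSucc_zero, Fin.snoc_castSucc]
    have hs : ∀ i : Fin n, (Fin.snoc (α := fun _ => X) q x : Fin (n + 2) → X) i.castSucc.succ =
        q i.succ := by
      intro i
      rw [Fin.succ_castSucc, Fin.snoc_castSucc]
    simp [h0, hs, hsymm x, mul_assoc]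
  simp_rw [h1]
  calc ∫⁻ q : Fin (n + 1) → X, ∫⁻ x, (∏ i : Fin n, k (q i.castSucc) (q i.succ)) *
        (k (q (Fin.last n)) x * k (q 0) x) ∂μ ∂(Measure.pi fun _ => μ)
      ≤ ∫⁻ q : Fin (n + 1) → X, (∏ i : Fin n, k (q i.castSucc) (q i.succ)) * (κ + κ)
          ∂(Measure.pi fun _ => μ) := by
        refine lintegral_mono fun q => ?_
        have hm : ∀ y, Measurable (fun x => k y x) := fun y =>
          measurable_kernel_comp hk measurable_const measurable_id'
        have hm2 : Measurable fun x => k (q (Fin.last n)) x * k (q 0) x := (hm _).mul (hm _)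
        simp only
        rw [lintegral_const_mul _ hm2]
        gcongr
        calc ∫⁻ x, k (q (Fin.last n)) x * k (q 0) x ∂μ
            ≤ ∫⁻ x, (k (q (Fin.last n)) x ^ 2 + k (q 0) x ^ 2) ∂μ := by
              refine lintegral_mono fun x => ?_
              simp only
              rcases le_total (k (q (Fin.last n)) x) (k (q 0) x) with h | h
              · refine le_add_left ?_
                rw [pow_two]
                gcongr
              · refine le_add_right ?_
                rw [pow_two]
                gcongr
          _ ≤ κ + κ := by
              rw [lintegral_add_left ((hm _).pow_const 2)]
              exact add_le_add (hκ2 _) (hκ2 _)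
    _ ≤ _ := by
        rw [lintegral_mul_const _ (measurable_path hk n)]
        gcongr
        exact lintegral_path_le μ hk hκ n

end Cyclic

/-- The square of the kernel is the kernel with doubled exponents, integrable because `2 βT < 1` and
`2 βS < d`. -/
lemma lintegral_cyclic_rieszKernelENN_lt_top (d : ℕ) {βT βS : ℝ} (hT : 0 < βT) (hT1 : βT < 1 / 2)
    (hS : 0 < βS) (hSd : βS < (d : ℝ) / 2) (n : ℕ) :
    ∫⁻ p : Fin (n + 2) → Sph d × ℝ, ∏ i : Fin (n + 2),
      rieszKernelENN d βT βS (p i) (p (finRotate (n + 2) i))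
      ∂(Measure.pi fun _ => unitDomain d) < ⊤ := by
  obtain ⟨κ₁, hκ₁, h1⟩ := exists_lintegral_rieszKernelENN_le d hT (by linarith) hS
    (by linarith : βS < d)
  obtain ⟨κ₂, hκ₂, h2⟩ := exists_lintegral_rieszKernelENN_le d (by linarith : 0 < 2 * βT)
    (by linarith) (by linarith : 0 < 2 * βS) (by linarith : 2 * βS < d)
  have hsq : ∀ p q, rieszKernelENN d βT βS p q ^ 2 = rieszKernelENN d (2 * βT) (2 * βS) p q := by
    intro p q
    unfold rieszKernelENN
    rw [mul_pow, ← ENNReal.rpow_natCast, ← ENNReal.rpow_natCast, ← ENNReal.rpow_mul,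
      ← ENNReal.rpow_mul]
    congr 2 <;> push_cast <;> ring
  refine (lintegral_cyclic_le (unitDomain d) (measurable_rieszKernelENN d βT βS) (κ := κ₁ + κ₂)
    (rieszKernelENN_symm d βT βS) (fun p => (h1 p).trans le_self_add)
    (fun p => ?_) n).trans_lt ?_
  · simp_rw [hsq]
    exact (h2 p).trans le_add_self
  · have hκ : κ₁ + κ₂ ≠ ⊤ := ENNReal.add_ne_top.2 ⟨hκ₁, hκ₂⟩
    exact (ENNReal.mul_ne_top (ENNReal.mul_ne_top (measure_ne_top _ _) (ENNReal.pow_ne_top hκ))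
      (ENNReal.add_ne_top.2 ⟨hκ, hκ⟩)).lt_top

lemma aestronglyMeasurable_cyclicProduct {X : Type*} [MeasurableSpace X]
    {μ : Measure X} {K : X → X → ℝ} (hK : Measurable fun z : X × X => K z.1 z.2) (m : ℕ) :
    AEStronglyMeasurable (cyclicProduct K m) (Measure.pi fun _ : Fin m => μ) :=
  (Finset.measurable_prod _ fun i _ =>
    hK.comp ((measurable_pi_apply i).prodMk (measurable_pi_apply _))).aestronglyMeasurable

lemma integrable_cyclicProduct_rieszKernel (d : ℕ) {αT αS : ℝ} (hT : 0 < αT) (hT1 : αT < 1 / 2)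
    (hS : 0 < αS) (hSd : αS < (d : ℝ) / 2) (n : ℕ) :
    Integrable (cyclicProduct (rieszKernel d αT αS) (n + 2))
      (Measure.pi fun _ : Fin (n + 2) => unitDomain d) := by
  refine ⟨aestronglyMeasurable_cyclicProduct (measurable_rieszKernel d αT αS) _, ?_⟩
  refine (lintegral_mono fun p => ?_).trans_lt
    (lintegral_cyclic_rieszKernelENN_lt_top d hT hT1 hS hSd n)
  rw [cyclicProduct, enorm_eq_nnnorm, nnnorm_prod, ENNReal.ofNNReal_finsetProd]
  exact Finset.prod_le_prod' fun i _ => enorm_rieszKernel_le d hT hS _ _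

/-- A finite product of nonzero factors has finite factors. -/
lemma ae_rieszKernelENN_ne_top (d : ℕ) {βT βS : ℝ} (hT : 0 < βT) (hT1 : βT < 1 / 2)
    (hS : 0 < βS) (hSd : βS < (d : ℝ) / 2) (n : ℕ) :
    ∀ᵐ p : Fin (n + 2) → Sph d × ℝ ∂(Measure.pi fun _ => unitDomain d), ∀ i,
      rieszKernelENN d βT βS (p i) (p (finRotate (n + 2) i)) ≠ ⊤ ∧ (p i).2 ∈ Icc (-1 : ℝ) 1 := by
  have h1 := ae_lt_top (measurable_cyclic (measurable_rieszKernelENN d βT βS) (n + 2))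
    (lintegral_cyclic_rieszKernelENN_lt_top d hT hT1 hS hSd n).ne
  have h2 : ∀ᵐ q : Sph d × ℝ ∂(unitDomain d), q.2 ∈ Icc (-1 : ℝ) 1 := by
    have h3 : ∀ᵐ s ∂((volume : Measure ℝ).restrict (Icc (-1) 1)), s ∈ Icc (-1 : ℝ) 1 :=
      ae_restrict_mem measurableSet_Icc
    exact Measure.quasiMeasurePreserving_snd.ae h3
  have h4 : ∀ᵐ p : Fin (n + 2) → Sph d × ℝ ∂(Measure.pi fun _ => unitDomain d), ∀ i,
      (p i).2 ∈ Icc (-1 : ℝ) 1 :=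
    ae_all_iff.2 fun i => (Measure.tendsto_eval_ae_ae (μ := fun _ => unitDomain d) (i := i)).eventually h2
  filter_upwards [h1, h4] with p hp hp4 i
  refine ⟨fun htop => hp.ne ?_, hp4 i⟩
  rw [← Finset.mul_prod_erase _ _ (Finset.mem_univ i), htop]
  exact ENNReal.top_mul (Finset.prod_ne_zero_iff.2 fun j _ => rieszKernelENN_ne_zero d hT hS _ _)

/-- Convergence of cyclic integrals under domination by a Riesz kernel. -/
theorem tendsto_integral_cyclicProduct (d : ℕ) {αT αS βT βS : ℝ} (hT : 0 < βT) (hT1 : βT < 1 / 2)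
    (hS : 0 < βS) (hSd : βS < (d : ℝ) / 2) {F : ℝ → Sph d × ℝ → Sph d × ℝ → ℝ}
    (hF : ∀ᶠ T in atTop, Measurable fun z : (Sph d × ℝ) × (Sph d × ℝ) => F T z.1 z.2) {A : ℝ}
    (hbound : ∀ᶠ T in atTop, ∀ p q : Sph d × ℝ, p.2 ∈ Icc (-1 : ℝ) 1 → q.2 ∈ Icc (-1 : ℝ) 1 →
      p.2 ≠ q.2 → p.1 ≠ q.1 →
      |F T p q| ≤ A * (|p.2 - q.2| ^ (-βT) * ‖(p.1 : E d) - (q.1 : E d)‖ ^ (-βS)))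
    (hlim : ∀ p q : Sph d × ℝ, p.2 ∈ Icc (-1 : ℝ) 1 → q.2 ∈ Icc (-1 : ℝ) 1 →
      p.2 ≠ q.2 → p.1 ≠ q.1 →
      Tendsto (fun T => F T p q) atTop (𝓝 (rieszKernel d αT αS p q))) (n : ℕ) :
    Tendsto (fun T => ∫ p, cyclicProduct (F T) (n + 2) p
        ∂(Measure.pi fun _ : Fin (n + 2) => unitDomain d)) atTop
      (𝓝 (cycleCoeff d αT αS (n + 2))) := by
  have hae := ae_rieszKernelENN_ne_top d hT hT1 hS hSd n
  have hfin := lintegral_cyclic_rieszKernelENN_lt_top d hT hT1 hS hSd n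
  refine tendsto_integral_filter_of_dominated_convergence
    (fun p => A ^ (n + 2) * (∏ i : Fin (n + 2),
      rieszKernelENN d βT βS (p i) (p (finRotate (n + 2) i))).toReal) ?_ ?_ ?_ ?_
  · filter_upwards [hF] with T hT
    exact aestronglyMeasurable_cyclicProduct hT _
  · filter_upwards [hbound] with T hT
    filter_upwards [hae] with p hp
    rw [cyclicProduct, norm_prod, ENNReal.toReal_prod]
    calc ∏ i, ‖F T (p i) (p (finRotate (n + 2) i))‖
        ≤ ∏ i, (A * (rieszKernelENN d βT βS (p i) (p (finRotate (n + 2) i))).toReal) := by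
          refine Finset.prod_le_prod (fun _ _ => norm_nonneg _) fun i _ => ?_
          obtain ⟨h2, h1⟩ := ne_of_rieszKernelENN_ne_top (by assumption) hS (hp i).1
          rw [rieszKernelENN_eq_ofReal d βT βS h2 h1, ENNReal.toReal_ofReal (by positivity)]
          exact hT _ _ (hp i).2 (hp _).2 h2 h1
      _ = _ := by rw [Finset.prod_mul_distrib]; simp
  · refine Integrable.const_mul ?_ _
    exact integrable_toReal_of_lintegral_ne_top
      (measurable_cyclic (measurable_rieszKernelENN d βT βS) (n + 2)).aemeasurable hfin.ne
  · filter_upwards [hae] with p hp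
    refine tendsto_finsetProd _ fun i _ => ?_
    obtain ⟨h2, h1⟩ := ne_of_rieszKernelENN_ne_top hT hS (hp i).1
    exact hlim _ _ (hp i).2 (hp _).2 h2 h1

/-! ### Potter bounds -/

section RegularVariation

/-- A continuous additively slowly varying function grows at most linearly with any slope,
uniformly. -/
lemma exists_abs_sub_le_of_tendsto_add_sub {F : ℝ → ℝ} (hF : Continuous F)
    (h : ∀ u, Tendsto (fun x => F (x + u) - F x) atTop (𝓝 0)) {ε : ℝ} (hε : 0 < ε) :
    ∃ X : ℝ, ∀ x y, X ≤ x → x ≤ y → |F y - F x| ≤ 2 + ε * (y - x) := by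
  -- by Baire, the convergence is uniform on some interval
  obtain ⟨N, p, hp⟩ := nonempty_interior_of_iUnion_of_closed
    (f := fun N : ℕ => {u : ℝ | ∀ x : ℝ, (N : ℝ) ≤ x → |F (x + u) - F x| ≤ 1}) (by
      intro N
      simp only [ofPred_forall]
      refine isClosed_iInter fun x => isClosed_iInter fun _ => ?_
      exact isClosed_le (by fun_prop) continuous_const) (by
      rw [eq_univ_iff_forall]
      intro u
      have h1 : ∀ᶠ x in atTop, |F (x + u) - F x| < 1 := by
        have := (h u).eventually (Metric.ball_mem_nhds 0 one_pos)
        simpa [Real.dist_eq] using this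
      obtain ⟨x₀, hx₀⟩ := eventually_atTop.1 h1
      rw [mem_iUnion]
      exact ⟨⌈x₀⌉₊, fun x hx => (hx₀ x ((Nat.le_ceil x₀).trans hx)).le⟩)
  obtain ⟨r, hr, hball⟩ := Metric.isOpen_iff.1 isOpen_interior p hp
  have hball' : ∀ u, |u| < r → ∀ x : ℝ, (N : ℝ) ≤ x → |F (x + (p + u)) - F x| ≤ 1 := by
    intro u hu
    have h1 : p + u ∈ Metric.ball p r := by simpa [Real.dist_eq] using hu
    exact interior_subset (hball h1)
  set δ := r / 2 with hδ
  have hδ0 : 0 < δ := half_pos hr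
  -- Compare `x + u` and `x` with the common base point `x - p`: both shifts lie in the interval of
  -- uniformity, so each costs at most 1.
  have hsmall : ∀ x, (N : ℝ) + p ≤ x → ∀ u, 0 ≤ u → u ≤ δ → |F (x + u) - F x| ≤ 2 := by
    intro x hx u hu0 hu
    have h1 := hball' u (by rw [abs_of_nonneg hu0]; linarith) (x - p) (by linarith)
    have h2 := hball' 0 (by simpa using hr) (x - p) (by linarith)
    rw [show x - p + (p + u) = x + u by ring] at h1
    rw [show x - p + (p + 0) = x by ring] at h2
    rw [abs_le] at *
    constructor <;> linarith [h1.1, h1.2, h2.1, h2.2]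
  have h3 : ∀ᶠ x in atTop, |F (x + δ) - F x| < ε * δ := by
    have := (h δ).eventually (Metric.ball_mem_nhds 0 (mul_pos hε hδ0))
    simpa [Real.dist_eq] using this
  obtain ⟨X₂, hX₂⟩ := eventually_atTop.1 h3
  -- Long increments are covered by steps of length `δ`, each costing `ε δ`; the leftover step costs
  -- at most 2.
  have hsteps : ∀ n : ℕ, ∀ x, X₂ ≤ x → |F (x + n * δ) - F x| ≤ n * (ε * δ) := by
    intro n
    induction n with
    | zero => intro x _; simp
    | succ n ih =>
      intro x hx
      have h4 := ih x hx
      have h5 := (hX₂ (x + n * δ) (by have : 0 ≤ (n : ℝ) * δ := by positivity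
                                      linarith)).le
      rw [show x + n * δ + δ = x + ((n + 1 : ℕ) : ℝ) * δ by push_cast; ring] at h5
      rw [show ((n + 1 : ℕ) : ℝ) * (ε * δ) = n * (ε * δ) + ε * δ by push_cast; ring]
      rw [abs_le] at *
      constructor <;> linarith [h4.1, h4.2, h5.1, h5.2]
  refine ⟨max (N + p) X₂, fun x y hx hxy => ?_⟩
  have hx1 : (N : ℝ) + p ≤ x := (le_max_left _ _).trans hx
  have hx2 : X₂ ≤ x := (le_max_right _ _).trans hx
  set n := ⌊(y - x) / δ⌋₊ with hn
  have hq : 0 ≤ (y - x) / δ := div_nonneg (by linarith) hδ0.le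
  have hn1 : (n : ℝ) * δ ≤ y - x := by
    have := Nat.floor_le hq
    rwa [← hn, le_div_iff₀ hδ0] at this
  have hn2 : y - x < n * δ + δ := by
    have := Nat.lt_floor_add_one ((y - x) / δ)
    rw [← hn, div_lt_iff₀ hδ0] at this
    linarith
  have hnδ : 0 ≤ (n : ℝ) * δ := by positivity
  have h6 := hsteps n x hx2
  have h7 := hsmall (x + n * δ) (by linarith) (y - x - n * δ) (by linarith) (by linarith)
  rw [show x + n * δ + (y - x - n * δ) = y by ring] at h7
  have h8 : (n : ℝ) * (ε * δ) ≤ ε * (y - x) := by nlinarith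
  rw [abs_le] at *
  constructor <;> linarith [h6.1, h6.2, h7.1, h7.2]

/-- Potter-type bound for bounded continuous regularly varying functions. -/
theorem exists_potter_bound {g : ℝ → ℝ} {α β : ℝ} (hg : ContinuousOn g (Ioi 0))
    (hg1 : ∀ t, 0 < t → |g t| ≤ 1) (hα : 0 ≤ α) (hαβ : α < β)
    (hne : ∀ᶠ T in atTop, g T ≠ 0)
    (hlim : ∀ τ, 0 < τ → Tendsto (fun T => g (T * τ) / g T) atTop (𝓝 (τ ^ (-α)))) :
    ∃ A T₁ : ℝ, 0 ≤ A ∧ ∀ T, T₁ ≤ T → ∀ τ, 0 < τ → τ ≤ 2 →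
      |g (T * τ)| ≤ A * τ ^ (-β) * |g T| := by
  obtain ⟨X₀', hX₀'⟩ := eventually_atTop.1 hne
  set X₀ := max X₀' 1 with hX₀
  have hX0pos : 0 < X₀ := zero_lt_one.trans_le (le_max_right _ _)
  have hne' : ∀ T, X₀ ≤ T → g T ≠ 0 := fun T hT => hX₀' T ((le_max_left _ _).trans hT)
  -- In logarithmic coordinates, with the power `α` removed, regular variation becomes additive slow
  -- variation. The `max` truncates to the range where `g` does not vanish, so that `F` is
  -- continuous on the whole line.
  set F : ℝ → ℝ := fun x => Real.log |g (Real.exp (max x (Real.log X₀)))| +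
    α * max x (Real.log X₀) with hF
  have hexp : ∀ x, X₀ ≤ Real.exp (max x (Real.log X₀)) := by
    intro x
    calc X₀ = Real.exp (Real.log X₀) := (Real.exp_log hX0pos).symm
      _ ≤ _ := Real.exp_le_exp.2 (le_max_right _ _)
  have hFc : Continuous F := by
    refine Continuous.add (Continuous.log (Continuous.abs ?_) fun x => ?_) (by fun_prop)
    · exact hg.comp_continuous (by fun_prop) fun x => Real.exp_pos _
    · exact abs_ne_zero.2 (hne' _ (hexp x))
  have hFlog : ∀ T, X₀ ≤ T → F (Real.log T) = Real.log |g T| + α * Real.log T := by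
    intro T hT
    have : Real.log X₀ ≤ Real.log T := Real.log_le_log hX0pos hT
    simp only [hF, max_eq_left this]
    rw [Real.exp_log (hX0pos.trans_le hT)]
  have hFslow : ∀ u, Tendsto (fun x => F (x + u) - F x) atTop (𝓝 0) := by
    intro u
    have h1 := (hlim (Real.exp u) (Real.exp_pos u)).comp Real.tendsto_exp_atTop
    have h2 := (h1.abs.log (abs_ne_zero.2 (Real.rpow_pos_of_pos (Real.exp_pos u) _).ne')).add_const
      (α * u)
    rw [abs_of_pos (Real.rpow_pos_of_pos (Real.exp_pos u) _), Real.log_rpow (Real.exp_pos u),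
      Real.log_exp, neg_mul, neg_add_cancel] at h2
    refine h2.congr' ?_
    filter_upwards [eventually_ge_atTop (max (Real.log X₀) (Real.log X₀ - u))] with x hx
    have hx1 : Real.log X₀ ≤ x := (le_max_left _ _).trans hx
    have hx2 : Real.log X₀ ≤ x + u := by linarith [(le_max_right _ _).trans hx]
    have hgx := hne' (Real.exp x) (by rw [← Real.exp_log hX0pos]; exact Real.exp_le_exp.2 hx1)
    have hgxu := hne' (Real.exp (x + u))
      (by rw [← Real.exp_log hX0pos]; exact Real.exp_le_exp.2 hx2)
    simp only [hF, Function.comp_apply, max_eq_left hx1, max_eq_left hx2]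
    rw [← Real.exp_add, abs_div, Real.log_div (abs_ne_zero.2 hgxu) (abs_ne_zero.2 hgx)]
    ring
  obtain ⟨X, hX⟩ := exists_abs_sub_le_of_tendsto_add_sub hFc hFslow (sub_pos.2 hαβ)
  set X₁ := Real.exp (max X (Real.log X₀)) with hX₁
  have hX1pos : 0 < X₁ := Real.exp_pos _
  have hX01 : X₀ ≤ X₁ := hexp X
  have hgX1 : 0 < |g X₁| := abs_pos.2 (hne' _ hX01)
  have key : ∀ s t, X₁ ≤ s → s ≤ t → |(Real.log |g t| + α * Real.log t) -
      (Real.log |g s| + α * Real.log s)| ≤ 2 + (β - α) * (Real.log t - Real.log s) := by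
    intro s t hs hst
    rw [← hFlog s (hX01.trans hs), ← hFlog t (hX01.trans (hs.trans hst))]
    refine hX _ _ ?_ (Real.log_le_log (hX1pos.trans_le hs) hst)
    calc X ≤ Real.log X₁ := by rw [hX₁, Real.log_exp]; exact le_max_left _ _
      _ ≤ _ := Real.log_le_log hX1pos hs
  -- The summand `2 (β - α) log 2` pays for `1 ≤ τ ≤ 2`, where the Potter exponent has the opposite
  -- sign.
  set A₁ := Real.exp (2 + 2 * (β - α) * Real.log 2) with hA₁
  set A₂ := Real.exp 2 / |g X₁| with hA₂
  have hA10 : 0 ≤ A₁ := (Real.exp_pos _).le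
  have hA20 : 0 ≤ A₂ := by positivity
  refine ⟨A₁ + A₂, X₁, add_nonneg hA10 hA20, fun T hT τ hτ hτ2 => ?_⟩
  have hT0 : 0 < T := hX1pos.trans_le hT
  have hgT : 0 < |g T| := abs_pos.2 (hne' _ (hX01.trans hT))
  have hτβ : 0 < τ ^ (-β) := Real.rpow_pos_of_pos hτ _
  have hmono : ∀ A', 0 ≤ A' → A' ≤ A₁ + A₂ → A' * τ ^ (-β) * |g T| ≤ (A₁ + A₂) * τ ^ (-β) * |g T| := by
    intro A' _ h
    gcongr
  have hlog2 : 0 < Real.log 2 := Real.log_pos one_lt_two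
  rcases le_or_gt X₁ (T * τ) with hs | hs
  · have hgs : 0 < |g (T * τ)| := abs_pos.2 (hne' _ (hX01.trans hs))
    refine le_trans ?_ (hmono A₁ hA10 (by linarith))
    rw [← Real.log_le_log_iff hgs (by positivity), Real.log_mul (by positivity) hgT.ne',
      Real.log_mul (by positivity) hτβ.ne', Real.log_rpow hτ, hA₁, Real.log_exp]
    have hlogmul : Real.log (T * τ) = Real.log T + Real.log τ := Real.log_mul hT0.ne' hτ.ne'
    have hτlog : Real.log τ ≤ Real.log 2 := Real.log_le_log hτ hτ2
    rcases le_total τ 1 with h1 | h1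
    · have hk := key (T * τ) T hs (by nlinarith)
      rw [abs_le, hlogmul] at hk
      nlinarith [hk.1, mul_pos (sub_pos.2 hαβ) hlog2]
    · have hk := key T (T * τ) hT (by nlinarith)
      rw [abs_le, hlogmul] at hk
      nlinarith [hk.2, mul_nonneg (sub_pos.2 hαβ).le (sub_nonneg.2 hτlog)]
  -- Below `X₁` only `|g| ≤ 1` is known. Here `τ < X₁ / T`, so `τ ^ (-β)` compensates the lower
  -- bound `|g T| ≥ exp (-2) |g X₁| (T / X₁) ^ (-β)`.
  · refine le_trans ?_ (hmono A₂ hA20 (by linarith))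
    refine (hg1 _ (by positivity)).trans ?_
    rw [← Real.log_nonneg_iff (by positivity), Real.log_mul (by positivity) hgT.ne',
      Real.log_mul (by positivity) hτβ.ne', Real.log_rpow hτ, hA₂, Real.log_div
        (Real.exp_pos _).ne' hgX1.ne', Real.log_exp]
    have hk := key X₁ T le_rfl hT
    have hlt : Real.log T + Real.log τ ≤ Real.log X₁ := by
      rw [← Real.log_mul hT0.ne' hτ.ne']
      exact Real.log_le_log (by positivity) hs.le
    rw [abs_le] at hk
    have hβ : 0 ≤ β := hα.trans hαβ.le
    nlinarith [hk.1, mul_le_mul_of_nonneg_left hlt hβ]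

end RegularVariation

/-! ### Commuting difference kernels -/

section Commutation

lemma memLp_restrict_of_continuous {T : ℝ} {f : ℝ → ℝ} (hf : Continuous f) :
    MemLp f 2 ((volume : Measure ℝ).restrict (Icc (-T) T)) := by
  obtain ⟨M, hM⟩ := isCompact_Icc.exists_bound_of_continuousOn (hf.continuousOn (s := Icc (-T) T))
  exact MemLp.of_bound hf.aestronglyMeasurable M
    ((ae_restrict_iff' measurableSet_Icc).2 (ae_of_all _ fun x hx => hM x hx))

/-- Two difference kernels with the same complete orthonormal family of eigenfunctions on `[-T, T]`
commute. -/
lemma integral_mul_comm_of_eigenfunctions {T : ℝ} {φ : ℕ → ℝ → ℝ} (hφ : IsTimeBasis T φ)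
    {c c' : ℝ → ℝ} (hc : Continuous c) (hc' : Continuous c') (hce : ∀ x, c (-x) = c x)
    (hce' : ∀ x, c' (-x) = c' x) {lam lam' : ℕ → ℝ}
    (h : ∀ l, ∀ t ∈ Icc (-T) T, ∫ s in Icc (-T) T, c (t - s) * φ l s = lam l * φ l t)
    (h' : ∀ l, ∀ t ∈ Icc (-T) T, ∫ s in Icc (-T) T, c' (t - s) * φ l s = lam' l * φ l t)
    {t s : ℝ} (ht : t ∈ Icc (-T) T) (hs : s ∈ Icc (-T) T) :
    ∫ u in Icc (-T) T, c (t - u) * c' (u - s) = ∫ u in Icc (-T) T, c' (t - u) * c (u - s) := by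
  obtain ⟨b, hb⟩ := hφ
  have key : ∀ c c' : ℝ → ℝ, Continuous c → Continuous c' → (∀ x, c' (-x) = c' x) →
      ∀ lam lam' : ℕ → ℝ,
      (∀ l, ∀ t ∈ Icc (-T) T, ∫ s in Icc (-T) T, c (t - s) * φ l s = lam l * φ l t) →
      (∀ l, ∀ t ∈ Icc (-T) T, ∫ s in Icc (-T) T, c' (t - s) * φ l s = lam' l * φ l t) →
      ∫ u in Icc (-T) T, c (t - u) * c' (u - s) =
        ∑' l, lam l * φ l t * (lam' l * φ l s) := by
    intro c c' hc hc' hce' lam lam' h h'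
    have hf : MemLp (fun u => c (t - u)) 2 ((volume : Measure ℝ).restrict (Icc (-T) T)) :=
      memLp_restrict_of_continuous (by fun_prop)
    have hg : MemLp (fun u => c' (s - u)) 2 ((volume : Measure ℝ).restrict (Icc (-T) T)) :=
      memLp_restrict_of_continuous (by fun_prop)
    -- Parseval expresses the composed kernel through the two eigenvalue sequences, symmetrically.
    have hP := b.tsum_inner_mul_inner (hf.toLp _) (hg.toLp _)
    have h1 : inner ℝ (hf.toLp _) (hg.toLp _) = ∫ u in Icc (-T) T, c (t - u) * c' (u - s) := by
      rw [L2.inner_def]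
      refine integral_congr_ae ?_
      filter_upwards [hf.coeFn_toLp, hg.coeFn_toLp] with u h1 h2
      rw [h1, h2, ← hce' (u - s), neg_sub]
      simp [mul_comm]
    have h2 : ∀ l, inner ℝ (hf.toLp _) (b l) = lam l * φ l t := by
      intro l
      rw [← h l t ht, L2.inner_def]
      refine integral_congr_ae ?_
      filter_upwards [hf.coeFn_toLp, hb l] with u h1 h2
      rw [h1, h2]
      simp [mul_comm]
    have h3 : ∀ l, inner ℝ (b l) (hg.toLp _) = lam' l * φ l s := by
      intro l
      rw [← h' l s hs, L2.inner_def]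
      refine integral_congr_ae ?_
      filter_upwards [hg.coeFn_toLp, hb l] with u h1 h2
      rw [h1, h2]
      simp
    rw [← h1, ← hP]
    simp_rw [h2, h3]
  rw [key c c' hc hc' hce' lam lam' h h', key c' c hc' hc hce lam' lam h' h]
  refine tsum_congr fun l => by ring

/-- Even continuous difference kernels which commute on all large symmetric intervals are
proportional. -/
lemma mul_comm_of_integral_mul_comm {a b : ℝ → ℝ} (ha : Continuous a) (hb : Continuous b)
    (hae : ∀ x, a (-x) = a x) (hbe : ∀ x, b (-x) = b x) {T₀ : ℝ}
    (h : ∀ T, T₀ ≤ T → ∀ t ∈ Icc (-T) T, ∀ s ∈ Icc (-T) T,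
      ∫ u in Icc (-T) T, a (t - u) * b (u - s) = ∫ u in Icc (-T) T, b (t - u) * a (u - s))
    {x y : ℝ} (hx : 0 ≤ x) (hy : 0 ≤ y) : a x * b y = b x * a y := by
  set β := max (2 * T₀) (max x y) with hβ
  have hβT : 2 * T₀ ≤ β := le_max_left _ _
  have hβx : x ≤ β := (le_max_left _ _).trans (le_max_right _ _)
  have hβy : y ≤ β := (le_max_right _ _).trans (le_max_right _ _)
  -- After moving `[-T, T]` to `[0, 2T]` and choosing `t, s` relative to the endpoint, the integrand
  -- no longer depends on `T`. Its integral over `[0, β']` vanishes for all `β' ≥ β`, so its value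
  -- at the endpoint `β` vanishes too; that value is the desired identity.
  set f : ℝ → ℝ := fun u => a (β - x - u) * b (u - (β - y)) - b (β - x - u) * a (u - (β - y)) with hf
  have hfc : Continuous f := by fun_prop
  have hzero : ∀ β', β ≤ β' → ∫ u in (0 : ℝ)..β', f u = 0 := by
    intro β' hβ'
    have hT : T₀ ≤ β' / 2 := by linarith
    have hβ0 : 0 ≤ β' / 2 := by linarith
    have h1 := h (β' / 2) hT (β - x - β' / 2) ⟨by linarith, by linarith⟩ (β - y - β' / 2)
      ⟨by linarith, by linarith⟩
    rw [integral_Icc_eq_integral_Ioc, integral_Icc_eq_integral_Ioc,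
      ← intervalIntegral.integral_of_le (by linarith),
      ← intervalIntegral.integral_of_le (by linarith)] at h1
    have h2 : ∫ u in (0 : ℝ)..β', f u = ∫ u in (-(β' / 2))..(β' / 2), f (u + β' / 2) := by
      rw [intervalIntegral.integral_comp_add_right]
      congr 1 <;> ring
    rw [h2]
    have h3 : ∀ u, f (u + β' / 2) = a (β - x - β' / 2 - u) * b (u - (β - y - β' / 2)) -
        b (β - x - β' / 2 - u) * a (u - (β - y - β' / 2)) := by
      intro u
      simp only [hf]
      congr 2 <;> congr 1 <;> ring
    simp_rw [h3]
    rw [intervalIntegral.integral_sub (Continuous.intervalIntegrable (by fun_prop) _ _)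
      (Continuous.intervalIntegrable (by fun_prop) _ _), h1, sub_self]
  have hd : HasDerivWithinAt (fun β' => ∫ u in (0 : ℝ)..β', f u) (f β) (Ici β) β :=
    (intervalIntegral.integral_hasDerivAt_right (hfc.intervalIntegrable _ _)
      (hfc.stronglyMeasurableAtFilter _ _) hfc.continuousAt).hasDerivWithinAt
  have hd0 : HasDerivWithinAt (fun β' => ∫ u in (0 : ℝ)..β', f u) 0 (Ici β) β :=
    (hasDerivWithinAt_const β (Ici β) (0 : ℝ)).congr (fun β' hβ' => hzero β' hβ') (hzero β le_rfl)
  have hfβ : f β = 0 := (uniqueDiffWithinAt_Ici β).eq_deriv _ hd hd0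
  simp only [hf, sub_sub_cancel] at hfβ
  rw [show β - x - β = -x by ring, hae, hbe] at hfβ
  linarith

end Commutation

/-! ### Factorization of the covariance -/

section Separability

/-- The kernel of the field between two fixed directions has the time basis as eigenfunctions. -/
lemma exists_eigenvalue_of_hasSum {T : ℝ} {φ : ℕ → ℝ → ℝ} (hφ : IsTimeBasis T φ)
    {J : ℕ → Type*} [∀ n, Fintype (J n)] {D : ℕ × ℕ → ℝ} (hD : ∀ q, 0 ≤ D q)
    {y z : (n : ℕ) → J n → ℝ} {k : ℝ → ℝ → ℝ} {κ κ' : ℝ}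
    (hk : ∀ t ∈ Icc (-T) T, ∀ s ∈ Icc (-T) T, HasSum (fun q : ℕ × ℕ =>
      D q * ∑ j, y q.1 j * z q.1 j * (φ q.2 t * φ q.2 s)) (k t s))
    (hy : ∀ t ∈ Icc (-T) T, HasSum (fun q : ℕ × ℕ =>
      D q * ∑ j, y q.1 j * y q.1 j * (φ q.2 t * φ q.2 t)) κ)
    (hz : ∀ t ∈ Icc (-T) T, HasSum (fun q : ℕ × ℕ =>
      D q * ∑ j, z q.1 j * z q.1 j * (φ q.2 t * φ q.2 t)) κ') :
    ∃ lam : ℕ → ℝ, ∀ l, ∀ t ∈ Icc (-T) T,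
      ∫ s in Icc (-T) T, k t s * φ l s = lam l * φ l t := by
  classical
  unfold IsTimeBasis at hφ
  set ν := (volume : Measure ℝ).restrict (Icc (-T) T) with hν
  obtain ⟨b, hb⟩ := hφ
  have hmem : ∀ l, MemLp (φ l) 2 ν := fun l => (memLp_congr_ae (hb l)).1 (Lp.memLp (b l))
  have horth : ∀ i l, ∫ s, φ i s * φ l s ∂ν = if i = l then 1 else 0 := by
    intro i l
    have h1 := orthonormal_iff_ite.1 b.orthonormal i l
    rw [← h1, L2.inner_def]
    refine integral_congr_ae ?_
    filter_upwards [hb i, hb l] with s h2 h3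
    rw [h2, h3]
    simp [mul_comm]
  refine ⟨fun l => ∑' q : ℕ × ℕ, if q.2 = l then D q * ∑ j, y q.1 j * z q.1 j else 0,
    fun l t ht => ?_⟩
  set F : ℕ × ℕ → ℝ → ℝ := fun q s => (D q * ∑ j, y q.1 j * z q.1 j * (φ q.2 t * φ q.2 s)) * φ l s
    with hF
  -- The mixed series is dominated by the two diagonal ones through `|ab| ≤ a² + b²` and
  -- nonnegativity of the coefficients. Their sums are constant in time, which permits termwise
  -- integration.
  set bd : ℕ × ℕ → ℝ → ℝ := fun q s => (D q * ∑ j, y q.1 j * y q.1 j * (φ q.2 t * φ q.2 t) +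
    D q * ∑ j, z q.1 j * z q.1 j * (φ q.2 s * φ q.2 s)) * |φ l s| with hbd
  have hbdsum : ∀ s ∈ Icc (-T) T, HasSum (fun q => bd q s) ((κ + κ') * |φ l s|) := fun s hs =>
    ((hy t ht).add (hz s hs)).mul_right _
  have hle : ∀ q s, ‖F q s‖ ≤ bd q s := by
    intro q s
    simp only [hF, hbd]
    rw [norm_mul, Real.norm_eq_abs, Real.norm_eq_abs]
    refine mul_le_mul_of_nonneg_right ?_ (abs_nonneg _)
    rw [abs_mul, abs_of_nonneg (hD q), ← mul_add, ← Finset.sum_add_distrib]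
    refine mul_le_mul_of_nonneg_left ((Finset.abs_sum_le_sum_abs _ _).trans
      (Finset.sum_le_sum fun j _ => ?_)) (hD q)
    rw [abs_le]
    constructor <;>
      nlinarith [sq_nonneg (y q.1 j * φ q.2 t + z q.1 j * φ q.2 s),
        sq_nonneg (y q.1 j * φ q.2 t - z q.1 j * φ q.2 s),
        sq_nonneg (y q.1 j * φ q.2 t), sq_nonneg (z q.1 j * φ q.2 s)]
  have hFint : ∀ q s, F q s =
      (D q * ∑ j, y q.1 j * z q.1 j) * φ q.2 t * (φ q.2 s * φ l s) := by
    intro q s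
    simp only [hF]
    rw [← Finset.sum_mul]
    ring
  have hsum := hasSum_integral_of_dominated_convergence (μ := ν) (F := F)
    (f := fun s => k t s * φ l s) bd ?_ ?_ ?_ ?_ ?_
  · have hval : ∀ q, ∫ s, F q s ∂ν =
        (if q.2 = l then D q * ∑ j, y q.1 j * z q.1 j else 0) * φ l t := by
      intro q
      simp_rw [hFint]
      rw [integral_const_mul, horth]
      split_ifs with h
      · rw [h, mul_one]
      · simp
    simp_rw [hval] at hsum
    rw [← tsum_mul_right]
    exact hsum.tsum_eq.symm
  · intro q
    rw [show F q = _ from funext (hFint q)]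
    exact (((hmem q.2).1.mul (hmem l).1).const_mul _)
  · exact fun q => ae_of_all _ (hle q)
  · exact (ae_restrict_iff' measurableSet_Icc).2 (ae_of_all _ fun s hs => (hbdsum s hs).summable)
  · have : Integrable (fun s => (κ + κ') * |φ l s|) ν :=
      ((hmem l).integrable (by norm_num)).abs.const_mul _
    refine this.congr ((ae_restrict_iff' measurableSet_Icc).2 (ae_of_all _ fun s hs => ?_))
    exact (hbdsum s hs).tsum_eq.symm
  · exact (ae_restrict_iff' measurableSet_Icc).2
      (ae_of_all _ fun s hs => (hk t ht s hs).mul_right _)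

variable {Ω : Type*} [MeasurableSpace Ω] {P : Measure Ω} {d : ℕ} {C : ℝ → ℝ → ℝ}
  {Z : E d → ℝ → Ω → ℝ}

lemma IsGaussianSTRF.isUnitGaussianProcess_comp (hZ : IsGaussianSTRF P d C Z) {X : Type*}
    [TopologicalSpace X] [MeasurableSpace X] {f : X → E d} {g : X → ℝ} (hf : Continuous f)
    (hg : Continuous g) (hfm : Measurable f) (hgm : Measurable g) :
    IsUnitGaussianProcess (fun x => Z (f x) (g x))
      (fun x y => C ‖f x - f y‖ |g x - g y|) P where
  measurable := hZ.measurable.comp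
    (((hfm.comp measurable_fst).prodMk (hgm.comp measurable_fst)).prodMk measurable_snd)
  gaussian := hZ.gaussian.comp_right fun x => (f x, g x)
  mean_zero _ := hZ.mean_zero _ _
  covariance _ _ := hZ.covariance _ _ _ _
  variance_one _ := hZ.variance_one _ _
  meanSquare_continuous x := (hZ.meanSquare_continuous (f x, g x)).comp
    ((hf.tendsto x).prodMk_nhds (hg.tendsto x))

lemma IsGaussianSTRF.isUnitGaussianProcess (hZ : IsGaussianSTRF P d C Z) :
    IsUnitGaussianProcess (fun p : E d × ℝ => Z p.1 p.2)
      (fun p q => C ‖p.1 - q.1‖ |p.2 - q.2|) P :=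
  hZ.isUnitGaussianProcess_comp continuous_fst continuous_snd measurable_fst measurable_snd

lemma IsGaussianSTRF.continuous_cov (hZ : IsGaussianSTRF P d C Z) :
    Continuous fun p : ℝ × ℝ => C |p.1| |p.2| := by
  have h := hZ.isUnitGaussianProcess.continuous
  have hm : Continuous fun p : ℝ × ℝ =>
      (((p.1 • EuclideanSpace.single 0 1, p.2), (0, 0)) : (E d × ℝ) × (E d × ℝ)) := by fun_prop
  have h2 := h.comp hm
  have h3 : ((fun p : (E d × ℝ) × (E d × ℝ) => C ‖p.1.1 - p.2.1‖ |p.1.2 - p.2.2|) ∘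
      fun p : ℝ × ℝ => (((p.1 • EuclideanSpace.single 0 1, p.2), (0, 0)) : (E d × ℝ) × (E d × ℝ))) =
      fun p : ℝ × ℝ => C |p.1| |p.2| := by
    ext p
    simp [norm_smul]
  rwa [h3] at h2

lemma IsGaussianSTRF.abs_cov_le_one (hZ : IsGaussianSTRF P d C Z) {r t : ℝ} (hr : 0 ≤ r)
    (ht : 0 ≤ t) : |C r t| ≤ 1 := by
  have h := hZ.isUnitGaussianProcess.abs_le_one (r • EuclideanSpace.single 0 1, t) (0, 0)
  simpa [norm_smul, abs_of_nonneg hr, abs_of_nonneg ht] using h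

lemma IsGaussianSTRF.cov_zero (hZ : IsGaussianSTRF P d C Z) : C 0 0 = 1 := by
  have h := hZ.isUnitGaussianProcess.apply_self (0, 0)
  simpa using h

/-- The points `c e₀ ± s e₁` with `s = r / (2R)` and `c² + s² = 1`; a second coordinate exists
because `d ≥ 1`. -/
lemma exists_sphere_dist_eq (hd : 1 ≤ d) {R r : ℝ} (hR : 0 < R) (hr : 0 ≤ r) (hrR : r ≤ 2 * R) :
    ∃ u v : Sph d, ‖R • (u : E d) - R • (v : E d)‖ = r := by
  obtain ⟨n, rfl⟩ : ∃ n, d = n + 1 := ⟨d - 1, by omega⟩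
  set s := r / (2 * R) with hs
  have hs0 : 0 ≤ s := by positivity
  have hs1 : s ≤ 1 := (div_le_one (by positivity)).2 hrR
  have hc : 0 ≤ 1 - s ^ 2 := by nlinarith
  set c := Real.sqrt (1 - s ^ 2) with hcdef
  have hc2 : c ^ 2 = 1 - s ^ 2 := Real.sq_sqrt hc
  have hnorm : ∀ w : ℝ, w ^ 2 = s ^ 2 →
      ‖(c • EuclideanSpace.single 0 1 + w • EuclideanSpace.single 1 1 : E (n + 1))‖ = 1 := by
    intro w hw
    rw [EuclideanSpace.norm_eq, Real.sqrt_eq_one, Fin.sum_univ_succ, Fin.sum_univ_succ]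
    have h2 : ∀ i : Fin n, i.succ.succ ≠ 1 := fun i h => by
      simpa using congrArg Fin.val h
    simp [Fin.succ_ne_zero, hw, hc2, h2]
  refine ⟨⟨_, mem_sphere_zero_iff_norm.2 (hnorm s rfl)⟩,
    ⟨_, mem_sphere_zero_iff_norm.2 (hnorm (-s) (by ring))⟩, ?_⟩
  have : R • (c • EuclideanSpace.single 0 1 + s • EuclideanSpace.single 1 1 : E (n + 1)) -
      R • (c • EuclideanSpace.single 0 1 + (-s) • EuclideanSpace.single 1 1) =
      (2 * R * s) • EuclideanSpace.single 1 1 := by module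
  simp only
  rw [this, norm_smul]
  simp only [PiLp.norm_single, norm_one, mul_one]
  rw [Real.norm_of_nonneg (by positivity), hs]
  field_simp

/-- A diagonal expansion with a time basis common to all spherical frequencies forces the
covariance to factorize. -/
theorem cov_eq_mul_of_hasDiagonalExpansion (hZ : IsGaussianSTRF P d C Z) {γ : ℝ}
    (hA0 : HasDiagonalExpansion d γ C) {r T₀ : ℝ} (hT₀ : 1 ≤ T₀)
    (hr : ∀ T, T₀ ≤ T → ∃ u v : Sph d, ‖(T ^ γ) • (u : E d) - (T ^ γ) • (v : E d)‖ = r)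
    {t : ℝ} (ht : 0 ≤ t) : C r t = C r 0 * C 0 t := by
  have hr0 : 0 ≤ r := by
    obtain ⟨u, v, h⟩ := hr T₀ le_rfl
    rw [← h]; exact norm_nonneg _
  have hcont : ∀ ρ, 0 ≤ ρ → Continuous fun x : ℝ => C ρ |x| := by
    intro ρ hρ
    have := hZ.continuous_cov.comp (by fun_prop : Continuous fun x : ℝ => (ρ, x))
    simpa [Function.comp_def, abs_of_nonneg hρ] using this
  obtain ⟨Y, -, B, hB⟩ := hA0
  -- The kernel at distance `r` is compared with the one at coinciding directions, at times `t` and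
  -- 0, where `C 0 0 = 1`.
  have hcomm := mul_comm_of_integral_mul_comm (a := fun x => C r |x|) (b := fun x => C 0 |x|)
    (hcont r hr0) (hcont 0 le_rfl) (fun x => by rw [abs_neg]) (fun x => by rw [abs_neg])
    (T₀ := T₀) (fun T hT t ht s hs => ?_) ht le_rfl
  · simp only [abs_of_nonneg ht, abs_zero, hZ.cov_zero] at hcomm
    linarith
  · obtain ⟨hBpos, b, φ, hb, hφ, hsum⟩ := hB T (hT₀.trans hT)
    obtain ⟨u, v, huv⟩ := hr T hT
    have hterm : ∀ u v : Sph d, ∀ t ∈ Icc (-T) T, ∀ s ∈ Icc (-T) T,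
        HasSum (fun q : ℕ × ℕ => B q.1 (T ^ γ) * b q.1 q.2 *
            ∑ j : Fin (eigenDim d q.1),
              ((T ^ γ) ^ (-(d : ℝ) / 2) * Y q.1 j u) * ((T ^ γ) ^ (-(d : ℝ) / 2) * Y q.1 j v) *
                (φ q.2 t * φ q.2 s))
          (C ‖(T ^ γ) • (u : E d) - (T ^ γ) • (v : E d)‖ |t - s|) := by
      intro u v t ht s hs
      simpa only [mul_assoc] using hsum u v t ht s hs
    have hdiag : ∀ u : Sph d, ∀ t ∈ Icc (-T) T, HasSum (fun q : ℕ × ℕ => B q.1 (T ^ γ) * b q.1 q.2 *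
            ∑ j : Fin (eigenDim d q.1),
              ((T ^ γ) ^ (-(d : ℝ) / 2) * Y q.1 j u) * ((T ^ γ) ^ (-(d : ℝ) / 2) * Y q.1 j u) *
                (φ q.2 t * φ q.2 t)) (C 0 0) := by
      intro u t ht
      simpa only [sub_self, norm_zero, abs_zero] using hterm u u t ht t ht
    obtain ⟨lam, hlam⟩ := exists_eigenvalue_of_hasSum hφ
      (D := fun q => B q.1 (T ^ γ) * b q.1 q.2) (fun q => mul_nonneg (hBpos _) (hb _ _))
      (y := fun n j => (T ^ γ) ^ (-(d : ℝ) / 2) * Y n j u)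
      (z := fun n j => (T ^ γ) ^ (-(d : ℝ) / 2) * Y n j v) (hterm u v) (hdiag u) (hdiag v)
    obtain ⟨lam', hlam'⟩ := exists_eigenvalue_of_hasSum hφ
      (D := fun q => B q.1 (T ^ γ) * b q.1 q.2) (fun q => mul_nonneg (hBpos _) (hb _ _))
      (y := fun n j => (T ^ γ) ^ (-(d : ℝ) / 2) * Y n j u)
      (z := fun n j => (T ^ γ) ^ (-(d : ℝ) / 2) * Y n j u) (hterm u u) (hdiag u) (hdiag u)
    rw [huv] at hlam
    simp only [sub_self, norm_zero] at hlam'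
    exact integral_mul_comm_of_eigenfunctions hφ (hcont r hr0) (hcont 0 le_rfl)
      (fun x => by rw [abs_neg]) (fun x => by rw [abs_neg]) hlam hlam' ht hs

end Separability

/-! ### Lévy's continuity theorem -/

section Levy

/-- Lévy's continuity theorem: pointwise convergence of characteristic functions to a function
continuous at zero implies convergence in distribution. -/
theorem exists_tendstoInDistribution_of_tendsto_charFun {Ω : Type*} [MeasurableSpace Ω]
    {P : Measure Ω} [IsProbabilityMeasure P] {S : ℝ → Ω → ℝ} (hS : ∀ T, AEMeasurable (S T) P)
    {f : ℝ → ℂ} (hf : ContinuousAt f 0)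
    (h : ∀ ξ, Tendsto (fun T => charFun (P.map (S T)) ξ) atTop (𝓝 (f ξ))) :
    ∃ (μ : Measure ℝ) (_ : IsProbabilityMeasure μ),
      TendstoInDistribution S atTop (fun x : ℝ => x) (fun _ => P) μ ∧ ∀ ξ, charFun μ ξ = f ξ := by
  let ν : ℝ → ProbabilityMeasure ℝ := fun T =>
    ⟨P.map (S T), Measure.isProbabilityMeasure_map (hS T)⟩
  have hν : ∀ ξ, Tendsto (fun T => charFun (ν T : Measure ℝ) ξ) atTop (𝓝 (f ξ)) := h
  -- Tightness along the integers suffices to produce a measure with characteristic function `f`;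
  -- convergence along real `T` is then checked on sequences.
  have htight : IsTightMeasureSet {((μ : ProbabilityMeasure ℝ) : Measure ℝ) |
      μ ∈ range fun n : ℕ => ν n} := by
    have := isTightMeasureSet_of_tendsto_charFun (μ := fun n : ℕ => (ν n : Measure ℝ)) hf
      (fun ξ => (hν ξ).comp tendsto_natCast_atTop_atTop)
    convert this using 1
    ext m
    simp
  obtain ⟨μ, -, hμ⟩ := (isCompact_closure_of_isTightMeasureSet htight).exists_mapClusterPt_of_frequently
    (l := atTop) (f := fun n : ℕ => ν n) (Frequently.of_forall fun n => subset_closure ⟨n, rfl⟩)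
  obtain ⟨u, hu, huμ⟩ := mapClusterPt_iff_ultrafilter.1 hμ
  have hchar : ∀ ξ, charFun (μ : Measure ℝ) ξ = f ξ := by
    intro ξ
    refine tendsto_nhds_unique ?_ (((hν ξ).comp tendsto_natCast_atTop_atTop).mono_left hu)
    have h1 := huμ
    rw [ProbabilityMeasure.tendsto_iff_forall_integral_rclike_tendsto ℂ] at h1
    simp_rw [charFun_eq_integral_innerProbChar]
    exact h1 (BoundedContinuousFunction.innerProbChar ξ)
  have hmain : Tendsto ν atTop (𝓝 μ) := by
    refine tendsto_of_seq_tendsto fun T hT => ?_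
    refine ProbabilityMeasure.tendsto_of_tendsto_charFun fun ξ => ?_
    rw [hchar]
    exact (hν ξ).comp hT
  refine ⟨μ, inferInstance, ⟨hS, by fun_prop, ?_⟩, hchar⟩
  have hid : (⟨(μ : Measure ℝ).map fun x => x, Measure.isProbabilityMeasure_map (by fun_prop)⟩ :
      ProbabilityMeasure ℝ) = μ := Subtype.ext Measure.map_id
  rw [hid]
  exact hmain

end Levy

/-! ### Rescaling the functional to the unit domain -/

section Functional

instance (d : ℕ) (R : ℝ) : IsFiniteMeasure (surfaceMeasure d R) := by
  unfold surfaceMeasure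
  exact Measure.smul_finite _ ENNReal.ofReal_ne_top

variable {Ω : Type*} [MeasurableSpace Ω] {P : Measure Ω} {d : ℕ} {C : ℝ → ℝ → ℝ}
  {Z : E d → ℝ → Ω → ℝ} {γ αT αS : ℝ} {L : ℝ → ℝ}

lemma IsGaussianSTRF.measurable_functional (hZ : IsGaussianSTRF P d C Z) (T : ℝ) :
    Measurable (functional d γ αT αS L Z T) := by
  unfold functional
  refine Measurable.const_mul ?_ _
  have h1 : StronglyMeasurable fun q : (Ω × ℝ) × E d => Z q.2 q.1.2 q.1.1 ^ 2 - 1 := by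
    have h0 : Measurable fun q : (Ω × ℝ) × E d => ((q.2, q.1.2), q.1.1) :=
      (measurable_snd.prodMk (measurable_snd.comp measurable_fst)).prodMk
        (measurable_fst.comp measurable_fst)
    exact (((hZ.measurable.comp h0).pow_const 2).sub_const 1).stronglyMeasurable
  have h2 : StronglyMeasurable fun q : Ω × ℝ =>
      ∫ x, (Z x q.2 q.1 ^ 2 - 1) ∂(surfaceMeasure d (T ^ γ)) := h1.integral_prod_right'
  exact h2.integral_prod_right'.measurable

/-- The ratio between the functional and the integral over the unit domain. -/
noncomputable def scaling (γ αT αS : ℝ) (L : ℝ → ℝ) (T : ℝ) : ℝ :=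
  T ^ (γ * αS) * T ^ αT / (L T * L (T ^ γ))

lemma IsSlowlyVarying.scaling_pos (hL : IsSlowlyVarying L) {T : ℝ} (hT : 0 < T) :
    0 < scaling γ αT αS L T := by
  have h1 := hL.pos T hT
  have h2 := hL.pos (T ^ γ) (Real.rpow_pos_of_pos hT _)
  unfold scaling
  positivity

/-- The factor `T * (T ^ γ) ^ d` is the Jacobian of the rescaling of time and sphere. -/
lemma IsSlowlyVarying.div_normalizer (hL : IsSlowlyVarying L) {T : ℝ} (hT : 0 < T) :
    1 / normalizer d γ αT αS L T * (T * (T ^ γ) ^ d) = scaling γ αT αS L T := by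
  have h1 := hL.pos T hT
  have h2 := hL.pos (T ^ γ) (Real.rpow_pos_of_pos hT _)
  have h3 : (T ^ γ) ^ d = T ^ (γ * (d - αS)) * T ^ (γ * αS) := by
    rw [← Real.rpow_natCast, ← Real.rpow_mul hT.le, ← Real.rpow_add hT]
    congr 1; ring
  have h4 : T = T ^ (1 - αT) * T ^ αT := by
    rw [← Real.rpow_add hT, sub_add_cancel, Real.rpow_one]
  have h5 := Real.rpow_pos_of_pos hT (γ * (d - αS))
  have h6 := Real.rpow_pos_of_pos hT (1 - αT)
  rw [h3]
  nth_rewrite 2 [h4]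
  unfold normalizer scaling
  field_simp

lemma integral_Icc_scale (f : ℝ → ℝ) {T : ℝ} (hT : 0 < T) :
    ∫ t in Icc (-T) T, f t = T * ∫ s in Icc (-1 : ℝ) 1, f (T * s) := by
  rw [integral_Icc_eq_integral_Ioc, integral_Icc_eq_integral_Ioc,
    ← intervalIntegral.integral_of_le (by linarith),
    ← intervalIntegral.integral_of_le (by norm_num), intervalIntegral.mul_integral_comp_mul_left]
  simp

lemma integral_surfaceMeasure {f : E d → ℝ} (hf : StronglyMeasurable f) {R : ℝ} (hR : 0 ≤ R) :
    ∫ x, f x ∂(surfaceMeasure d R) = R ^ d * ∫ u : Sph d, f (R • (u : E d)) ∂(unitSurface d) := by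
  unfold surfaceMeasure
  rw [integral_smul_measure, integral_map (by fun_prop) hf.aestronglyMeasurable,
    ENNReal.toReal_ofReal (by positivity), smul_eq_mul]

/-- The rescaled field on the unit domain. -/
lemma IsGaussianSTRF.isUnitGaussianProcess_scaled (hZ : IsGaussianSTRF P d C Z) (γ T : ℝ) :
    IsUnitGaussianProcess (fun p : Sph d × ℝ => Z ((T ^ γ) • (p.1 : E d)) (T * p.2))
      (fun p q => C ‖(T ^ γ) • (p.1 : E d) - (T ^ γ) • (q.1 : E d)‖ |T * p.2 - T * q.2|) P :=
  hZ.isUnitGaussianProcess_comp (f := fun p : Sph d × ℝ => (T ^ γ) • (p.1 : E d))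
    (g := fun p => T * p.2) (by fun_prop) (by fun_prop) (by fun_prop) (by fun_prop)

/-- Merging the iterated integral into one over the product needs integrability of the path, which
holds for almost every `ω`. -/
lemma IsGaussianSTRF.functional_ae_eq [IsProbabilityMeasure P] (hZ : IsGaussianSTRF P d C Z)
    (hL : IsSlowlyVarying L) {T : ℝ} (hT : 0 < T) :
    ∀ᵐ ω ∂P, functional d γ αT αS L Z T ω = scaling γ αT αS L T *
      ∫ p : Sph d × ℝ, (Z ((T ^ γ) • (p.1 : E d)) (T * p.2) ω ^ 2 - 1) ∂(unitDomain d) := by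
  have hint := (hZ.isUnitGaussianProcess_scaled γ T).integrable_sq_comp (unitDomain d) measurable_id
  simp only [id] at hint
  filter_upwards [hint.prod_left_ae] with ω hω
  have hZm : ∀ t, StronglyMeasurable fun x => Z x t ω ^ 2 - 1 := by
    intro t
    have h1 : Measurable fun x => Z x t ω :=
      hZ.measurable.comp ((measurable_id.prodMk measurable_const).prodMk measurable_const)
    exact ((h1.pow_const 2).sub_const 1).stronglyMeasurable
  rw [functional, integral_Icc_scale _ hT]
  simp_rw [fun s => integral_surfaceMeasure (hZm s) (Real.rpow_nonneg hT.le γ)]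
  rw [integral_const_mul, ← mul_assoc T, ← mul_assoc, hL.div_normalizer hT, unitDomain,
    integral_prod_symm _ hω]

end Functional

/-! ### Limit and domination of the rescaled covariance -/

section Covariance

variable {Ω : Type*} [MeasurableSpace Ω] {P : Measure Ω} {d : ℕ} {C : ℝ → ℝ → ℝ}
  {Z : E d → ℝ → Ω → ℝ} {γ αT αS : ℝ} {L : ℝ → ℝ}

lemma tendsto_scaling_mul_cov (hL : IsSlowlyVarying L) (hA1 : HasSeparableDecay d γ αT αS L C)
    {r τ : ℝ} (hr : 0 < r) (hτ : 0 < τ) :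
    Tendsto (fun T => scaling γ αT αS L T * C (T ^ γ * r) (T * τ)) atTop
      (𝓝 (τ ^ (-αT) * r ^ (-αS))) := by
  have hx : (r • EuclideanSpace.single 0 1 : E d) ≠ 0 := by
    rw [← norm_pos_iff]; simpa [norm_smul] using hr.ne'
  have h1 := hA1 _ hx τ hτ.ne'
  have hpos : ∀ T : ℝ, 0 < T → 0 < L T ∧ 0 < L (T ^ γ) ∧ 0 < T ^ γ := fun T hT =>
    ⟨hL.pos T hT, hL.pos _ (Real.rpow_pos_of_pos hT _), Real.rpow_pos_of_pos hT _⟩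
  have hnorm : ∀ T : ℝ, 0 < T → ‖(T ^ γ) • (r • EuclideanSpace.single 0 1 : E d)‖ = T ^ γ * r := by
    intro T hT
    rw [norm_smul, norm_smul, PiLp.norm_single, norm_one, mul_one,
      Real.norm_of_nonneg (hpos T hT).2.2.le, Real.norm_of_nonneg hr.le]
  rw [Asymptotics.isEquivalent_iff_tendsto_one] at h1
  · have h2 := h1.const_mul (τ ^ (-αT) * r ^ (-αS))
    rw [mul_one] at h2
    refine h2.congr' ?_
    filter_upwards [eventually_gt_atTop 0] with T hT
    obtain ⟨h3, h4, h5⟩ := hpos T hT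
    simp only [Pi.div_apply]
    rw [hnorm T hT, abs_of_pos (mul_pos hT hτ), Real.mul_rpow hT.le hτ.le,
      Real.mul_rpow h5.le hr.le, ← Real.rpow_mul hT.le, Real.rpow_neg hτ.le, Real.rpow_neg hr.le,
      scaling]
    have := Real.rpow_pos_of_pos hT (γ * αS)
    have := Real.rpow_pos_of_pos hT αT
    have := Real.rpow_pos_of_pos hτ αT
    have := Real.rpow_pos_of_pos hr αS
    field_simp
  · filter_upwards [eventually_gt_atTop 0] with T hT
    obtain ⟨h3, h4, h5⟩ := hpos T hT
    rw [hnorm T hT]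
    have : 0 < |T * τ| := abs_pos.2 (mul_pos hT hτ).ne'
    positivity

/-- A fixed sphere is incompatible with the singular spatial decay of a factorized covariance. -/
lemma radius_exponent_ne_zero (hZ : IsGaussianSTRF P d C Z) (hL : IsSlowlyVarying L)
    (hd : 1 ≤ d) (hαS : 0 < αS) (hA0 : HasDiagonalExpansion d γ C)
    (hA1 : HasSeparableDecay d γ αT αS L C) : γ ≠ 0 := by
  rintro rfl
  have hsep : ∀ r t, 0 ≤ r → r ≤ 2 → 0 ≤ t → C r t = C r 0 * C 0 t := fun r t hr hr2 ht =>
    cov_eq_mul_of_hasDiagonalExpansion hZ hA0 le_rfl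
      (fun T _ => exists_sphere_dist_eq hd (by simp) hr (by simpa using hr2)) ht
  have hlim : ∀ r, 0 < r → r ≤ 2 →
      Tendsto (fun T => C r 0 * (scaling 0 αT αS L T * C 0 T)) atTop (𝓝 (r ^ (-αS))) := by
    intro r hr hr2
    have h1 := tendsto_scaling_mul_cov hL hA1 hr one_pos
    rw [Real.one_rpow, one_mul] at h1
    refine h1.congr' ?_
    filter_upwards [eventually_ge_atTop 0] with T hT
    rw [Real.rpow_zero, one_mul, mul_one, hsep r T hr.le hr2 hT]
    ring
  have h1 := hlim 1 one_pos one_le_two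
  rw [Real.one_rpow] at h1
  have hc : C 1 0 ≠ 0 := by
    intro h
    simp only [h, zero_mul] at h1
    exact zero_ne_one (tendsto_nhds_unique tendsto_const_nhds h1)
  -- The limits at distances `r` and 1 share the same time-dependent factor, which cancels in the
  -- quotient.
  have hratio : ∀ r, 0 < r → r ≤ 2 → r ^ (-αS) = C r 0 / C 1 0 := by
    intro r hr hr2
    refine tendsto_nhds_unique (hlim r hr hr2) ?_
    have h2 := h1.const_mul (C r 0 / C 1 0)
    rw [mul_one] at h2
    refine h2.congr fun T => ?_
    field_simp
  have hc0 : 0 < |C 1 0| := abs_pos.2 hc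
  have hc1 : |C 1 0| ≤ 1 := hZ.abs_cov_le_one zero_le_one le_rfl
  -- Chosen so that the ratio forces `|C r 0| = 2`.
  set r := (|C 1 0| / 2) ^ (1 / αS) with hr
  have hr0 : 0 < r := Real.rpow_pos_of_pos (by positivity) _
  have hr1 : r ≤ 1 := Real.rpow_le_one (by positivity) (by linarith) (by positivity)
  have h3 : r ^ (-αS) = 2 / |C 1 0| := by
    rw [hr, ← Real.rpow_mul (by positivity), mul_neg, one_div_mul_cancel hαS.ne',
      Real.rpow_neg_one, inv_div]
  have h4 := hZ.abs_cov_le_one hr0.le le_rfl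
  have h5 := hratio r hr0 (by linarith)
  rw [h3, div_eq_div_iff hc0.ne' hc] at h5
  have h6 := congrArg abs h5
  rw [abs_mul, abs_mul, abs_abs, abs_two] at h6
  nlinarith

/-- Uniform domination of the rescaled covariance by a slightly more singular kernel. -/
theorem exists_scaling_mul_cov_le (hZ : IsGaussianSTRF P d C Z) (hL : IsSlowlyVarying L)
    (hd : 1 ≤ d) (hγ : 0 < γ) (hαT : 0 < αT) (hαS : 0 < αS) {βT βS : ℝ} (hβT : αT < βT)
    (hβS : αS < βS) (hA0 : HasDiagonalExpansion d γ C) (hA1 : HasSeparableDecay d γ αT αS L C) :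
    ∃ A : ℝ, ∀ᶠ T in atTop, ∀ r τ : ℝ, 0 < r → r ≤ 2 → 0 < τ → τ ≤ 2 →
      |scaling γ αT αS L T * C (T ^ γ * r) (T * τ)| ≤ A * (τ ^ (-βT) * r ^ (-βS)) := by
  -- Since `γ > 0`, every distance `r` is realized on all sufficiently large spheres.
  have hsep : ∀ r t, 0 ≤ r → 0 ≤ t → C r t = C r 0 * C 0 t := by
    intro r t hr ht
    refine cov_eq_mul_of_hasDiagonalExpansion hZ hA0 (T₀ := max 1 (r ^ γ⁻¹)) (le_max_left _ _)
      (fun T hT => ?_) ht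
    have hT0 : 0 < T := zero_lt_one.trans_le ((le_max_left _ _).trans hT)
    have h1 : r ≤ T ^ γ := by
      rw [← Real.rpow_inv_rpow hr hγ.ne']
      exact Real.rpow_le_rpow (Real.rpow_nonneg hr _) ((le_max_right _ _).trans hT) hγ.le
    exact exists_sphere_dist_eq hd (Real.rpow_pos_of_pos hT0 _) hr
      (by linarith [Real.rpow_pos_of_pos hT0 γ])
  have hlim : ∀ r τ, 0 < r → 0 < τ →
      Tendsto (fun T => scaling γ αT αS L T * (C (T ^ γ * r) 0 * C 0 (T * τ))) atTop
        (𝓝 (τ ^ (-αT) * r ^ (-αS))) := by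
    intro r τ hr hτ
    refine (tendsto_scaling_mul_cov hL hA1 hr hτ).congr' ?_
    filter_upwards [eventually_ge_atTop 0] with T hT
    rw [hsep (T ^ γ * r) (T * τ) (by positivity) (by positivity)]
  have hlim1 : Tendsto (fun T => scaling γ αT αS L T * (C (T ^ γ) 0 * C 0 T)) atTop (𝓝 1) := by
    simpa using hlim 1 1 one_pos one_pos
  have hne : ∀ᶠ T in atTop, scaling γ αT αS L T * (C (T ^ γ) 0 * C 0 T) ≠ 0 :=
    hlim1.eventually_ne one_ne_zero
  have hgT : ∀ᶠ T in atTop, C 0 T ≠ 0 := hne.mono fun T h h' => h (by rw [h', mul_zero, mul_zero])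
  have hhT : ∀ᶠ T : ℝ in atTop, C (T ^ γ) 0 ≠ 0 :=
    hne.mono fun T h h' => h (by rw [h', zero_mul, mul_zero])
  -- Substituting `T = ρ ^ (1/γ)` makes the spatial factor regularly varying in its own variable.
  have hρ : Tendsto (fun ρ : ℝ => ρ ^ γ⁻¹) atTop atTop := tendsto_rpow_atTop (inv_pos.2 hγ)
  have hg := exists_potter_bound (g := fun t => C 0 t) (α := αT) (β := βT) ?_ ?_ hαT.le hβT hgT ?_
  rotate_left
  · have h1 : Continuous fun t : ℝ => C 0 |t| := by
      have := hZ.continuous_cov.comp (by fun_prop : Continuous fun x : ℝ => ((0 : ℝ), x))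
      simpa [Function.comp_def] using this
    exact h1.continuousOn.congr fun t ht => by simp only [abs_of_pos (mem_Ioi.1 ht)]
  · exact fun t ht => hZ.abs_cov_le_one le_rfl ht.le
  · intro τ hτ
    -- In the quotient of the limits at `τ` and at 1 the scaling and the spatial factor cancel.
    have h1 := (hlim 1 τ one_pos hτ).div hlim1 one_ne_zero
    rw [Real.one_rpow, mul_one, div_one] at h1
    refine h1.congr' ?_
    filter_upwards [hne] with T hT
    simp only [mul_one, Pi.div_apply]
    have h2 : scaling γ αT αS L T ≠ 0 := left_ne_zero_of_mul hT
    have h3 : C (T ^ γ) 0 ≠ 0 := left_ne_zero_of_mul (right_ne_zero_of_mul hT)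
    rw [mul_div_mul_left _ _ h2, mul_div_mul_left _ _ h3]
  have hh := exists_potter_bound (g := fun r => C r 0) (α := αS) (β := βS) ?_ ?_ hαS.le hβS ?_ ?_
  rotate_left
  · have h1 : Continuous fun t : ℝ => C |t| 0 := by
      have := hZ.continuous_cov.comp (by fun_prop : Continuous fun x : ℝ => (x, (0 : ℝ)))
      simpa [Function.comp_def] using this
    exact h1.continuousOn.congr fun t ht => by simp only [abs_of_pos (mem_Ioi.1 ht)]
  · exact fun t ht => hZ.abs_cov_le_one ht.le le_rfl
  · filter_upwards [hρ.eventually hhT, eventually_ge_atTop 0] with ρ h1 h2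
    rwa [Real.rpow_inv_rpow h2 hγ.ne'] at h1
  · intro r hr
    have h1 := (hlim r 1 hr one_pos).div hlim1 one_ne_zero
    rw [Real.one_rpow, one_mul, div_one] at h1
    refine (h1.comp hρ).congr' ?_
    filter_upwards [hρ.eventually hne, eventually_ge_atTop 0] with ρ hT h2
    simp only [Function.comp_apply, Pi.div_apply, Real.rpow_inv_rpow h2 hγ.ne', mul_one] at hT ⊢
    have h3 := left_ne_zero_of_mul hT
    have h4 := right_ne_zero_of_mul (right_ne_zero_of_mul hT)
    rw [mul_div_mul_left _ _ h3, mul_div_mul_right _ _ h4]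
  obtain ⟨A₁, T₁, hA₁, h₁⟩ := hg
  obtain ⟨A₂, R₁, hA₂, h₂⟩ := hh
  -- The scaling times both factors at unit arguments tends to 1, so the slowly varying functions
  -- drop out and only the two Potter bounds remain.
  have hle : ∀ᶠ T in atTop, |scaling γ αT αS L T * (C (T ^ γ) 0 * C 0 T)| < 2 :=
    hlim1.abs.eventually_lt_const (by norm_num)
  refine ⟨2 * (A₁ * A₂), ?_⟩
  filter_upwards [hle, eventually_ge_atTop T₁, eventually_ge_atTop 0,
    (tendsto_rpow_atTop hγ).eventually_ge_atTop R₁] with T h3 h4 h5 h6 r τ hr hr2 hτ hτ2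
  have h7 := h₁ T h4 τ hτ hτ2
  have h8 := h₂ (T ^ γ) h6 r hr hr2
  rw [hsep (T ^ γ * r) (T * τ) (by positivity) (by positivity), abs_mul, abs_mul]
  rw [abs_mul, abs_mul] at h3
  calc |scaling γ αT αS L T| * (|C (T ^ γ * r) 0| * |C 0 (T * τ)|)
      ≤ |scaling γ αT αS L T| *
        ((A₂ * r ^ (-βS) * |C (T ^ γ) 0|) * (A₁ * τ ^ (-βT) * |C 0 T|)) := by gcongr
    _ = (|scaling γ αT αS L T| * (|C (T ^ γ) 0| * |C 0 T|)) *
        ((A₁ * A₂) * (τ ^ (-βT) * r ^ (-βS))) := by ring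
    _ ≤ 2 * ((A₁ * A₂) * (τ ^ (-βT) * r ^ (-βS))) := by gcongr
    _ = _ := by ring

end Covariance

/-! ### Convergence of cyclic integrals and characteristic functions -/

section Limit

variable {Ω : Type*} [MeasurableSpace Ω] {P : Measure Ω} {d : ℕ}
  {C : ℝ → ℝ → ℝ} {Z : E d → ℝ → Ω → ℝ} {γ αT αS : ℝ} {L : ℝ → ℝ}

/-- The cyclic integrals of the rescaled covariance converge to those of the Riesz kernel. -/
theorem tendsto_integral_cyclicProduct_cov (hZ : IsGaussianSTRF P d C Z) (hL : IsSlowlyVarying L)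
    (hγ : 0 ≤ γ) (hαT : 0 < αT) (hαT' : αT < 1 / 2) (hαS : 0 < αS) (hαS' : αS < (d : ℝ) / 2)
    (hA0 : HasDiagonalExpansion d γ C) (hA1 : HasSeparableDecay d γ αT αS L C) (n : ℕ) :
    Tendsto (fun T => ∫ p, cyclicProduct (fun p q : Sph d × ℝ => scaling γ αT αS L T *
        C ‖(T ^ γ) • (p.1 : E d) - (T ^ γ) • (q.1 : E d)‖ |T * p.2 - T * q.2|) (n + 2) p
        ∂(Measure.pi fun _ : Fin (n + 2) => unitDomain d)) atTop
      (𝓝 (cycleCoeff d αT αS (n + 2))) := by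
  have hd : 1 ≤ d := by
    rw [Nat.one_le_iff_ne_zero]
    rintro rfl
    norm_num at hαS'
    linarith
  have hγ0 : 0 < γ := lt_of_le_of_ne hγ (radius_exponent_ne_zero hZ hL hd hαS hA0 hA1).symm
  -- Room for the loss in the Potter bounds, still within the range of finite cyclic integrals.
  obtain ⟨βT, hβT, hβT'⟩ := exists_between hαT'
  obtain ⟨βS, hβS, hβS'⟩ := exists_between hαS'
  obtain ⟨A, hA⟩ := exists_scaling_mul_cov_le hZ hL hd hγ0 hαT hαS hβT hβS hA0 hA1
  have hscale : ∀ T : ℝ, 0 < T → ∀ p q : Sph d × ℝ,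
      C ‖(T ^ γ) • (p.1 : E d) - (T ^ γ) • (q.1 : E d)‖ |T * p.2 - T * q.2| =
        C (T ^ γ * ‖(p.1 : E d) - (q.1 : E d)‖) (T * |p.2 - q.2|) := by
    intro T hT p q
    rw [← smul_sub, ← mul_sub, norm_smul, abs_mul, abs_of_pos hT,
      Real.norm_of_nonneg (Real.rpow_nonneg hT.le _)]
  have hsub : ∀ p q : Sph d × ℝ, p.1 ≠ q.1 → 0 < ‖(p.1 : E d) - (q.1 : E d)‖ := fun p q h =>
    norm_pos_iff.2 (sub_ne_zero.2 fun h' => h (Subtype.ext h'))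
  refine tendsto_integral_cyclicProduct d (hαT.trans hβT) hβT' (hαS.trans hβS) hβS'
    (F := fun T p q => scaling γ αT αS L T *
      C ‖(T ^ γ) • (p.1 : E d) - (T ^ γ) • (q.1 : E d)‖ |T * p.2 - T * q.2|) ?_ (A := A) ?_ ?_ n
  · exact Eventually.of_forall fun T =>
      ((hZ.isUnitGaussianProcess_scaled γ T).continuous.measurable).const_mul _
  · filter_upwards [hA, eventually_gt_atTop 0] with T h hT p q hp hq h2 h1
    rw [hscale T hT]
    refine h _ _ (hsub p q h1) ?_ (abs_pos.2 (sub_ne_zero.2 h2)) ?_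
    · refine (norm_sub_le _ _).trans ?_
      rw [norm_eq_of_mem_sphere, norm_eq_of_mem_sphere]
      norm_num
    · rw [abs_le]
      constructor <;> linarith [hp.1, hp.2, hq.1, hq.2]
  · intro p q _ _ h2 h1
    have h := tendsto_scaling_mul_cov hL hA1 (hsub p q h1) (abs_pos.2 (sub_ne_zero.2 h2))
    rw [Real.rpow_neg (abs_nonneg _), Real.rpow_neg (norm_nonneg _), ← mul_inv, ← one_div] at h
    refine h.congr' ?_
    filter_upwards [eventually_gt_atTop 0] with T hT
    rw [hscale T hT]

/-- The characteristic functions of the functional converge. -/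
theorem exists_tendsto_charFun_functional [IsProbabilityMeasure P] (hZ : IsGaussianSTRF P d C Z)
    (hL : IsSlowlyVarying L) (hγ : 0 ≤ γ) (hαT : 0 < αT) (hαT' : αT < 1 / 2) (hαS : 0 < αS)
    (hαS' : αS < (d : ℝ) / 2) (hA0 : HasDiagonalExpansion d γ C)
    (hA1 : HasSeparableDecay d γ αT αS L C) :
    ∃ Φ : ℝ → ℂ, IsExponent (cycleCoeff d αT αS) Φ ∧ ∀ ξ : ℝ,
      Tendsto (fun T => charFun (P.map (functional d γ αT αS L Z T)) ξ) atTop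
        (𝓝 (Complex.exp (1 / 2 * Φ ξ))) := by
  -- The discretization has error at most a multiple of `T⁻¹` and controls the first `⌈T⌉₊` power
  -- sums, so every fixed order is eventually covered; for `T ≤ 0` the data are placeholders.
  have hdisc : ∀ T : ℝ, ∃ (n : ℕ) (lam : Fin n → ℝ), (∀ j, 0 ≤ lam j) ∧ (0 < T →
      (∀ ξ : ℝ, ‖charFun (P.map (functional d γ αT αS L Z T)) ξ -
        Complex.exp (1 / 2 * ∑ j, logRem (2 * Complex.I * ξ * lam j))‖ ≤ |ξ| * T⁻¹) ∧
      ∀ m : ℕ, m < ⌈T⌉₊ → |∑ j, lam j ^ (m + 1) - ∫ p : Fin (m + 1) → Sph d × ℝ,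
        cyclicProduct (fun p q : Sph d × ℝ => scaling γ αT αS L T *
          C ‖(T ^ γ) • (p.1 : E d) - (T ^ γ) • (q.1 : E d)‖ |T * p.2 - T * q.2|) (m + 1) p
          ∂(Measure.pi fun _ => unitDomain d)| ≤ T⁻¹) := by
    intro T
    rcases le_or_gt T 0 with hT | hT
    · exact ⟨0, Fin.elim0, fun j => j.elim0, fun h => absurd h hT.not_gt⟩
    obtain ⟨n, lam, h0, h1, h2⟩ := (hZ.isUnitGaussianProcess_scaled γ T).exists_discretization
      (unitDomain d) (hL.scaling_pos (γ := γ) (αT := αT) (αS := αS) hT).le (inv_pos.2 hT) ⌈T⌉₊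
    refine ⟨n, lam, h0, fun _ => ⟨fun ξ => ?_, h2⟩⟩
    have hchar : charFun (P.map (functional d γ αT αS L Z T)) ξ =
        ∫ ω, Complex.exp (Complex.I * ξ * ((scaling γ αT αS L T * ∫ p : Sph d × ℝ,
          (Z ((T ^ γ) • (p.1 : E d)) (T * p.2) ω ^ 2 - 1) ∂(unitDomain d) : ℝ) : ℂ)) ∂P := by
      rw [charFun_apply_real, integral_map (hZ.measurable_functional T).aemeasurable
        (Continuous.aestronglyMeasurable (by fun_prop))]
      refine integral_congr_ae ?_
      filter_upwards [hZ.functional_ae_eq (γ := γ) (αT := αT) (αS := αS) hL hT] with ω hω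
      rw [hω]
      congr 1
      ring
    rw [hchar]
    exact h1 ξ
  choose n lam h0 hlam using hdisc
  have hinv : Tendsto (fun T : ℝ => T⁻¹) atTop (𝓝 0) := tendsto_inv_atTop_zero
  have hpow : ∀ m, Tendsto (fun T => ∑ j, lam T j ^ (m + 2)) atTop
      (𝓝 (cycleCoeff d αT αS (m + 2))) := by
    intro m
    have h1 := tendsto_integral_cyclicProduct_cov hZ hL hγ hαT hαT' hαS hαS' hA0 hA1 m
    refine tendsto_of_tendsto_of_dist h1 ?_
    refine squeeze_zero' (Eventually.of_forall fun _ => dist_nonneg) ?_ hinv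
    filter_upwards [eventually_gt_atTop ((m + 1 : ℕ) : ℝ)] with T hT
    rw [dist_comm, Real.dist_eq]
    exact (hlam T ((Nat.cast_nonneg _).trans_lt hT)).2 (m + 1) (Nat.lt_ceil.2 hT)
  obtain ⟨Φ, hΦ, hlim⟩ := exists_exponent_of_tendsto_powerSums atTop h0 hpow
  refine ⟨Φ, hΦ, fun ξ => ?_⟩
  have h1 : Tendsto (fun T => Complex.exp (1 / 2 * ∑ j, logRem (2 * Complex.I * ξ * lam T j)))
      atTop (𝓝 (Complex.exp (1 / 2 * Φ ξ))) :=
    (Complex.continuous_exp.tendsto _).comp ((hlim ξ).const_mul _)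
  refine tendsto_of_tendsto_of_dist h1 ?_
  have h2 := hinv.const_mul |ξ|
  rw [mul_zero] at h2
  refine squeeze_zero' (Eventually.of_forall fun _ => dist_nonneg) ?_ h2
  filter_upwards [eventually_gt_atTop 0] with T hT
  rw [dist_comm, dist_eq_norm]
  exact (hlam T hT).1 ξ

end Limit

end SphereNCLT

theorem theorem1 {Ω : Type*} [MeasurableSpace Ω] (P : Measure Ω) [IsProbabilityMeasure P]
    (d : ℕ) (γ αT αS : ℝ) (hγ : 0 ≤ γ)
    (hαT : 0 < αT) (hαT' : αT < 1 / 2) (hαS : 0 < αS) (hαS' : αS < (d : ℝ) / 2)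
    (L : ℝ → ℝ) (hL : SphereNCLT.IsSlowlyVarying L)
    (C : ℝ → ℝ → ℝ) (Z : SphereNCLT.E d → ℝ → Ω → ℝ)
    (hZ : SphereNCLT.IsGaussianSTRF P d C Z)
    (hA0 : SphereNCLT.HasDiagonalExpansion d γ C)
    (hA1 : SphereNCLT.HasSeparableDecay d γ αT αS L C)
    (hA2 : SphereNCLT.CyclicDomination d γ αT αS L) :
    (∀ m : ℕ, 2 ≤ m →
      Integrable (SphereNCLT.cyclicProduct (SphereNCLT.rieszKernel d αT αS) m)
        (Measure.pi fun _ : Fin m => SphereNCLT.unitDomain d)) ∧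
    ∃ (μ : Measure ℝ) (_ : IsProbabilityMeasure μ),
      TendstoInDistribution (fun (T : ℝ) (ω : Ω) => SphereNCLT.functional d γ αT αS L Z T ω)
        atTop (fun x : ℝ => x) (fun _ => P) μ ∧
      ∃ Φ : ℝ → ℂ,
        AnalyticOnNhd ℝ Φ univ ∧
        (∃ r : ℝ, 0 < r ∧ ∀ ξ : ℝ, |ξ| < r →
          Summable fun m : ℕ => SphereNCLT.cumulantTerm d αT αS ξ (m + 2)) ∧
        (∀ ξ : ℝ, Summable (fun m : ℕ => SphereNCLT.cumulantTerm d αT αS ξ (m + 2)) →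
          Φ ξ = ∑' m : ℕ, SphereNCLT.cumulantTerm d αT αS ξ (m + 2)) ∧
        ∀ ξ : ℝ, charFun μ ξ = Complex.exp (1 / 2 * Φ ξ) := by
  refine ⟨fun m hm => ?_, ?_⟩
  · obtain ⟨n, rfl⟩ := Nat.exists_eq_add_of_le' hm
    exact SphereNCLT.integrable_cyclicProduct_rieszKernel d hαT hαT' hαS hαS' n
  · obtain ⟨Φ, hΦ, hlim⟩ := SphereNCLT.exists_tendsto_charFun_functional hZ hL hγ hαT hαT' hαS
      hαS' hA0 hA1
    have hcont : ContinuousAt (fun ξ : ℝ => Complex.exp (1 / 2 * Φ ξ)) 0 :=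
      ((hΦ.analytic 0 (mem_univ _)).continuousAt.const_mul _).cexp
    obtain ⟨μ, hμ, hdist, hchar⟩ := SphereNCLT.exists_tendstoInDistribution_of_tendsto_charFun
      (fun T => (hZ.measurable_functional T).aemeasurable) hcont hlim
    exact ⟨μ, hμ, hdist, Φ, hΦ.analytic, hΦ.radius, hΦ.eq_tsum, hchar⟩
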